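/- Setting. Let $\mathbb{R}^{4,2}$ carry its scalar product $\langle\cdot,\cdot\rangle$ of signature $(4,2)$ and fix a point sphere complex $\mathfrak p$, $\langle\mathfrak p,\mathfrak p\rangle=-1$. Oriented spheres are null lines; point spheres are null lines orthogonal to $\mathfrak p$; contact elements are totally null $2$-planes; $c^{\mathfrak p}:=c\cap\mathfrak p^\perp$ is the point sphere of a contact element $c$; spheres $s,t$ intersect orthogonally if $\langle\mathfrak s,\mathfrak t+\langle\mathfrak t,\mathfrak p\rangle\mathfrak p\rangle=0$; $\sigma_{\mathfrak a}(\mathfrak x)=\mathfrak x-2\frac{\langle\mathfrak x,\mathfrak a\rangle}{\langle\mathfrak a,\mathfrak a\rangle}\mathfrak a$ is the Lie inversion with respect to $\mathfrak a$. A circle is given by a $(2,1)$-plane $\gamma\perp\mathfrak p$, the null lines of $\gamma$ being its points; the spheres in $\gamma^\perp$ contain the circle. Let $\mathcal V=I\times J$, where $I,J\subset\mathbb Z$ are (finite or infinite) discrete intervals with at least three elements. A discrete Legendre map $f$ on $\mathcal V$ assigns to each vertex a contact element $f_i$ so that $f_i\cap f_j$ is exactly one sphere (the curvature sphere) for every edge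 $(ij)$ and, for every choice of a point sphere complex, the four point spheres of each face are concircular. It is totally umbilic if all its curvature spheres coincide. It is a discrete channel surface, with circular lines in one coordinate direction, if for each coordinate ribbon in this direction there is a Dupin cyclide, i.e. an orthogonal splitting $\mathbb R^{4,2}=\delta\oplus\delta^\perp$ into two $(2,1)$-planes, such that the curvature spheres of the ribbon on the edges of this direction lie in $\delta$ and those on the edges of the other direction lie in $\delta^\perp$; totally umbilic maps for which, for every choice of a point sphere complex, the point spheres along each coordinate line of this direction lie on a circle are also admitted. A discrete Dupin cyclide is a discrete channel surface with respect to both coordinate directions (in particular, a totally umbilic map with two families of circular coordinate lines is a discrete Dupin cyclide). Two discrete Legendre maps $f,u$ form a Ribaucour pair, and $u$ is a Ribaucour transform of $f$, if $f_i\cap u_i=:r_i$ is a sphere for all $i$. The Ribaucour sphere congruence $r$ is assumed to be nondegenerate: no $r_i$ is a point sphere, adjacent $r_i,r_j$ are not in oriented contact, and the four spheres of each face span a $(2,1)$- or a $(1,2)$-plane. Let $\mathfrak r_i\in r_i$ be normalized by $\langle\mathfrak r_i,\mathfrak p\rangle=1$. The associated circle congruence consists of the circles $\gamma_i=f_i^{\mathfrak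 p}\oplus u_i^{\mathfrak p}\oplus\langle\mathfrak r_i+\mathfrak p\rangle$ that intersect $r_i$ orthogonally in the point spheres of $f_i$ and $u_i$. Its orthogonal surfaces are the discrete Legendre maps $g$ such that, at each vertex, the point sphere of $g_i$ lies on $\gamma_i$ and the spheres of $g_i$ intersect all spheres containing the circle orthogonally, and such that $\sigma_{\mathfrak r_j-\mathfrak r_i}(g_j)=g_i$ for every edge $(ij)$ (i.e. $g$ is parallel for the flat connection of M-Lie inversions determined by the Ribaucour pair). A discrete triply orthogonal system on $I\times J\times K$ consists of three contact element maps $F^1,F^2,F^3$ such that at each vertex $F^1\cap F^2\cap F^3$ is a point sphere, the spheres of different contact elements intersect orthogonally, and adjacent contact elements of the same family share exactly one sphere. Its coordinate surfaces are the restrictions of $F^\mu$ to the slices on which the $\mu$-th coordinate is constant. It is a discrete cyclic system (with circles in the third direction) if all its $F^1$- and $F^2$-coordinate surfaces are discrete channel surfaces with circular lines in the third direction. Theorem. Let $f$ be a discrete Dupin cyclide on $\mathcal V$ and let $u$ be a totally umbilic Ribaucour transform of $f$, with nondegenerate Ribaucour sphere congruence. (1) All orthogonal surfaces of the cyclic circle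 congruence associated to $(f,u)$ are discrete Dupin cyclides. (2) For every discrete interval $K\subset\mathbb Z$ with at least three elements there are families $(g^k)_{k\in K}$ of orthogonal surfaces whose point spheres form a net on $I\times J\times K$ in which adjacent point spheres are distinct. If $f$ is not totally umbilic, then for every such family there is a discrete cyclic system $(F^1,F^2,F^3)$ on $I\times J\times K$ such that, for each $k\in K$, the coordinate surface $F^3(\cdot,\cdot,k)$ is $g^k$ up to a global change of orientation, and all coordinate surfaces of the system are discrete Dupin cyclides. -/

import Mathlib

open Module

/-- The vector space underlying `ℝ^{4,2}`. -/
abbrev R42 : Type := Fin 6 → ℝ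

/-- The scalar product of signature `(4,2)` on `ℝ^{4,2}`. -/
noncomputable def lieForm : LinearMap.BilinForm ℝ R42 :=
  Matrix.toBilin' (Matrix.diagonal ![1, 1, 1, 1, -1, -1])

/-- Orthogonal complement of a subspace of `ℝ^{4,2}`. -/
noncomputable def perp (W : Submodule ℝ R42) : Submodule ℝ R42 := lieForm.orthogonal W

/-- `W` is a nondegenerate subspace of signature `(a,b)`: it has an orthonormal basis of
`a` spacelike and `b` timelike unit vectors. -/
def HasSignature (W : Submodule ℝ R42) (a b : ℕ) : Prop :=
  ∃ e : Fin a ⊕ Fin b → R42, W = Submodule.span ℝ (Set.range e) ∧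
    (∀ i j, i ≠ j → lieForm (e i) (e j) = 0) ∧
    (∀ i, lieForm (e (Sum.inl i)) (e (Sum.inl i)) = 1) ∧
    (∀ i, lieForm (e (Sum.inr i)) (e (Sum.inr i)) = -1)

/-- All vectors of `W` are null and mutually orthogonal. -/
def IsTotallyNull (W : Submodule ℝ R42) : Prop :=
  ∀ x ∈ W, ∀ y ∈ W, lieForm x y = 0

/-- An oriented 2-sphere: a point of the projective light cone, seen as a null line. -/
def IsSphere (s : Submodule ℝ R42) : Prop := finrank ℝ s = 1 ∧ IsTotallyNull s

/-- A contact element: a null 2-plane (a line in the Lie quadric). -/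
def IsContactElement (c : Submodule ℝ R42) : Prop := finrank ℝ c = 2 ∧ IsTotallyNull c

/-- The point sphere of a contact element with respect to the point sphere complex `p`. -/
noncomputable def pointSphere (p : R42) (c : Submodule ℝ R42) : Submodule ℝ R42 :=
  c ⊓ perp (Submodule.span ℝ {p})

/-- The Lie inversion `x ↦ x - 2 ⟨x,a⟩ / ⟨a,a⟩ a` (used for `⟨a,a⟩ ≠ 0` only). -/
noncomputable def lieInversion (a : R42) : R42 →ₗ[ℝ] R42 :=
  LinearMap.id - (2 / lieForm a a) • (lieForm.flip a).smulRight a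

/-- The spheres spanned by the null vectors `s`, `t` intersect orthogonally with respect to the
point sphere complex `p` (if one of them is a point sphere: it lies on the other sphere). -/
def OrthogonalSpheres (p s t : R42) : Prop :=
  lieForm s (t + lieForm t p • p) = 0

/-- A discrete interval of `ℤ` (finite or infinite) with at least three vertices. -/
def IsDiscreteInterval (I : Set ℤ) : Prop := I.OrdConnected ∧ 3 ≤ I.encard

/-- Discrete Legendre maps on the vertex set `I × J`: any two adjacent contact elements share
exactly one sphere (the curvature sphere of the edge) and, for any choice of a point sphere
complex `q`, the point sphere map is a circular net. -/
structure IsLegendre (I J : Set ℤ) (f : ℤ → ℤ → Submodule ℝ R42) : Prop where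
  contact : ∀ m ∈ I, ∀ n ∈ J, IsContactElement (f m n)
  edge₁ : ∀ m n, m ∈ I → m + 1 ∈ I → n ∈ J → IsSphere (f m n ⊓ f (m + 1) n)
  edge₂ : ∀ m n, m ∈ I → n ∈ J → n + 1 ∈ J → IsSphere (f m n ⊓ f m (n + 1))
  circular : ∀ m n, m ∈ I → m + 1 ∈ I → n ∈ J → n + 1 ∈ J →
    ∀ q : R42, lieForm q q = -1 →
      finrank ℝ ↥(pointSphere q (f m n) ⊔ pointSphere q (f (m + 1) n) ⊔
        pointSphere q (f m (n + 1)) ⊔ pointSphere q (f (m + 1) (n + 1))) ≤ 3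

/-- Totally umbilic discrete Legendre maps: all curvature spheres coincide. -/
def IsTotallyUmbilic (I J : Set ℤ) (f : ℤ → ℤ → Submodule ℝ R42) : Prop :=
  IsLegendre I J f ∧ ∃ s : Submodule ℝ R42, IsSphere s ∧
    (∀ m n, m ∈ I → m + 1 ∈ I → n ∈ J → f m n ⊓ f (m + 1) n = s) ∧
    (∀ m n, m ∈ I → n ∈ J → n + 1 ∈ J → f m n ⊓ f m (n + 1) = s)

/-- A family of contact elements along a coordinate line whose point spheres are, for any choice
of a point sphere complex `q`, concircular. -/
def IsCircularLine (I : Set ℤ) (c : ℤ → Submodule ℝ R42) : Prop :=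
  ∀ q : R42, lieForm q q = -1 → finrank ℝ ↥(⨆ m ∈ I, pointSphere q (c m)) ≤ 3

/-- Each coordinate ribbon in the first direction, between the lines `n` and `n + 1`, admits a
constant Lie cyclide: a Dupin cyclide, given by an orthogonal splitting into two planes `δ` and
`perp δ` of signature `(2,1)`, such that the curvature spheres on the edges of the first direction
belong to one family, and those on the edges of the second direction to the other family of
curvature spheres of the cyclide. -/
def HasConstantLieCyclides (I J : Set ℤ) (f : ℤ → ℤ → Submodule ℝ R42) : Prop :=
  ∀ n, n ∈ J → n + 1 ∈ J → ∃ δ : Submodule ℝ R42,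
    HasSignature δ 2 1 ∧ HasSignature (perp δ) 2 1 ∧
    (∀ m, m ∈ I → m + 1 ∈ I →
      f m n ⊓ f (m + 1) n ≤ δ ∧ f m (n + 1) ⊓ f (m + 1) (n + 1) ≤ δ) ∧
    (∀ m ∈ I, f m n ⊓ f m (n + 1) ≤ perp δ)

/-- Discrete channel surfaces whose coordinate lines in the first direction are the circular ones.
Totally umbilic maps with circular lines in the first direction are included. -/
def IsChannelSurface (I J : Set ℤ) (f : ℤ → ℤ → Submodule ℝ R42) : Prop :=
  IsLegendre I J f ∧
    (HasConstantLieCyclides I J f ∨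
      (IsTotallyUmbilic I J f ∧ ∀ n ∈ J, IsCircularLine I (fun m => f m n)))

/-- Discrete Dupin cyclides: discrete channel surfaces with respect to both coordinate directions
(including totally umbilic maps with two families of circular coordinate lines). -/
def IsDupinCyclide (I J : Set ℤ) (f : ℤ → ℤ → Submodule ℝ R42) : Prop :=
  IsChannelSurface I J f ∧ IsChannelSurface J I (fun n m => f m n)

/-- `(f, u)` is a discrete Ribaucour pair enveloping the sphere congruence `r`, which is
nondegenerate and contains no point spheres; `r` is given by its homogeneous coordinates with
`⟨r, p⟩ = 1`. -/
structure IsRibaucourPair (p : R42) (I J : Set ℤ) (f u : ℤ → ℤ → Submodule ℝ R42)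
    (r : ℤ → ℤ → R42) : Prop where
  legendre_left : IsLegendre I J f
  legendre_right : IsLegendre I J u
  envelop : ∀ m ∈ I, ∀ n ∈ J, f m n ⊓ u m n = Submodule.span ℝ {r m n}
  normalized : ∀ m ∈ I, ∀ n ∈ J, lieForm (r m n) p = 1
  edge₁ : ∀ m n, m ∈ I → m + 1 ∈ I → n ∈ J → lieForm (r m n) (r (m + 1) n) ≠ 0
  edge₂ : ∀ m n, m ∈ I → n ∈ J → n + 1 ∈ J → lieForm (r m n) (r m (n + 1)) ≠ 0
  face : ∀ m n, m ∈ I → m + 1 ∈ I → n ∈ J → n + 1 ∈ J →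
    HasSignature (Submodule.span ℝ {r m n, r (m + 1) n, r m (n + 1), r (m + 1) (n + 1)}) 2 1 ∨
    HasSignature (Submodule.span ℝ {r m n, r (m + 1) n, r m (n + 1), r (m + 1) (n + 1)}) 1 2

/-- The circle (its plane `γ`, the point spheres of the circle being the null lines of `γ`) of the
circle congruence associated to a Ribaucour pair: it intersects the sphere `ρ`, `⟨ρ, p⟩ = 1`,
orthogonally in the point spheres of the contact elements `c` and `c'`. -/
noncomputable def associatedCircle (p : R42) (c c' : Submodule ℝ R42) (ρ : R42) :
    Submodule ℝ R42 :=
  pointSphere p c ⊔ pointSphere p c' ⊔ Submodule.span ℝ {ρ + p}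

/-- A contact element `c` is orthogonal to the circle `(γ, perp γ)`: its point sphere lies on the
circle and its spheres intersect all the spheres that contain the circle orthogonally. -/
def IsOrthogonalToCircle (p : R42) (γ c : Submodule ℝ R42) : Prop :=
  pointSphere p c ≤ γ ∧
    ∀ s ∈ c, ∀ t ∈ perp γ, lieForm t t = 0 → OrthogonalSpheres p s t

/-- Orthogonal surfaces of the cyclic circle congruence associated to a Ribaucour pair: discrete
Legendre maps that are orthogonal to the associated circles and whose adjacent contact elements
are mapped to each other by the flat connection of the Ribaucour pair, that is, by the M-Lie
inversions in the linear sphere complexes `r j - r i`. -/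
structure IsOrthogonalSurface (p : R42) (I J : Set ℤ) (f u : ℤ → ℤ → Submodule ℝ R42)
    (r : ℤ → ℤ → R42) (g : ℤ → ℤ → Submodule ℝ R42) : Prop where
  legendre : IsLegendre I J g
  orthogonal : ∀ m ∈ I, ∀ n ∈ J,
    IsOrthogonalToCircle p (associatedCircle p (f m n) (u m n) (r m n)) (g m n)
  parallel₁ : ∀ m n, m ∈ I → m + 1 ∈ I → n ∈ J →
    (g (m + 1) n).map (lieInversion (r (m + 1) n - r m n)) = g m n
  parallel₂ : ∀ m n, m ∈ I → n ∈ J → n + 1 ∈ J →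
    (g m (n + 1)).map (lieInversion (r m (n + 1) - r m n)) = g m n

/-- A discrete family of orthogonal surfaces `g k`, `k ∈ K`, whose point spheres form a net on
`I × J × K` in which adjacent point spheres are distinct. -/
structure IsRegularFamily (p : R42) (I J K : Set ℤ) (f u : ℤ → ℤ → Submodule ℝ R42)
    (r : ℤ → ℤ → R42) (g : ℤ → ℤ → ℤ → Submodule ℝ R42) : Prop where
  surface : ∀ k ∈ K, IsOrthogonalSurface p I J f u r (g k)
  distinct₁ : ∀ m n k, m ∈ I → m + 1 ∈ I → n ∈ J → k ∈ K →
    pointSphere p (g k m n) ≠ pointSphere p (g k (m + 1) n)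
  distinct₂ : ∀ m n k, m ∈ I → n ∈ J → n + 1 ∈ J → k ∈ K →
    pointSphere p (g k m n) ≠ pointSphere p (g k m (n + 1))
  distinct₃ : ∀ m n k, m ∈ I → n ∈ J → k ∈ K → k + 1 ∈ K →
    pointSphere p (g k m n) ≠ pointSphere p (g (k + 1) m n)

/-- Discrete triply orthogonal systems `F = (F 0, F 1, F 2)` on the vertex set `I × J × K`. -/
structure IsTriplyOrthogonalSystem (p : R42) (I J K : Set ℤ)
    (F : Fin 3 → ℤ → ℤ → ℤ → Submodule ℝ R42) : Prop where
  contact : ∀ μ, ∀ m ∈ I, ∀ n ∈ J, ∀ k ∈ K, IsContactElement (F μ m n k)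
  point : ∀ m ∈ I, ∀ n ∈ J, ∀ k ∈ K,
    IsSphere (F 0 m n k ⊓ F 1 m n k ⊓ F 2 m n k) ∧
      F 0 m n k ⊓ F 1 m n k ⊓ F 2 m n k ≤ perp (Submodule.span ℝ {p})
  orthogonal : ∀ μ ν, μ ≠ ν → ∀ m ∈ I, ∀ n ∈ J, ∀ k ∈ K,
    ∀ s ∈ F μ m n k, ∀ t ∈ F ν m n k, OrthogonalSpheres p s t
  edge₁ : ∀ μ m n k, m ∈ I → m + 1 ∈ I → n ∈ J → k ∈ K →
    IsSphere (F μ m n k ⊓ F μ (m + 1) n k)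
  edge₂ : ∀ μ m n k, m ∈ I → n ∈ J → n + 1 ∈ J → k ∈ K →
    IsSphere (F μ m n k ⊓ F μ m (n + 1) k)
  edge₃ : ∀ μ m n k, m ∈ I → n ∈ J → k ∈ K → k + 1 ∈ K →
    IsSphere (F μ m n k ⊓ F μ m n (k + 1))

/-- Discrete cyclic systems, with circular trajectories in the third direction: the coordinate
surfaces `F 0 m` and `F 1 · n` are discrete channel surfaces that intersect along their circular
curvature lines. -/
def IsCyclicSystem (p : R42) (I J K : Set ℤ)
    (F : Fin 3 → ℤ → ℤ → ℤ → Submodule ℝ R42) : Prop :=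
  IsTriplyOrthogonalSystem p I J K F ∧
    (∀ m ∈ I, IsChannelSurface K J (fun k n => F 0 m n k)) ∧
    (∀ n ∈ J, IsChannelSurface K I (fun k m => F 1 m n k))

/-- All coordinate surfaces of `F` are discrete Dupin cyclides. -/
def AllCoordinateSurfacesDupin (I J K : Set ℤ)
    (F : Fin 3 → ℤ → ℤ → ℤ → Submodule ℝ R42) : Prop :=
  (∀ m ∈ I, IsDupinCyclide J K (fun n k => F 0 m n k)) ∧
    (∀ n ∈ J, IsDupinCyclide I K (fun m k => F 1 m n k)) ∧
    (∀ k ∈ K, IsDupinCyclide I J (fun m n => F 2 m n k))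

/-- On `I × J`, the map `g'` coincides with `g` up to a change of the orientation of all
spheres. -/
def EqUpToOrientation (p : R42) (I J : Set ℤ) (g' g : ℤ → ℤ → Submodule ℝ R42) : Prop :=
  (∀ m ∈ I, ∀ n ∈ J, g' m n = g m n) ∨
    (∀ m ∈ I, ∀ n ∈ J, g' m n = (g m n).map (lieInversion p))

/-!
The totally umbilic surface `u` consists of contact elements through one fixed sphere `s`. With the
normalizations `⟨r, p⟩ = 1` and `⟨F, s⟩ = 1`, where `F` lifts the point spheres of `f`, one has
`f = span {F, r}` and `u = span {s, r}`, and across an edge only the sphere `r` changes: the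
curvature sphere of `f` is `F + κ r` at both ends, and the M-Lie inversion of the edge fixes `s`, `p`
and `F + κ r` and exchanges the two spheres `r` (`IsFramedNet`). The contact elements orthogonal to
a circle of the congruence are the null planes of `span {s, r, F, p}`. They form two rulings of a
quadric that are exchanged by the reversal of orientation, and one of them is
`orthElement p s r F a b` with homogeneous parameters `(a, b)`. The M-Lie inversions preserve these
parameters (`map_orthElement`), so every orthogonal surface has constant parameters in one of the
rulings (`exists_eq_orthElement`).

If `a (a - ⟨s, p⟩ b)` does not vanish, the orthogonal surface with parameters `(a, b)` is the image
of `f` under one Lie transformation that depends only on `s`, `p`, `a`, `b` (`orthMap`), and is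
therefore a Dupin cyclide. For the remaining parameters its contact elements share a fixed sphere,
and its coordinate lines are circular because, along a circular line of `f`, the contact elements
share a sphere `D` and the spheres `r` lie in a three-dimensional space (`exists_line`). Adjacent
point spheres of an orthogonal surface coincide only for the zeros of a quadratic polynomial
attached to the edge, so all but countably many parameters can be used in a regular family
(`exists_isRegularFamily`).

Now let `f` be a Dupin cyclide that is not totally umbilic. All its curvature spheres lie in one
splitting `δ ⊕ δ^⊥`, and they are constant along their own coordinate lines: `f m n` contains
`D n` in `δ` and `E m` in `δ^⊥`, normalized by `⟨D, s⟩ = ⟨E, s⟩ = 1` (`exists_splitting`,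
`IsFramedNet.exists_isSplitNet`). The points `E m` lie on the conic `⟨x, s⟩ = 1` of the light cone
of `δ^⊥`. The unit tangents of the conic at two points, oriented oppositely, differ by a multiple of
the difference of the points (`exists_conic_tangent`). Unit tangents `τ m` with alternating
orientation, and likewise `ω n` for the points `D n` in `δ`, are thus parallel directions orthogonal
to all circles at the vertices: each of them determines a sphere through the circle
(`circleSphere`), and the contact elements through a point of the circle and these two spheres
(`tangentElement`) are two of the families of a triply orthogonal system. Each of their coordinate
surfaces is swept out by the circles along one line; it is a Dupin cyclide since the curvature
spheres across the circles lie in the fixed plane `cyclidePlane`, and the spheres containing the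
circles lie in its orthogonal complement, unless the latter all coincide
(`IsCircleFamily.isDupinCyclide`).

The third family consists of the orthogonal surfaces. Contact elements of the same ruling at
different points of a circle are disjoint, but elements of opposite rulings meet. Alternating the
orientation from layer to layer (`alternatingElement`) therefore makes adjacent contact elements
share a sphere, which is why the layers are the given orthogonal surfaces only up to orientation.
-/

/-! ### The scalar product of signature `(4,2)` -/

theorem lieForm_apply (x y : R42) :
    lieForm x y = x 0 * y 0 + x 1 * y 1 + x 2 * y 2 + x 3 * y 3 - x 4 * y 4 - x 5 * y 5 := by
  simp only [lieForm, Matrix.toBilin'_apply, Matrix.diagonal_apply]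
  simp [Fin.sum_univ_six]
  ring

theorem lieForm_comm (x y : R42) : lieForm x y = lieForm y x := by
  rw [lieForm_apply, lieForm_apply]; ring

theorem lieForm_isSymm : lieForm.IsSymm := ⟨fun x y => lieForm_comm x y⟩

theorem lieForm_isRefl : lieForm.IsRefl := lieForm_isSymm.isRefl

theorem lieForm_nondegenerate : lieForm.Nondegenerate := by
  refine (LinearMap.IsRefl.nondegenerate_iff_separatingLeft lieForm_isRefl).2 ?_
  intro x hx
  funext i
  have h := hx (Pi.single i 1)
  rw [lieForm_apply] at h
  fin_cases i <;> simpa [Pi.single_apply] using h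

theorem mem_perp {W : Submodule ℝ R42} {x : R42} : x ∈ perp W ↔ ∀ y ∈ W, lieForm y x = 0 :=
  Iff.rfl

theorem mem_perp_span {S : Set R42} {x : R42} :
    x ∈ perp (Submodule.span ℝ S) ↔ ∀ y ∈ S, lieForm y x = 0 := by
  refine ⟨fun h y hy => h y (Submodule.subset_span hy), fun h y hy => ?_⟩
  induction hy using Submodule.span_induction with
  | mem y hy => exact h y hy
  | zero => simp
  | add y z _ _ hy hz => rw [map_add, LinearMap.add_apply, hy, hz, add_zero]
  | smul c y _ hy => rw [map_smul, LinearMap.smul_apply, hy, smul_zero]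

theorem mem_perp_singleton {x y : R42} :
    x ∈ perp (Submodule.span ℝ {y}) ↔ lieForm x y = 0 := by
  rw [mem_perp_span]; simp [lieForm_comm]

theorem perp_perp (W : Submodule ℝ R42) : perp (perp W) = W :=
  LinearMap.BilinForm.orthogonal_orthogonal lieForm_nondegenerate lieForm_isRefl W

theorem finrank_perp (W : Submodule ℝ R42) : finrank ℝ (perp W) = 6 - finrank ℝ W := by
  have := LinearMap.BilinForm.finrank_orthogonal lieForm_nondegenerate W
  rwa [finrank_fin_fun] at this

/-- A hyperplane that misses a vector of `S` cuts the dimension of `S`. -/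
theorem finrank_inf_perp_le {S : Submodule ℝ R42} {n : ℕ} (hS : finrank ℝ S ≤ n + 1)
    {v w : R42} (hv : v ∈ S) (hvw : lieForm v w ≠ 0) :
    finrank ℝ ↥(S ⊓ perp (Submodule.span ℝ {w})) ≤ n := by
  have hlt : S ⊓ perp (Submodule.span ℝ {w}) < S :=
    lt_of_le_of_ne inf_le_left fun h => hvw (mem_perp_singleton.1 (h.ge hv).2)
  have := Submodule.finrank_lt_finrank_of_lt hlt
  omega

theorem finrank_sup_span_singleton_le {S : Submodule ℝ R42} {n : ℕ} (hS : finrank ℝ S ≤ n)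
    (v : R42) : finrank ℝ ↥(S ⊔ Submodule.span ℝ {v}) ≤ n + 1 :=
  (Submodule.finrank_add_le_finrank_add_finrank _ _).trans
    (add_le_add hS (by
      classical
      simpa using finrank_span_le_card (R := ℝ) ({v} : Set R42)))

theorem finrank_span_quadruple_le (a b c d : R42) :
    finrank ℝ (Submodule.span ℝ {a, b, c, d}) ≤ 4 := by
  classical
  refine (finrank_span_le_card _).trans ?_
  have : ({a, b, c, d} : Set R42).toFinset = ({a, b, c, d} : Finset R42) := by
    ext; simp
  rw [this]
  exact Finset.card_le_four

/-- A negative semidefinite subspace has dimension at most two: some nonzero vector in a higher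
dimensional subspace has vanishing timelike coordinates. -/
theorem exists_relation_of_nonpos {ι : Type*} [Fintype ι] (x : ι → R42)
    (ho : ∀ i j, i ≠ j → lieForm (x i) (x j) = 0) (hx : ∀ i, lieForm (x i) (x i) ≤ 0)
    (hc : 2 < Fintype.card ι) :
    ∃ c : ι → ℝ, c ≠ 0 ∧ ∑ i, c i • x i = 0 := by
  classical
  let T : (ι → ℝ) →ₗ[ℝ] (Fin 2 → ℝ) :=
    (LinearMap.pi ![LinearMap.proj 4, LinearMap.proj 5]).comp (Fintype.linearCombination ℝ x)
  have hk : LinearMap.ker T ≠ ⊥ := LinearMap.ker_ne_bot_of_finrank_lt (by simpa using hc)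
  obtain ⟨c, hcT, hc0⟩ := (Submodule.ne_bot_iff _).1 hk
  refine ⟨c, hc0, ?_⟩
  set v := ∑ i, c i • x i with hv
  have hT : T c = 0 := hcT
  have h4 : v 4 = 0 := by simpa [T, Fintype.linearCombination_apply, hv] using congrFun hT 0
  have h5 : v 5 = 0 := by simpa [T, Fintype.linearCombination_apply, hv] using congrFun hT 1
  have hvv : lieForm v v ≤ 0 := by
    have : lieForm v v = ∑ i, c i ^ 2 * lieForm (x i) (x i) := by
      rw [hv]
      simp only [map_sum, LinearMap.sum_apply, map_smul, LinearMap.smul_apply, smul_eq_mul]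
      refine Finset.sum_congr rfl fun i _ => ?_
      rw [Finset.sum_eq_single i]
      · ring
      · intro j _ hj; rw [ho j i hj]; ring
      · simp
    rw [this]
    exact Finset.sum_nonpos fun i _ => mul_nonpos_of_nonneg_of_nonpos (sq_nonneg _) (hx i)
  rw [lieForm_apply, h4, h5] at hvv
  funext i
  fin_cases i
  · change v 0 = 0
    nlinarith [sq_nonneg (v 0), sq_nonneg (v 1), sq_nonneg (v 2), sq_nonneg (v 3)]
  · change v 1 = 0
    nlinarith [sq_nonneg (v 0), sq_nonneg (v 1), sq_nonneg (v 2), sq_nonneg (v 3)]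
  · change v 2 = 0
    nlinarith [sq_nonneg (v 0), sq_nonneg (v 1), sq_nonneg (v 2), sq_nonneg (v 3)]
  · change v 3 = 0
    nlinarith [sq_nonneg (v 0), sq_nonneg (v 1), sq_nonneg (v 2), sq_nonneg (v 3)]
  · exact h4
  · exact h5

theorem exists_relation_of_nonneg {ι : Type*} [Fintype ι] (x : ι → R42)
    (ho : ∀ i j, i ≠ j → lieForm (x i) (x j) = 0) (hx : ∀ i, 0 ≤ lieForm (x i) (x i))
    (hc : 4 < Fintype.card ι) :
    ∃ c : ι → ℝ, c ≠ 0 ∧ ∑ i, c i • x i = 0 := by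
  classical
  let T : (ι → ℝ) →ₗ[ℝ] (Fin 4 → ℝ) :=
    (LinearMap.pi ![LinearMap.proj 0, LinearMap.proj 1, LinearMap.proj 2,
      LinearMap.proj 3]).comp (Fintype.linearCombination ℝ x)
  have hk : LinearMap.ker T ≠ ⊥ := LinearMap.ker_ne_bot_of_finrank_lt (by simpa using hc)
  obtain ⟨c, hcT, hc0⟩ := (Submodule.ne_bot_iff _).1 hk
  refine ⟨c, hc0, ?_⟩
  set v := ∑ i, c i • x i with hv
  have hT : T c = 0 := hcT
  have h0 : v 0 = 0 := by simpa [T, Fintype.linearCombination_apply, hv] using congrFun hT 0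
  have h1 : v 1 = 0 := by simpa [T, Fintype.linearCombination_apply, hv] using congrFun hT 1
  have h2 : v 2 = 0 := by simpa [T, Fintype.linearCombination_apply, hv] using congrFun hT 2
  have h3 : v 3 = 0 := by simpa [T, Fintype.linearCombination_apply, hv] using congrFun hT 3
  have hvv : 0 ≤ lieForm v v := by
    have : lieForm v v = ∑ i, c i ^ 2 * lieForm (x i) (x i) := by
      rw [hv]
      simp only [map_sum, LinearMap.sum_apply, map_smul, LinearMap.smul_apply, smul_eq_mul]
      refine Finset.sum_congr rfl fun i _ => ?_
      rw [Finset.sum_eq_single i]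
      · ring
      · intro j _ hj; rw [ho j i hj]; ring
      · simp
    rw [this]
    exact Finset.sum_nonneg fun i _ => mul_nonneg (sq_nonneg _) (hx i)
  rw [lieForm_apply, h0, h1, h2, h3] at hvv
  funext i
  fin_cases i
  · exact h0
  · exact h1
  · exact h2
  · exact h3
  · change v 4 = 0
    nlinarith [sq_nonneg (v 4), sq_nonneg (v 5)]
  · change v 5 = 0
    nlinarith [sq_nonneg (v 4), sq_nonneg (v 5)]

/-- Mutually orthogonal vectors that are not null are linearly independent. -/
theorem eq_zero_of_relation {ι : Type*} [Fintype ι] {x : ι → R42}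
    (ho : ∀ i j, i ≠ j → lieForm (x i) (x j) = 0) {c : ι → ℝ} (h : ∑ i, c i • x i = 0) (i : ι)
    (hi : lieForm (x i) (x i) ≠ 0) : c i = 0 := by
  classical
  have := congrArg (fun v => lieForm v (x i)) h
  simp only [map_sum, LinearMap.sum_apply, map_smul, LinearMap.smul_apply, smul_eq_mul, map_zero,
    LinearMap.zero_apply] at this
  rw [Finset.sum_eq_single i (fun j _ hj => by rw [ho j i hj, mul_zero]) (by simp)] at this
  exact (mul_eq_zero.1 this).resolve_right hi

theorem card_le_two_of_neg {ι : Type*} [Fintype ι] (x : ι → R42)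
    (ho : ∀ i j, i ≠ j → lieForm (x i) (x j) = 0) (hx : ∀ i, lieForm (x i) (x i) < 0) :
    Fintype.card ι ≤ 2 := by
  by_contra! hc
  obtain ⟨c, hc0, h⟩ := exists_relation_of_nonpos x ho (fun i => (hx i).le) hc
  exact hc0 (funext fun i => eq_zero_of_relation ho h i (hx i).ne)

theorem card_le_four_of_pos {ι : Type*} [Fintype ι] (x : ι → R42)
    (ho : ∀ i j, i ≠ j → lieForm (x i) (x j) = 0) (hx : ∀ i, 0 < lieForm (x i) (x i)) :
    Fintype.card ι ≤ 4 := by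
  by_contra! hc
  obtain ⟨c, hc0, h⟩ := exists_relation_of_nonneg x ho (fun i => (hx i).le) hc
  exact hc0 (funext fun i => eq_zero_of_relation ho h i (hx i).ne')

/-! ### Subspaces of signature `(2,1)` -/

theorem HasSignature.disjoint_perp {W : Submodule ℝ R42} {a b : ℕ} (h : HasSignature W a b)
    {x : R42} (hx : x ∈ W) (hx' : x ∈ perp W) : x = 0 := by
  obtain ⟨e, rfl, ho, hp, hn⟩ := h
  obtain ⟨c, rfl⟩ := (Submodule.mem_span_range_iff_exists_fun ℝ).1 hx
  have hc : ∀ i, c i = 0 := by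
    intro i
    have h1 := hx' (e i) (Submodule.subset_span ⟨i, rfl⟩)
    simp only [map_sum, map_smul, smul_eq_mul] at h1
    rw [Finset.sum_eq_single i (fun j _ hj => by rw [ho i j hj.symm, mul_zero]) (by simp)] at h1
    refine (mul_eq_zero.1 h1).resolve_right ?_
    rcases i with i | i
    · rw [hp]; norm_num
    · rw [hn]; norm_num
  simp [hc]

theorem HasSignature.linearIndependent {a b : ℕ} {e : Fin a ⊕ Fin b → R42}
    (ho : ∀ i j, i ≠ j → lieForm (e i) (e j) = 0)
    (hp : ∀ i, lieForm (e (Sum.inl i)) (e (Sum.inl i)) = 1)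
    (hn : ∀ i, lieForm (e (Sum.inr i)) (e (Sum.inr i)) = -1) : LinearIndependent ℝ e := by
  refine Fintype.linearIndependent_iff.2 fun c h i => eq_zero_of_relation ho h i ?_
  rcases i with i | i
  · rw [hp]; norm_num
  · rw [hn]; norm_num

theorem HasSignature.finrank_eq {W : Submodule ℝ R42} {a b : ℕ} (h : HasSignature W a b) :
    finrank ℝ W = a + b := by
  obtain ⟨e, rfl, ho, hp, hn⟩ := h
  rw [finrank_span_eq_card (HasSignature.linearIndependent ho hp hn)]
  simp

/-- An orthogonal triple with exactly one timelike member spans a `(2,1)`-plane. -/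
theorem HasSignature.of_orthogonal (x : Fin 3 → R42)
    (ho : ∀ i j, i ≠ j → lieForm (x i) (x j) = 0) (i₀ : Fin 3) (hi₀ : lieForm (x i₀) (x i₀) < 0)
    (hx : ∀ i, i ≠ i₀ → 0 < lieForm (x i) (x i)) :
    HasSignature (Submodule.span ℝ (Set.range x)) 2 1 := by
  obtain ⟨π, hπ⟩ : ∃ π : Fin 2 ⊕ Fin 1 ≃ Fin 3, π (Sum.inr 0) = i₀ := by
    refine ⟨(finSumFinEquiv (m := 2) (n := 1)).trans (Equiv.swap 2 i₀), ?_⟩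
    have : (finSumFinEquiv (m := 2) (n := 1)) (Sum.inr 0) = (2 : Fin 3) := by decide
    rw [Equiv.trans_apply, this, Equiv.swap_apply_left]
  have hne : ∀ i, lieForm (x i) (x i) ≠ 0 := fun i => by
    by_cases h : i = i₀
    · rw [h]; exact hi₀.ne
    · exact (hx i h).ne'
  have hs : ∀ i, √|lieForm (x i) (x i)| ≠ 0 := fun i =>
    (Real.sqrt_pos.2 (abs_pos.2 (hne i))).ne'
  have hsq : ∀ i, √|lieForm (x i) (x i)| * √|lieForm (x i) (x i)| = |lieForm (x i) (x i)| :=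
    fun i => Real.mul_self_sqrt (abs_nonneg _)
  refine ⟨fun j => (√|lieForm (x (π j)) (x (π j))|)⁻¹ • x (π j), ?_, ?_, ?_, ?_⟩
  · apply le_antisymm
    · rw [Submodule.span_le]
      rintro _ ⟨i, rfl⟩
      have hm : (√|lieForm (x i) (x i)|)⁻¹ • x i ∈ Submodule.span ℝ (Set.range
          fun j => (√|lieForm (x (π j)) (x (π j))|)⁻¹ • x (π j)) :=
        Submodule.subset_span ⟨π.symm i, by simp⟩
      have := Submodule.smul_mem _ (√|lieForm (x i) (x i)|) hm
      rwa [smul_smul, mul_inv_cancel₀ (hs i), one_smul] at this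
    · rw [Submodule.span_le]
      rintro _ ⟨j, rfl⟩
      exact Submodule.smul_mem _ _ (Submodule.subset_span ⟨_, rfl⟩)
  · intro i j hij
    simp [ho _ _ (π.injective.ne hij)]
  · intro i
    have hpos := hx (π (Sum.inl i)) (by rw [← hπ]; exact π.injective.ne (by simp))
    have h1 := hs (π (Sum.inl i))
    have h2 := hsq (π (Sum.inl i))
    rw [abs_of_pos hpos] at h1 h2
    simp only [map_smul, LinearMap.smul_apply, smul_eq_mul, abs_of_pos hpos]
    field_simp
    rw [sq, h2]
  · intro i
    have hneg : lieForm (x (π (Sum.inr i))) (x (π (Sum.inr i))) < 0 := by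
      rw [Subsingleton.elim i 0, hπ]; exact hi₀
    have h1 := hs (π (Sum.inr i))
    have h2 := hsq (π (Sum.inr i))
    rw [abs_of_neg hneg] at h1 h2
    simp only [map_smul, LinearMap.smul_apply, smul_eq_mul, abs_of_neg hneg]
    field_simp
    rw [sq, h2, neg_neg]

/-- The orthogonal complement of a `(2,1)`-plane in `ℝ^{4,2}` is a `(2,1)`-plane: an orthogonal
basis of the complement has at most one timelike and at most two spacelike members, since
negative definite subspaces have dimension at most two and positive definite ones at most four. -/
theorem HasSignature.perp {W : Submodule ℝ R42} (h : HasSignature W 2 1) :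
    HasSignature (perp W) 2 1 := by
  have hfr : finrank ℝ (_root_.perp W) = 3 := by rw [finrank_perp, h.finrank_eq]
  have hnd : (lieForm.restrict (_root_.perp W)).Nondegenerate := by
    refine LinearMap.BilinForm.nondegenerate_restrict_of_disjoint_orthogonal _ lieForm_isRefl ?_
    rw [Submodule.disjoint_def]
    intro x hx hx'
    have hx'' : x ∈ W := by
      have : x ∈ _root_.perp (_root_.perp W) := hx'
      rwa [perp_perp] at this
    exact h.disjoint_perp hx'' hx
  obtain ⟨v, hv⟩ := LinearMap.BilinForm.exists_orthogonal_basis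
    (B := lieForm.restrict (_root_.perp W)) ⟨fun x y => lieForm_comm _ _⟩
  let x : Fin 3 → R42 := fun i => (v.reindex (finCongr hfr) i : R42)
  have hxm : ∀ i, x i ∈ _root_.perp W := fun i => (v.reindex (finCongr hfr) i).2
  have hxo : ∀ i j, i ≠ j → lieForm (x i) (x j) = 0 := fun i j hij => by
    have := hv (i := (finCongr hfr).symm i) (j := (finCongr hfr).symm j)
      ((finCongr hfr).symm.injective.ne hij)
    simpa [x] using this
  have hx0 : ∀ i, lieForm (x i) (x i) ≠ 0 := fun i => by
    have := hv.not_isOrtho_basis_self_of_separatingLeft hnd.1 ((finCongr hfr).symm i)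
    simpa [x] using this
  have hspan : _root_.perp W = Submodule.span ℝ (Set.range x) := by
    have h1 : Submodule.span ℝ (Set.range x) =
        (Submodule.span ℝ (Set.range (v.reindex (finCongr hfr)))).map
          (_root_.perp W).subtype := by
      rw [Submodule.map_span, ← Set.range_comp]; rfl
    rw [h1, Basis.span_eq, Submodule.map_top, Submodule.range_subtype]
  obtain ⟨e, rfl, ho, hp, hn⟩ := h
  have hex : ∀ j i, lieForm (e j) (x i) = 0 := fun j i =>
    hxm i (e j) (Submodule.subset_span ⟨j, rfl⟩)
  have hxe : ∀ i j, lieForm (x i) (e j) = 0 := fun i j => by rw [lieForm_comm, hex]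
  obtain ⟨i₀, hi₀⟩ : ∃ i, lieForm (x i) (x i) < 0 := by
    by_contra! hpos
    have := card_le_four_of_pos (Sum.elim (fun i => e (Sum.inl i)) x)
      (by
        rintro (i | i) (j | j) hij
        · exact ho _ _ (by simpa using hij)
        · exact hex _ _
        · exact hxe _ _
        · exact hxo _ _ (by simpa using hij))
      (by
        rintro (i | i)
        · simp [hp]
        · exact lt_of_le_of_ne (hpos i) (hx0 i).symm)
    simp at this
  rw [hspan]
  refine HasSignature.of_orthogonal x hxo i₀ hi₀ fun i hi => ?_
  by_contra! hneg
  have hneg' := lt_of_le_of_ne hneg (hx0 i)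
  have := card_le_two_of_neg ![e (Sum.inr 0), x i₀, x i]
    (by
      have h1 := hxo i i₀ hi
      have h2 := hxo i₀ i (Ne.symm hi)
      intro a b hab
      fin_cases a <;> fin_cases b <;>
        first
        | exact absurd rfl hab
        | simp [hex, hxe, h1, h2])
    (by
      intro a
      fin_cases a
      · simp [hn]
      · exact hi₀
      · exact hneg')
  simp at this

/-! ### Contact elements and spheres -/

theorem linearIndependent_pair_of_lieForm {x y z : R42} (hx : x ≠ 0) (hxz : lieForm x z = 0)
    (hyz : lieForm y z ≠ 0) : LinearIndependent ℝ ![x, y] := by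
  rw [LinearIndependent.pair_iff]
  intro a b h
  have h1 := congrArg (fun v => lieForm v z) h
  simp only [map_add, map_smul, LinearMap.add_apply, LinearMap.smul_apply, smul_eq_mul, hxz,
    mul_zero, zero_add, map_zero, LinearMap.zero_apply, mul_eq_zero, hyz, or_false] at h1
  subst h1
  simpa [hx] using h

theorem finrank_span_pair {x y : R42} (h : LinearIndependent ℝ ![x, y]) :
    finrank ℝ (Submodule.span ℝ {x, y}) = 2 := by
  have := finrank_span_eq_card h
  rwa [Matrix.range_cons, Matrix.range_cons, Matrix.range_empty, Set.union_empty,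
    Set.singleton_union, Fintype.card_fin] at this

theorem isContactElement_span_pair {x y : R42} (h : LinearIndependent ℝ ![x, y])
    (hxx : lieForm x x = 0) (hxy : lieForm x y = 0) (hyy : lieForm y y = 0) :
    IsContactElement (Submodule.span ℝ {x, y}) := by
  refine ⟨finrank_span_pair h, fun u hu v hv => ?_⟩
  obtain ⟨a, b, rfl⟩ := Submodule.mem_span_pair.1 hu
  obtain ⟨c, d, rfl⟩ := Submodule.mem_span_pair.1 hv
  simp [hxx, hxy, hyy, lieForm_comm y x]

theorem IsContactElement.eq_span_pair {c : Submodule ℝ R42} (hc : IsContactElement c) {x y : R42}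
    (h : LinearIndependent ℝ ![x, y]) (hx : x ∈ c) (hy : y ∈ c) :
    c = Submodule.span ℝ {x, y} := by
  refine (Submodule.eq_of_le_of_finrank_eq ?_ ?_).symm
  · rw [Submodule.span_le]
    rintro _ (rfl | rfl)
    · exact hx
    · exact hy
  · rw [finrank_span_pair h, hc.1]

theorem IsContactElement.exists_pair {c : Submodule ℝ R42} (hc : IsContactElement c) :
    ∃ x ∈ c, ∃ y ∈ c, LinearIndependent ℝ ![x, y] := by
  let v := Module.finBasisOfFinrankEq ℝ c hc.1
  refine ⟨v 0, (v 0).2, v 1, (v 1).2, ?_⟩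
  have := v.linearIndependent.map' c.subtype (Submodule.ker_subtype c)
  have h2 : (c.subtype ∘ v : Fin 2 → R42) = ![(v 0 : R42), (v 1 : R42)] := by
    funext i
    fin_cases i <;> rfl
  rwa [h2] at this

/-- Contact elements are maximal totally null subspaces. -/
theorem IsContactElement.mem_of_forall_orthogonal {c : Submodule ℝ R42} (hc : IsContactElement c)
    {v : R42} (hv : lieForm v v = 0) (h : ∀ x ∈ c, lieForm x v = 0) : v ∈ c := by
  obtain ⟨x, hx, y, hy, hxy⟩ := hc.exists_pair
  have hvx : lieForm v x = 0 := by rw [lieForm_comm, h x hx]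
  have hvy : lieForm v y = 0 := by rw [lieForm_comm, h y hy]
  obtain ⟨a, ha, hrel⟩ := exists_relation_of_nonpos ![x, y, v]
    (by
      intro i j _
      fin_cases i <;> fin_cases j <;>
        simp [hv, hc.2 x hx x hx, hc.2 x hx y hy, hc.2 y hy x hx, hc.2 y hy y hy, h x hx, h y hy,
          hvx, hvy])
    (by
      intro i
      fin_cases i <;> simp [hv, hc.2 x hx x hx, hc.2 y hy y hy]) (by simp)
  rw [Fin.sum_univ_three] at hrel
  change a 0 • x + a 1 • y + a 2 • v = 0 at hrel
  have h2 : a 2 ≠ 0 := by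
    intro h2
    rw [h2, zero_smul, add_zero] at hrel
    obtain ⟨h0, h1⟩ := LinearIndependent.pair_iff.1 hxy _ _ hrel
    exact ha (funext fun i => by fin_cases i <;> assumption)
  have : v = (a 2)⁻¹ • (-(a 0 • x + a 1 • y)) := by
    rw [← eq_neg_of_add_eq_zero_right hrel, smul_smul, inv_mul_cancel₀ h2, one_smul]
  rw [this]
  exact c.smul_mem _ (c.neg_mem (c.add_mem (c.smul_mem _ hx) (c.smul_mem _ hy)))

/-- The orthogonal complement of a timelike vector contains no contact element. -/
theorem IsContactElement.exists_lieForm_ne_zero {c : Submodule ℝ R42} (hc : IsContactElement c)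
    {q : R42} (hq : lieForm q q = -1) : ∃ x ∈ c, lieForm x q ≠ 0 := by
  by_contra! h
  obtain ⟨x, hx, y, hy, hxy⟩ := hc.exists_pair
  have hqx : lieForm q x = 0 := by rw [lieForm_comm, h x hx]
  have hqy : lieForm q y = 0 := by rw [lieForm_comm, h y hy]
  have ho : ∀ i j, i ≠ j → lieForm (![x, y, q] i) (![x, y, q] j) = 0 := by
    intro i j hij
    fin_cases i <;> fin_cases j <;>
      first
      | exact absurd rfl hij
      | simp [hc.2 x hx y hy, hc.2 y hy x hx, h x hx, h y hy, hqx, hqy]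
  obtain ⟨a, ha, hrel⟩ := exists_relation_of_nonpos ![x, y, q] ho
    (by
      intro i
      fin_cases i <;> simp [hq, hc.2 x hx x hx, hc.2 y hy y hy]) (by simp)
  have h2 : a 2 = 0 := eq_zero_of_relation ho hrel 2 (by simp [hq])
  rw [Fin.sum_univ_three, h2, zero_smul, add_zero] at hrel
  change a 0 • x + a 1 • y = 0 at hrel
  obtain ⟨h0, h1⟩ := LinearIndependent.pair_iff.1 hxy _ _ hrel
  exact ha (funext fun i => by fin_cases i <;> assumption)

/-- Point spheres of contact elements in a four-dimensional space are concircular as soon as the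
space contains a contact element. -/
theorem finrank_inf_perp_le_three {S c : Submodule ℝ R42} (hS : finrank ℝ S ≤ 4)
    (hc : IsContactElement c) (hcS : c ≤ S) {q : R42} (hq : lieForm q q = -1) :
    finrank ℝ ↥(S ⊓ perp (Submodule.span ℝ {q})) ≤ 3 := by
  obtain ⟨x, hx, hxq⟩ := hc.exists_lieForm_ne_zero hq
  exact finrank_inf_perp_le hS (hcS hx) hxq

theorem isCircularLine_of_le {I : Set ℤ} {c : ℤ → Submodule ℝ R42} {S : Submodule ℝ R42}
    (hS : finrank ℝ S ≤ 4) {m₀ : ℤ} (hm₀ : m₀ ∈ I) (h₀ : IsContactElement (c m₀))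
    (hc : ∀ m ∈ I, c m ≤ S) : IsCircularLine I c := by
  intro q hq
  refine (Submodule.finrank_mono ?_).trans (finrank_inf_perp_le_three hS h₀ (hc _ hm₀) hq)
  exact iSup₂_le fun m hm => inf_le_inf_right _ (hc m hm)

/-- Distinct contact elements with a common nonzero vector share exactly one sphere. -/
theorem inf_eq_span_singleton {c c' : Submodule ℝ R42} (hc : IsContactElement c)
    (hc' : IsContactElement c') (hne : c ≠ c') {x : R42} (hx0 : x ≠ 0) (hx : x ∈ c)
    (hx' : x ∈ c') : c ⊓ c' = Submodule.span ℝ {x} := by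
  have hlt : c ⊓ c' < c := by
    refine lt_of_le_of_ne inf_le_left fun h => hne ?_
    exact Submodule.eq_of_le_of_finrank_eq (inf_eq_left.1 h) (hc.1.trans hc'.1.symm)
  have h1 := Submodule.finrank_lt_finrank_of_lt hlt
  rw [hc.1] at h1
  refine (Submodule.eq_of_le_of_finrank_le ?_ ?_).symm
  · rw [Submodule.span_singleton_le_iff_mem]; exact ⟨hx, hx'⟩
  · rw [finrank_span_singleton hx0]; omega

theorem isSphere_span_singleton {x : R42} (hx0 : x ≠ 0) (hx : lieForm x x = 0) :
    IsSphere (Submodule.span ℝ {x}) := by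
  refine ⟨finrank_span_singleton hx0, fun u hu v hv => ?_⟩
  obtain ⟨a, rfl⟩ := Submodule.mem_span_singleton.1 hu
  obtain ⟨b, rfl⟩ := Submodule.mem_span_singleton.1 hv
  simp [hx]

theorem IsContactElement.isSphere_inf {c c' : Submodule ℝ R42} (hc : IsContactElement c)
    (hc' : IsContactElement c') (hne : c ≠ c') {x : R42} (hx0 : x ≠ 0) (hx : x ∈ c)
    (hx' : x ∈ c') : IsSphere (c ⊓ c') := by
  rw [inf_eq_span_singleton hc hc' hne hx0 hx hx']
  exact isSphere_span_singleton hx0 (hc.2 x hx x hx)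

theorem IsSphere.eq_span_singleton {s : Submodule ℝ R42} (hs : IsSphere s) {x : R42}
    (hx0 : x ≠ 0) (hx : x ∈ s) : s = Submodule.span ℝ {x} := by
  refine (Submodule.eq_of_le_of_finrank_eq ?_ ?_).symm
  · rwa [Submodule.span_singleton_le_iff_mem]
  · rw [finrank_span_singleton hx0, hs.1]

theorem IsSphere.exists_eq_span {s : Submodule ℝ R42} (hs : IsSphere s) :
    ∃ x, x ≠ 0 ∧ lieForm x x = 0 ∧ s = Submodule.span ℝ {x} := by
  obtain ⟨x, hx, hx0⟩ := s.ne_bot_iff.1 (by rintro rfl; simpa using hs.1)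
  exact ⟨x, hx0, hs.2 x hx x hx, hs.eq_span_singleton hx0 hx⟩

theorem pointSphere_span_pair {p x y : R42} (hx : lieForm x p = 0) (hy : lieForm y p ≠ 0) :
    pointSphere p (Submodule.span ℝ {x, y}) = Submodule.span ℝ {x} := by
  ext v
  simp only [pointSphere, Submodule.mem_inf, mem_perp_singleton, Submodule.mem_span_pair,
    Submodule.mem_span_singleton]
  constructor
  · rintro ⟨⟨a, b, rfl⟩, h⟩
    simp only [map_add, map_smul, LinearMap.add_apply, LinearMap.smul_apply, smul_eq_mul, hx,
      mul_zero, zero_add, mul_eq_zero, hy, or_false] at h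
    exact ⟨a, by rw [h, zero_smul, add_zero]⟩
  · rintro ⟨a, rfl⟩
    exact ⟨⟨a, 0, by simp⟩, by simp [hx]⟩

/-! ### Lie transformations -/

theorem lieInversion_apply (a x : R42) :
    lieInversion a x = x - (2 / lieForm a a * lieForm x a) • a := by
  simp [lieInversion, smul_smul]

theorem lieForm_lieInversion {a : R42} (ha : lieForm a a ≠ 0) (x y : R42) :
    lieForm (lieInversion a x) (lieInversion a y) = lieForm x y := by
  simp only [lieInversion_apply, map_sub, map_smul, LinearMap.sub_apply, LinearMap.smul_apply,
    smul_eq_mul, lieForm_comm a]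
  field_simp
  ring

theorem lieInversion_fixed {a x : R42} (h : lieForm x a = 0) : lieInversion a x = x := by
  rw [lieInversion_apply, h]; simp

theorem lieInversion_sub_right {x y : R42} (hx : lieForm x x = 0) (hy : lieForm y y = 0)
    (hxy : lieForm x y ≠ 0) : lieInversion (y - x) y = x := by
  have h1 : lieForm (y - x) (y - x) = -2 * lieForm x y := by
    simp only [map_sub, LinearMap.sub_apply, hx, hy, lieForm_comm y x]; ring
  have h2 : lieForm y (y - x) = -lieForm x y := by
    simp only [map_sub, hy, lieForm_comm y x]; ring
  have h3 : 2 / (-2 * lieForm x y) * -lieForm x y = 1 := by field_simp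
  rw [lieInversion_apply, h1, h2, h3, one_smul, sub_sub_cancel]

theorem lieInversion_involutive {a : R42} (ha : lieForm a a ≠ 0) (x : R42) :
    lieInversion a (lieInversion a x) = x := by
  have h1 : 2 / lieForm a a * (lieForm x a - 2 / lieForm a a * lieForm x a * lieForm a a) =
      -(2 / lieForm a a * lieForm x a) := by field_simp; ring
  rw [lieInversion_apply a (lieInversion a x), lieInversion_apply]
  simp only [map_sub, map_smul, LinearMap.sub_apply, LinearMap.smul_apply, smul_eq_mul, h1]
  module

theorem map_lieInversion_map {a : R42} (ha : lieForm a a ≠ 0) (c : Submodule ℝ R42) :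
    (c.map (lieInversion a)).map (lieInversion a) = c := by
  rw [← Submodule.map_comp]
  have : (lieInversion a) ∘ₗ (lieInversion a) = LinearMap.id :=
    LinearMap.ext (lieInversion_involutive ha)
  rw [this, Submodule.map_id]

/-- A linear map that preserves the scalar product, as a linear equivalence. -/
noncomputable def isometryEquiv (T : R42 →ₗ[ℝ] R42) (hT : ∀ x y, lieForm (T x) (T y) = lieForm x y) :
    R42 ≃ₗ[ℝ] R42 :=
  LinearEquiv.ofInjectiveEndo T (by
    rw [← LinearMap.ker_eq_bot, LinearMap.ker_eq_bot']
    intro x hx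
    refine lieForm_nondegenerate.1 x fun y => ?_
    rw [← hT, hx, map_zero, LinearMap.zero_apply])

theorem lieForm_symm_apply {L : R42 ≃ₗ[ℝ] R42} (hL : ∀ x y, lieForm (L x) (L y) = lieForm x y)
    (x y : R42) : lieForm (L.symm x) y = lieForm x (L y) := by
  rw [← hL, L.apply_symm_apply]

theorem isometry_symm {L : R42 ≃ₗ[ℝ] R42} (hL : ∀ x y, lieForm (L x) (L y) = lieForm x y)
    (x y : R42) : lieForm (L.symm x) (L.symm y) = lieForm x y := by
  rw [lieForm_symm_apply hL, L.apply_symm_apply]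

theorem map_perp {L : R42 ≃ₗ[ℝ] R42} (hL : ∀ x y, lieForm (L x) (L y) = lieForm x y)
    (W : Submodule ℝ R42) : (perp W).map (L : R42 →ₗ[ℝ] R42) = perp (W.map (L : R42 →ₗ[ℝ] R42)) := by
  ext x
  rw [Submodule.mem_map_equiv, mem_perp, mem_perp]
  constructor
  · rintro h _ ⟨y, hy, rfl⟩
    have := h y hy
    rw [lieForm_comm, lieForm_symm_apply hL] at this
    rw [lieForm_comm]; exact this
  · intro h y hy
    rw [lieForm_comm, lieForm_symm_apply hL, lieForm_comm]
    exact h _ ⟨y, hy, rfl⟩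

theorem HasSignature.map {L : R42 ≃ₗ[ℝ] R42} (hL : ∀ x y, lieForm (L x) (L y) = lieForm x y)
    {W : Submodule ℝ R42} {a b : ℕ} (h : HasSignature W a b) :
    HasSignature (W.map (L : R42 →ₗ[ℝ] R42)) a b := by
  obtain ⟨e, rfl, ho, hp, hn⟩ := h
  refine ⟨fun i => L (e i), ?_, fun i j hij => ?_, fun i => ?_, fun i => ?_⟩
  · rw [Submodule.map_span, ← Set.range_comp]; rfl
  · rw [hL, ho i j hij]
  · rw [hL, hp]
  · rw [hL, hn]

theorem IsTotallyNull.map {L : R42 ≃ₗ[ℝ] R42} (hL : ∀ x y, lieForm (L x) (L y) = lieForm x y)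
    {W : Submodule ℝ R42} (h : IsTotallyNull W) :
    IsTotallyNull (W.map (L : R42 →ₗ[ℝ] R42)) := by
  rintro _ ⟨x, hx, rfl⟩ _ ⟨y, hy, rfl⟩
  exact (hL x y).trans (h x hx y hy)

theorem IsSphere.map {L : R42 ≃ₗ[ℝ] R42} (hL : ∀ x y, lieForm (L x) (L y) = lieForm x y)
    {W : Submodule ℝ R42} (h : IsSphere W) : IsSphere (W.map (L : R42 →ₗ[ℝ] R42)) :=
  ⟨(LinearEquiv.finrank_map_eq L W).trans h.1, h.2.map hL⟩

theorem IsContactElement.map {L : R42 ≃ₗ[ℝ] R42}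
    (hL : ∀ x y, lieForm (L x) (L y) = lieForm x y)
    {W : Submodule ℝ R42} (h : IsContactElement W) :
    IsContactElement (W.map (L : R42 →ₗ[ℝ] R42)) :=
  ⟨(LinearEquiv.finrank_map_eq L W).trans h.1, h.2.map hL⟩

theorem pointSphere_map {L : R42 ≃ₗ[ℝ] R42} (hL : ∀ x y, lieForm (L x) (L y) = lieForm x y)
    (q : R42) (c : Submodule ℝ R42) :
    pointSphere q (c.map (L : R42 →ₗ[ℝ] R42)) =
      (pointSphere (L.symm q) c).map (L : R42 →ₗ[ℝ] R42) := by
  have : Submodule.span ℝ {q} = (Submodule.span ℝ {L.symm q}).map (L : R42 →ₗ[ℝ] R42) := by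
    rw [Submodule.map_span, Set.image_singleton]; simp
  rw [pointSphere, pointSphere, this, ← map_perp hL,
    Submodule.map_inf _ L.injective]

theorem IsLegendre.map {L : R42 ≃ₗ[ℝ] R42} (hL : ∀ x y, lieForm (L x) (L y) = lieForm x y)
    {I J : Set ℤ} {f g : ℤ → ℤ → Submodule ℝ R42}
    (hg : ∀ m ∈ I, ∀ n ∈ J, g m n = (f m n).map (L : R42 →ₗ[ℝ] R42)) (h : IsLegendre I J f) :
    IsLegendre I J g where
  contact m hm n hn := by rw [hg m hm n hn]; exact (h.contact m hm n hn).map hL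
  edge₁ m n hm hm' hn := by
    rw [hg m hm n hn, hg _ hm' n hn, ← Submodule.map_inf _ L.injective]
    exact (h.edge₁ m n hm hm' hn).map hL
  edge₂ m n hm hn hn' := by
    rw [hg m hm n hn, hg m hm _ hn', ← Submodule.map_inf _ L.injective]
    exact (h.edge₂ m n hm hn hn').map hL
  circular m n hm hm' hn hn' q hq := by
    rw [hg m hm n hn, hg _ hm' n hn, hg m hm _ hn', hg _ hm' _ hn']
    rw [pointSphere_map hL, pointSphere_map hL, pointSphere_map hL, pointSphere_map hL,
      ← Submodule.map_sup, ← Submodule.map_sup, ← Submodule.map_sup, LinearEquiv.finrank_map_eq]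
    exact h.circular m n hm hm' hn hn' _ (by rw [isometry_symm hL, hq])

theorem IsChannelSurface.map {L : R42 ≃ₗ[ℝ] R42}
    (hL : ∀ x y, lieForm (L x) (L y) = lieForm x y)
    {I J : Set ℤ} {f g : ℤ → ℤ → Submodule ℝ R42}
    (hg : ∀ m ∈ I, ∀ n ∈ J, g m n = (f m n).map (L : R42 →ₗ[ℝ] R42))
    (h : IsChannelSurface I J f) : IsChannelSurface I J g := by
  refine ⟨h.1.map hL hg, ?_⟩
  rcases h.2 with hc | ⟨⟨-, s, hs, h1, h2⟩, hl⟩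
  · left
    intro n hn hn'
    obtain ⟨δ, hδ, hδ', he1, he2⟩ := hc n hn hn'
    refine ⟨δ.map (L : R42 →ₗ[ℝ] R42), hδ.map hL, ?_, fun m hm hm' => ⟨?_, ?_⟩, fun m hm => ?_⟩
    · rw [← map_perp hL]; exact hδ'.map hL
    · rw [hg m hm n hn, hg _ hm' n hn, ← Submodule.map_inf _ L.injective]
      exact Submodule.map_mono (he1 m hm hm').1
    · rw [hg m hm _ hn', hg _ hm' _ hn', ← Submodule.map_inf _ L.injective]
      exact Submodule.map_mono (he1 m hm hm').2
    · rw [hg m hm n hn, hg m hm _ hn', ← Submodule.map_inf _ L.injective, ← map_perp hL]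
      exact Submodule.map_mono (he2 m hm)
  · right
    refine ⟨⟨h.1.map hL hg, s.map (L : R42 →ₗ[ℝ] R42), hs.map hL, fun m n hm hm' hn => ?_,
      fun m n hm hn hn' => ?_⟩, fun n hn q hq => ?_⟩
    · rw [hg m hm n hn, hg _ hm' n hn, ← Submodule.map_inf _ L.injective, h1 m n hm hm' hn]
    · rw [hg m hm n hn, hg m hm _ hn', ← Submodule.map_inf _ L.injective, h2 m n hm hn hn']
    · have : ⨆ m ∈ I, pointSphere q (g m n) =
          (⨆ m ∈ I, pointSphere (L.symm q) (f m n)).map (L : R42 →ₗ[ℝ] R42) := by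
        simp only [Submodule.map_iSup]
        exact iSup_congr fun m => iSup_congr fun hm => by rw [hg m hm n hn, pointSphere_map hL]
      rw [this, LinearEquiv.finrank_map_eq]
      exact hl n hn _ (by rw [isometry_symm hL, hq])

/-- Lie transformations map discrete Dupin cyclides to discrete Dupin cyclides. -/
theorem IsDupinCyclide.map {L : R42 ≃ₗ[ℝ] R42}
    (hL : ∀ x y, lieForm (L x) (L y) = lieForm x y)
    {I J : Set ℤ} {f g : ℤ → ℤ → Submodule ℝ R42}
    (hg : ∀ m ∈ I, ∀ n ∈ J, g m n = (f m n).map (L : R42 →ₗ[ℝ] R42))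
    (h : IsDupinCyclide I J f) : IsDupinCyclide I J g :=
  ⟨h.1.map hL hg, h.2.map hL fun n hn m hm => hg m hm n hn⟩

theorem IsDupinCyclide.congr {I J : Set ℤ} {f g : ℤ → ℤ → Submodule ℝ R42}
    (hg : ∀ m ∈ I, ∀ n ∈ J, g m n = f m n) (h : IsDupinCyclide I J f) : IsDupinCyclide I J g :=
  h.map (L := LinearEquiv.refl ℝ R42) (fun _ _ => rfl) fun m hm n hn => by
    rw [hg m hm n hn]; exact (Submodule.map_id _).symm

theorem IsLegendre.swap {I J : Set ℤ} {f : ℤ → ℤ → Submodule ℝ R42} (h : IsLegendre I J f) :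
    IsLegendre J I (fun n m => f m n) where
  contact n hn m hm := h.contact m hm n hn
  edge₁ n m hn hn' hm := h.edge₂ m n hm hn hn'
  edge₂ n m hn hm hm' := h.edge₁ m n hm hm' hn
  circular n m hn hn' hm hm' q hq := by
    have := h.circular m n hm hm' hn hn' q hq
    rwa [sup_right_comm (pointSphere q (f m n))] at this

theorem IsTotallyUmbilic.swap {I J : Set ℤ} {f : ℤ → ℤ → Submodule ℝ R42}
    (h : IsTotallyUmbilic I J f) : IsTotallyUmbilic J I (fun n m => f m n) := by
  obtain ⟨hf, s, hs, h1, h2⟩ := h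
  exact ⟨hf.swap, s, hs, fun n m hn hn' hm => h2 m n hm hn hn',
    fun n m hn hm hm' => h1 m n hm hm' hn⟩

/-- A discrete Legendre map whose contact elements share a sphere is totally umbilic. -/
theorem IsLegendre.isTotallyUmbilic {I J : Set ℤ} {f : ℤ → ℤ → Submodule ℝ R42}
    (h : IsLegendre I J f) {C : R42} (hC : C ≠ 0) (hCC : lieForm C C = 0)
    (hf : ∀ m ∈ I, ∀ n ∈ J, C ∈ f m n) : IsTotallyUmbilic I J f :=
  ⟨h, _, isSphere_span_singleton hC hCC,
    fun m n hm hm' hn => (h.edge₁ m n hm hm' hn).eq_span_singleton hC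
      ⟨hf m hm n hn, hf _ hm' n hn⟩,
    fun m n hm hn hn' => (h.edge₂ m n hm hn hn').eq_span_singleton hC
      ⟨hf m hm n hn, hf m hm _ hn'⟩⟩

/-! ### Discrete intervals -/

theorem IsDiscreteInterval.nonempty {I : Set ℤ} (h : IsDiscreteInterval I) : I.Nonempty := by
  rw [Set.nonempty_iff_ne_empty]
  rintro rfl
  simpa using h.2

theorem IsDiscreteInterval.succ_or_pred {I : Set ℤ} (h : IsDiscreteInterval I) {m : ℤ}
    (hm : m ∈ I) : m + 1 ∈ I ∨ m - 1 ∈ I := by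
  obtain ⟨k, hk, hkm⟩ : ∃ k ∈ I, k ≠ m := by
    by_contra! hall
    have hsub : I ⊆ {m} := hall
    have := (h.2.trans (Set.encard_le_encard hsub))
    rw [Set.encard_singleton] at this
    norm_num at this
  rcases lt_or_gt_of_ne hkm with hlt | hlt
  · exact Or.inr (h.1.out hk hm ⟨by omega, by omega⟩)
  · exact Or.inl (h.1.out hm hk ⟨by omega, by omega⟩)

theorem IsDiscreteInterval.exists_edge {I : Set ℤ} (h : IsDiscreteInterval I) :
    ∃ m, m ∈ I ∧ m + 1 ∈ I := by
  obtain ⟨m, hm⟩ := h.nonempty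
  rcases h.succ_or_pred hm with h' | h'
  · exact ⟨m, hm, h'⟩
  · exact ⟨m - 1, h', by rwa [sub_add_cancel]⟩

theorem IsDiscreteInterval.induction {I : Set ℤ} (h : IsDiscreteInterval I) {P : ℤ → Prop}
    {m₀ : ℤ} (hm₀ : m₀ ∈ I) (h₀ : P m₀) (hP : ∀ m, m ∈ I → m + 1 ∈ I → (P m ↔ P (m + 1))) :
    ∀ m ∈ I, P m := by
  intro m hm
  rcases le_total m₀ m with hle | hle
  · refine Int.leInduction (motive := fun k _ => k ≤ m → P k) (fun _ => h₀) ?_ m hle le_rfl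
    intro k hk ih hkm
    exact (hP k (h.1.out hm₀ hm ⟨hk, by omega⟩) (h.1.out hm₀ hm ⟨by omega, hkm⟩)).1
      (ih (by omega))
  · refine Int.leInductionDown (motive := fun k _ => m ≤ k → P k) (fun _ => h₀) ?_ m hle le_rfl
    intro k hk ih hkm
    refine (hP (k - 1) (h.1.out hm hm₀ ⟨hkm, by omega⟩) ?_).2 ?_
    · rw [sub_add_cancel]; exact h.1.out hm hm₀ ⟨by omega, hk⟩
    · rw [sub_add_cancel]; exact ih (by omega)

/-! ### Contact elements orthogonal to a circle -/

/-- Normalized data of a Ribaucour pair at a vertex: `s` is the common curvature sphere of the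
totally umbilic surface, `r` the enveloped sphere with `⟨r, p⟩ = 1`, and `F` the point sphere of the
other surface with `⟨F, s⟩ = 1`. The contact elements are `span {F, r}` and `span {s, r}`. -/
structure IsVertexFrame (p s r F : R42) : Prop where
  pp : lieForm p p = -1
  ss : lieForm s s = 0
  rr : lieForm r r = 0
  FF : lieForm F F = 0
  rp : lieForm r p = 1
  rs : lieForm r s = 0
  Fp : lieForm F p = 0
  Fr : lieForm F r = 0
  Fs : lieForm F s = 1

/-- The points of the circle through the point spheres `F` and `s - ⟨s, p⟩ r` that intersects `r`
orthogonally, in homogeneous parameters `(a, b)`. -/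
noncomputable def circlePoint (p s r F : R42) (a b : ℝ) : R42 :=
  b ^ 2 • (s - lieForm s p • r) + (2 * a * b) • (r + p) - (2 * a ^ 2) • F

/-- The sphere that the orthogonal contact element with parameters `(a, b)` shares with
`span {s, r}`. -/
noncomputable def orthSphere (p s r : R42) (a b : ℝ) : R42 :=
  b • (s - lieForm s p • r) + a • r

/-- The sphere that the orthogonal contact element with parameters `(a, b)` shares with the
orientation reversal of `span {F, r}`. -/
noncomputable def orthSphere' (p r F : R42) (a b : ℝ) : R42 :=
  (2 * a) • F - b • (r + (2 : ℝ) • p)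

/-- The contact elements orthogonal to the circle form two rulings of a quadric, exchanged by the
reversal of orientation; this is the ruling that contains `span {F, r}`, in homogeneous
parameters. -/
noncomputable def orthElement (p s r F : R42) (a b : ℝ) : Submodule ℝ R42 :=
  Submodule.span ℝ {orthSphere p s r a b, orthSphere' p r F a b}

theorem lieInversion_of_timelike {p : R42} (hp : lieForm p p = -1) (x : R42) :
    lieInversion p x = x + (2 * lieForm x p) • p := by
  rw [lieInversion_apply, hp]; module

/-- Reversal of the orientation of all spheres. -/
noncomputable def reversal {p : R42} (hp : lieForm p p = -1) : R42 ≃ₗ[ℝ] R42 :=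
  isometryEquiv (lieInversion p) (lieForm_lieInversion (by rw [hp]; norm_num))

theorem reversal_isometry {p : R42} (hp : lieForm p p = -1) (x y : R42) :
    lieForm (reversal hp x) (reversal hp y) = lieForm x y :=
  lieForm_lieInversion (by rw [hp]; norm_num) x y

theorem map_reversal {p : R42} (hp : lieForm p p = -1) (c : Submodule ℝ R42) :
    c.map (reversal hp : R42 →ₗ[ℝ] R42) = c.map (lieInversion p) := rfl

theorem pointSphere_map_lieInversion {p : R42} (hp : lieForm p p = -1) (c : Submodule ℝ R42) :
    pointSphere p (c.map (lieInversion p)) = pointSphere p c := by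
  have hp0 : lieForm p p ≠ 0 := by rw [hp]; norm_num
  ext x
  simp only [pointSphere, Submodule.mem_inf, mem_perp_singleton]
  refine and_congr_left fun hx => ⟨?_, fun h => ⟨x, h, lieInversion_fixed hx⟩⟩
  rintro ⟨y, hy, rfl⟩
  have := lieInversion_fixed hx
  rw [lieInversion_involutive hp0] at this
  rw [← this]
  exact hy

theorem circlePoint_eq (p s r F : R42) (a b : ℝ) :
    circlePoint p s r F a b = b • orthSphere p s r a b - a • orthSphere' p r F a b := by
  simp only [circlePoint, orthSphere, orthSphere']; module

theorem circlePoint_mem (p s r F : R42) (a b : ℝ) :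
    circlePoint p s r F a b ∈ orthElement p s r F a b := by
  rw [circlePoint_eq]
  exact sub_mem (Submodule.smul_mem _ _ (Submodule.subset_span (by simp)))
    (Submodule.smul_mem _ _ (Submodule.subset_span (by simp)))

namespace IsVertexFrame

variable {p s r F : R42}

theorem pr (H : IsVertexFrame p s r F) : lieForm p r = 1 := by rw [lieForm_comm, H.rp]
theorem sr (H : IsVertexFrame p s r F) : lieForm s r = 0 := by rw [lieForm_comm, H.rs]
theorem pF (H : IsVertexFrame p s r F) : lieForm p F = 0 := by rw [lieForm_comm, H.Fp]
theorem rF (H : IsVertexFrame p s r F) : lieForm r F = 0 := by rw [lieForm_comm, H.Fr]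
theorem sF (H : IsVertexFrame p s r F) : lieForm s F = 1 := by rw [lieForm_comm, H.Fs]

/-- The scalar product on the span of a vertex frame. -/
theorem lieForm_combination (H : IsVertexFrame p s r F) (x₁ x₂ x₃ x₄ y₁ y₂ y₃ y₄ : ℝ) :
    lieForm (x₁ • s + x₂ • r + x₃ • F + x₄ • p) (y₁ • s + y₂ • r + y₃ • F + y₄ • p) =
      x₁ * y₃ + x₃ * y₁ + x₂ * y₄ + x₄ * y₂ - x₄ * y₄ + lieForm s p * (x₁ * y₄ + x₄ * y₁) := by
  simp only [map_add, map_smul, LinearMap.add_apply, LinearMap.smul_apply, smul_eq_mul, H.pp, H.ss,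
    H.rr, H.FF, H.rp, H.rs, H.Fp, H.Fr, H.Fs, H.pr, H.sr, H.pF, H.rF, H.sF, lieForm_comm p s]
  ring

theorem circlePoint_expand (p s r F : R42) (a b : ℝ) :
    circlePoint p s r F a b =
      b ^ 2 • s + (2 * a * b - lieForm s p * b ^ 2) • r + (-(2 * a ^ 2)) • F + (2 * a * b) • p := by
  simp only [circlePoint]; module

theorem orthSphere_expand (p s r F : R42) (a b : ℝ) :
    orthSphere p s r a b = b • s + (a - lieForm s p * b) • r + (0 : ℝ) • F + (0 : ℝ) • p := by
  simp only [orthSphere]; module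

theorem orthSphere'_expand (p s r F : R42) (a b : ℝ) :
    orthSphere' p r F a b = (0 : ℝ) • s + (-b) • r + (2 * a) • F + (-(2 * b)) • p := by
  simp only [orthSphere']; module

theorem lieForm_combination_p (H : IsVertexFrame p s r F) (x₁ x₂ x₃ x₄ : ℝ) :
    lieForm (x₁ • s + x₂ • r + x₃ • F + x₄ • p) p = x₁ * lieForm s p + x₂ - x₄ := by
  simp only [map_add, map_smul, LinearMap.add_apply, LinearMap.smul_apply, smul_eq_mul, H.pp, H.rp,
    H.Fp]
  ring

theorem combination_eq_zero (H : IsVertexFrame p s r F) {x₁ x₂ x₃ x₄ : ℝ}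
    (h : x₁ • s + x₂ • r + x₃ • F + x₄ • p = 0) : x₁ = 0 ∧ x₂ = 0 ∧ x₃ = 0 ∧ x₄ = 0 := by
  have key : ∀ y₁ y₂ y₃ y₄ : ℝ, x₁ * y₃ + x₃ * y₁ + x₂ * y₄ + x₄ * y₂ - x₄ * y₄ +
      lieForm s p * (x₁ * y₄ + x₄ * y₁) = 0 := fun y₁ y₂ y₃ y₄ => by
    rw [← H.lieForm_combination, h, map_zero, LinearMap.zero_apply]
  have h4 : x₄ = 0 := by simpa using key 0 1 0 0
  have h1 : x₁ = 0 := by simpa using key 0 0 1 0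
  have h3 : x₃ = 0 := by simpa [h4] using key 1 0 0 0
  have h2 : x₂ = 0 := by simpa [h4, h1] using key 0 0 0 1
  exact ⟨h1, h2, h3, h4⟩

theorem circlePoint_p (H : IsVertexFrame p s r F) (a b : ℝ) :
    lieForm (circlePoint p s r F a b) p = 0 := by
  rw [circlePoint_expand, H.lieForm_combination_p]; ring

theorem circlePoint_s (H : IsVertexFrame p s r F) (a b : ℝ) :
    lieForm (circlePoint p s r F a b) s = -2 * a * (a - lieForm s p * b) := by
  simp only [circlePoint, map_add, map_sub, map_smul, LinearMap.add_apply, LinearMap.sub_apply,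
    LinearMap.smul_apply, smul_eq_mul, H.ss, H.rs, H.Fs, lieForm_comm p s]
  ring

theorem circlePoint_self (H : IsVertexFrame p s r F) (a b : ℝ) :
    lieForm (circlePoint p s r F a b) (circlePoint p s r F a b) = 0 := by
  rw [circlePoint_expand, H.lieForm_combination]; ring

theorem circlePoint_ne_zero (H : IsVertexFrame p s r F) {a b : ℝ} (hab : a ≠ 0 ∨ b ≠ 0) :
    circlePoint p s r F a b ≠ 0 := by
  intro h
  rw [circlePoint_expand] at h
  obtain ⟨h1, -, h3, -⟩ := H.combination_eq_zero h
  rcases hab with h | h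
  · exact h (by simpa using h3)
  · exact h (by simpa using h1)

theorem linearIndependent_orthSphere (H : IsVertexFrame p s r F) {a b : ℝ} (hab : a ≠ 0 ∨ b ≠ 0) :
    LinearIndependent ℝ ![orthSphere p s r a b, orthSphere' p r F a b] := by
  rw [LinearIndependent.pair_iff]
  intro x y h
  have h' : (x * b) • s + (x * (a - lieForm s p * b) - y * b) • r + (y * (2 * a)) • F +
      (y * (-(2 * b))) • p = 0 := by
    rw [← h, orthSphere_expand p s r F, orthSphere'_expand p s r F]; module
  obtain ⟨h1, h2, h3, h4⟩ := H.combination_eq_zero h'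
  rcases hab with ha | hb
  · have hy : y = 0 := by simpa [ha] using h3
    subst hy
    refine ⟨?_, rfl⟩
    have : x * a = 0 := by linear_combination h2 + lieForm s p * h1
    exact (mul_eq_zero.1 this).resolve_right ha
  · exact ⟨by simpa [hb] using h1, by simpa [hb] using h4⟩

theorem isContactElement_orthElement (H : IsVertexFrame p s r F) {a b : ℝ}
    (hab : a ≠ 0 ∨ b ≠ 0) : IsContactElement (orthElement p s r F a b) := by
  refine isContactElement_span_pair (H.linearIndependent_orthSphere hab) ?_ ?_ ?_
  · rw [orthSphere_expand p s r F, H.lieForm_combination]; ring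
  · rw [orthSphere_expand p s r F, orthSphere'_expand p s r F, H.lieForm_combination]; ring
  · rw [orthSphere'_expand p s r F, H.lieForm_combination]; ring

theorem pointSphere_orthElement (H : IsVertexFrame p s r F) {a b : ℝ} (hab : a ≠ 0 ∨ b ≠ 0) :
    pointSphere p (orthElement p s r F a b) = Submodule.span ℝ {circlePoint p s r F a b} := by
  obtain ⟨y, hy, hyp⟩ := (H.isContactElement_orthElement hab).exists_lieForm_ne_zero H.pp
  rw [(H.isContactElement_orthElement hab).eq_span_pair
    (linearIndependent_pair_of_lieForm (H.circlePoint_ne_zero hab) (H.circlePoint_p a b) hyp)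
    (circlePoint_mem _ _ _ _ _ _) hy, pointSphere_span_pair (H.circlePoint_p a b) hyp]

/-- Elements of opposite rulings meet. -/
theorem exists_mem_orthElement_reversed (H : IsVertexFrame p s r F) {a b a' b' : ℝ}
    (hab : a ≠ 0 ∨ b ≠ 0) (hab' : a' ≠ 0 ∨ b' ≠ 0) :
    ∃ x, x ≠ 0 ∧ x ∈ orthElement p s r F a b ∧
      x ∈ (orthElement p s r F a' b').map (lieInversion p) := by
  refine ⟨(-b') • orthSphere p s r a b + a' • orthSphere' p r F a b, fun h => ?_, ?_, ?_⟩
  · obtain ⟨h1, h2⟩ := LinearIndependent.pair_iff.1 (H.linearIndependent_orthSphere hab) _ _ h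
    rcases hab' with h | h
    · exact h h2
    · exact h (by simpa using h1)
  · exact Submodule.mem_span_pair.2 ⟨_, _, rfl⟩
  · refine ⟨(-b) • orthSphere p s r a' b' + a • orthSphere' p r F a' b',
      Submodule.mem_span_pair.2 ⟨_, _, rfl⟩, ?_⟩
    have h1 : lieForm ((-b) • orthSphere p s r a' b' + a • orthSphere' p r F a' b') p =
        -(b * a') + a * b' := by
      simp only [orthSphere, orthSphere', map_add, map_sub, map_smul, LinearMap.add_apply,
        LinearMap.sub_apply, LinearMap.smul_apply, smul_eq_mul, H.pp, H.rp, H.Fp]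
      ring
    rw [lieInversion_of_timelike H.pp, h1]
    simp only [orthSphere, orthSphere']
    module

/-- The classification of contact elements orthogonal to the circle. -/
theorem exists_eq_orthElement (H : IsVertexFrame p s r F) {c : Submodule ℝ R42}
    (hc : IsContactElement c) (hcΓ : c ≤ Submodule.span ℝ {s, r, F, p}) :
    ∃ a b : ℝ, (a ≠ 0 ∨ b ≠ 0) ∧ (c = orthElement p s r F a b ∨
      c = (orthElement p s r F a b).map (lieInversion p)) := by
  have hp0 : lieForm p p ≠ 0 := by rw [H.pp]; norm_num
  have hexp : ∀ x ∈ c, ∃ x₁ x₂ x₃ x₄ : ℝ, x₁ • s + x₂ • r + x₃ • F + x₄ • p = x := by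
    intro x hx
    have := hcΓ hx
    rw [Submodule.mem_span_insert] at this
    obtain ⟨x₁, z, hz, rfl⟩ := this
    obtain ⟨x₂, x₃, x₄, rfl⟩ := Submodule.mem_span_triple.1 hz
    exact ⟨x₁, x₂, x₃, x₄, by module⟩
  obtain ⟨y, hy, hyp⟩ := hc.exists_lieForm_ne_zero H.pp
  -- the point sphere of `c` is a point of the circle
  obtain ⟨x, hx, hx0, hxp⟩ : ∃ x ∈ c, x ≠ 0 ∧ lieForm x p = 0 := by
    obtain ⟨v, hv, w, hw, hvw⟩ := hc.exists_pair
    by_cases hwp : lieForm w p = 0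
    · exact ⟨w, hw, hvw.ne_zero 1, hwp⟩
    · refine ⟨lieForm w p • v + (-lieForm v p) • w,
        c.add_mem (c.smul_mem _ hv) (c.smul_mem _ hw), fun h => ?_, ?_⟩
      · exact hwp (LinearIndependent.pair_iff.1 hvw _ _ h).1
      · simp only [map_add, map_smul, LinearMap.add_apply, LinearMap.smul_apply, smul_eq_mul]; ring
  obtain ⟨a, b, hab, hX⟩ : ∃ a b : ℝ, (b = 1 ∨ (b = 0 ∧ a = 1)) ∧
      circlePoint p s r F a b ∈ c := by
    obtain ⟨x₁, x₂, x₃, x₄, rfl⟩ := hexp x hx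
    have hq := hc.2 _ hx _ hx
    rw [H.lieForm_combination] at hq
    rw [H.lieForm_combination_p] at hxp
    have hx2 : x₂ = x₄ - lieForm s p * x₁ := by linear_combination hxp
    subst hx2
    by_cases h1 : x₁ = 0
    · subst h1
      have h4 : x₄ = 0 := by
        have : x₄ ^ 2 = 0 := by linear_combination hq
        exact pow_eq_zero_iff (by norm_num) |>.1 this
      subst h4
      have h3 : x₃ ≠ 0 := by
        rintro rfl
        simp at hx0
      refine ⟨1, 0, Or.inr ⟨rfl, rfl⟩, ?_⟩
      have : circlePoint p s r F 1 0 = (-2 / x₃) • ((0 : ℝ) • s + ((0 : ℝ) - lieForm s p * 0) • r +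
          x₃ • F + (0 : ℝ) • p) := by
        simp only [circlePoint]
        match_scalars <;> field_simp <;> ring
      rw [this]
      exact c.smul_mem _ hx
    · refine ⟨x₄ / (2 * x₁), 1, Or.inl rfl, ?_⟩
      have h3 : x₃ = -x₄ ^ 2 / (2 * x₁) := by
        field_simp
        linear_combination hq
      have : circlePoint p s r F (x₄ / (2 * x₁)) 1 = x₁⁻¹ • (x₁ • s + (x₄ - lieForm s p * x₁) • r +
          x₃ • F + x₄ • p) := by
        rw [circlePoint_expand, h3]
        match_scalars <;> field_simp
      rw [this]
      exact c.smul_mem _ hx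
  have hab' : a ≠ 0 ∨ b ≠ 0 := by
    rcases hab with rfl | ⟨rfl, rfl⟩ <;> simp
  have hli := linearIndependent_pair_of_lieForm (H.circlePoint_ne_zero hab') (H.circlePoint_p a b)
    hyp
  have hG := H.isContactElement_orthElement hab'
  have hG' := hG.map (reversal_isometry H.pp)
  rw [map_reversal] at hG'
  have hXG' : circlePoint p s r F a b ∈ (orthElement p s r F a b).map (lieInversion p) :=
    ⟨_, circlePoint_mem _ _ _ _ _ _, lieInversion_fixed (H.circlePoint_p a b)⟩
  refine ⟨a, b, hab', ?_⟩
  suffices hy' : y ∈ orthElement p s r F a b ∨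
      y ∈ (orthElement p s r F a b).map (lieInversion p) by
    refine hy'.imp (fun h => ?_) fun h => ?_
    · rw [hc.eq_span_pair hli hX hy, hG.eq_span_pair hli (circlePoint_mem _ _ _ _ _ _) h]
    · rw [hc.eq_span_pair hli hX hy, hG'.eq_span_pair hli hXG' h]
  have ht' : ∀ α β : ℝ, α • orthSphere p s r a b + β • orthSphere' p r F a b +
      (2 * (α * a + β * b)) • p ∈ (orthElement p s r F a b).map (lieInversion p) := by
    intro α β
    refine ⟨α • orthSphere p s r a b + β • orthSphere' p r F a b,
      Submodule.mem_span_pair.2 ⟨_, _, rfl⟩, ?_⟩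
    rw [lieInversion_of_timelike H.pp]
    congr 3
    simp only [orthSphere, orthSphere', map_add, map_sub, map_smul, LinearMap.add_apply,
      LinearMap.sub_apply, LinearMap.smul_apply, smul_eq_mul, H.pp, H.rp, H.Fp]
    ring
  obtain ⟨y₁, y₂, y₃, y₄, rfl⟩ := hexp y hy
  have hq := hc.2 _ hy _ hy
  have hXy := hc.2 _ hX _ hy
  rw [circlePoint_expand] at hXy
  rw [H.lieForm_combination] at hq hXy
  -- the two solutions of a quadratic equation correspond to the two rulings
  rcases hab with rfl | ⟨rfl, rfl⟩
  · have h3 : y₃ = 2 * a ^ 2 * y₁ - 2 * a * (y₂ + lieForm s p * y₁) := by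
      linear_combination hXy
    have hfac : (a * y₁ - (y₂ + lieForm s p * y₁ - y₄ / 2)) * (a * y₁ - y₄ / 2) = 0 := by
      rw [h3] at hq
      linear_combination hq / 4
    rcases mul_eq_zero.1 hfac with h | h
    · left
      refine Submodule.mem_span_pair.2 ⟨y₁, -y₄ / 2, ?_⟩
      have h2 : y₂ = a * y₁ - lieForm s p * y₁ + y₄ / 2 := by linear_combination -h
      rw [h3, h2, orthSphere_expand p s r F, orthSphere'_expand p s r F]
      module
    · right
      have h4 : y₄ = 2 * a * y₁ := by linear_combination -2 * h
      convert ht' y₁ (-(y₂ + lieForm s p * y₁ - y₄ / 2)) using 1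
      rw [h3, h4, orthSphere_expand p s r F, orthSphere'_expand p s r F]
      module
  · have h1 : y₁ = 0 := by linear_combination -hXy / 2
    subst h1
    have hfac : y₄ * (2 * y₂ - y₄) = 0 := by linear_combination hq
    rcases mul_eq_zero.1 hfac with h | h
    · left
      refine Submodule.mem_span_pair.2 ⟨y₂, y₃ / 2, ?_⟩
      rw [h, orthSphere_expand p s r F, orthSphere'_expand p s r F]
      module
    · right
      have h4 : y₄ = 2 * y₂ := by linear_combination -h
      convert ht' y₂ (y₃ / 2) using 1
      rw [h4, orthSphere_expand p s r F, orthSphere'_expand p s r F]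
      module

/-- The contact element of a surface orthogonal to a circle lies in the `(2,2)`-space spanned by
the contact elements of the Ribaucour pair. -/
theorem le_span_of_isOrthogonalToCircle (H : IsVertexFrame p s r F) {c : Submodule ℝ R42}
    (hc : ∀ y ∈ c, ∀ t ∈ perp (associatedCircle p (Submodule.span ℝ {F, r})
      (Submodule.span ℝ {s - lieForm s p • r, r}) r), lieForm t t = 0 → OrthogonalSpheres p y t) :
    c ≤ Submodule.span ℝ {s, r, F, p} := by
  intro y hy
  rw [← perp_perp (Submodule.span ℝ {s, r, F, p})]
  intro e he
  rw [mem_perp_span] at he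
  have hse : lieForm s e = 0 := he s (by simp)
  have hre : lieForm r e = 0 := he r (by simp)
  have hFe : lieForm F e = 0 := he F (by simp)
  have hpe : lieForm p e = 0 := he p (by simp)
  have hes : lieForm e s = 0 := by rw [lieForm_comm, hse]
  have her : lieForm e r = 0 := by rw [lieForm_comm, hre]
  have heF : lieForm e F = 0 := by rw [lieForm_comm, hFe]
  have hep : lieForm e p = 0 := by rw [lieForm_comm, hpe]
  -- otherwise `e`, `p` and a timelike vector of the circle would span a negative definite space
  have hee : 0 ≤ lieForm e e := by
    by_contra! hneg
    have h1 : lieForm (s - lieForm s p • r - F) p = 0 := by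
      simp [H.rp, H.Fp]
    have h2 : lieForm (s - lieForm s p • r - F) e = 0 := by simp [hse, hre, hFe]
    have h3 : lieForm (s - lieForm s p • r - F) (s - lieForm s p • r - F) = -2 := by
      simp only [map_sub, map_smul, LinearMap.sub_apply, LinearMap.smul_apply, smul_eq_mul, H.ss,
        H.rr, H.FF, H.rs, H.Fr, H.Fs, H.sr, H.rF, H.sF]
      ring
    have h1' := h1
    have h2' := h2
    rw [lieForm_comm] at h1' h2'
    have := card_le_two_of_neg ![e, p, s - lieForm s p • r - F]
      (by
        intro i j hij
        fin_cases i <;> fin_cases j <;>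
          first
          | exact absurd rfl hij
          | assumption)
      (by
        intro i
        fin_cases i
        · exact hneg
        · change lieForm p p < 0
          rw [H.pp]; norm_num
        · change lieForm (s - lieForm s p • r - F) (s - lieForm s p • r - F) < 0
          rw [h3]; norm_num)
    simp at this
  have hsq := Real.mul_self_sqrt hee
  set ρ := √(lieForm e e)
  have ht : e + ρ • p ∈ perp (associatedCircle p (Submodule.span ℝ {F, r})
      (Submodule.span ℝ {s - lieForm s p • r, r}) r) := by
    rw [associatedCircle, pointSphere_span_pair H.Fp (by rw [H.rp]; norm_num),
      pointSphere_span_pair (by simp [H.rp]) (by rw [H.rp]; norm_num), ← Submodule.span_union,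
      ← Submodule.span_union, mem_perp_span]
    rintro v ((rfl | rfl) | rfl)
    · simp [hFe, H.Fp]
    · simp [hse, hre, H.rp, mul_comm]
    · simp [hre, hpe, H.rp, H.pp]
  have := hc y hy _ ht (by
    simp only [map_add, map_smul, LinearMap.add_apply, LinearMap.smul_apply, smul_eq_mul, hep, hpe,
      H.pp]
    linear_combination -hsq)
  have hp' : lieForm (e + ρ • p) p = -ρ := by simp [hep, H.pp]
  rw [OrthogonalSpheres, hp', neg_smul, add_neg_cancel_right] at this
  rw [lieForm_comm]; exact this

theorem isOrthogonalToCircle_orthElement (H : IsVertexFrame p s r F) {a b : ℝ}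
    (hab : a ≠ 0 ∨ b ≠ 0) :
    IsOrthogonalToCircle p (associatedCircle p (Submodule.span ℝ {F, r})
      (Submodule.span ℝ {s - lieForm s p • r, r}) r) (orthElement p s r F a b) := by
  rw [associatedCircle, pointSphere_span_pair H.Fp (by rw [H.rp]; norm_num),
    pointSphere_span_pair (by simp [H.rp]) (by rw [H.rp]; norm_num), ← Submodule.span_union,
    ← Submodule.span_union]
  constructor
  · rw [H.pointSphere_orthElement hab, Submodule.span_singleton_le_iff_mem, circlePoint]
    refine sub_mem (add_mem ?_ ?_) ?_ <;>
      exact Submodule.smul_mem _ _ (Submodule.subset_span (by simp))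
  · intro y hy t ht _
    rw [mem_perp_span] at ht
    have hFt : lieForm F t = 0 := ht F (by simp)
    have hst : lieForm s t - lieForm s p * lieForm r t = 0 := by
      simpa using ht (s - lieForm s p • r) (by simp)
    have hrt : lieForm r t + lieForm p t = 0 := by simpa using ht (r + p) (by simp)
    obtain ⟨α, β, rfl⟩ := Submodule.mem_span_pair.1 hy
    rw [OrthogonalSpheres, orthSphere, orthSphere']
    simp only [map_add, map_sub, map_smul, LinearMap.add_apply, LinearMap.sub_apply,
      LinearMap.smul_apply, smul_eq_mul, H.rp, H.Fp, H.pp, lieForm_comm t p]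
    linear_combination (2 * β * a) * hFt + (α * b) * hst + (α * a - β * b) * hrt

end IsVertexFrame

/-! ### Parallel transport and Lie transformations of orthogonal surfaces -/

namespace IsVertexFrame

variable {p s r F r' F' : R42}

theorem circlePoint_sub {κ : ℝ} (hκ : F + κ • r = F' + κ • r') (a b : ℝ) :
    circlePoint p s r' F' a b - circlePoint p s r F a b =
      (-(lieForm s p * b ^ 2) + 2 * a * b + 2 * a ^ 2 * κ) • (r' - r) := by
  have : F' = F + κ • r - κ • r' := by rw [hκ]; module
  subst this
  simp only [circlePoint]; module

/-- The M-Lie inversions of the Ribaucour pair preserve the parameters of orthogonal contact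
elements. -/
theorem map_orthElement (H : IsVertexFrame p s r F) (H' : IsVertexFrame p s r' F')
    (hr : lieForm r r' ≠ 0) {κ : ℝ} (hκ : F + κ • r = F' + κ • r') (a b : ℝ) :
    (orthElement p s r' F' a b).map (lieInversion (r' - r)) = orthElement p s r F a b := by
  have h1 : lieInversion (r' - r) r' = r := lieInversion_sub_right H.rr H'.rr hr
  have h2 : lieInversion (r' - r) s = s := lieInversion_fixed (by simp [H.sr, H'.sr])
  have h3 : lieInversion (r' - r) p = p := lieInversion_fixed (by simp [H.pr, H'.pr])
  have h4 : lieInversion (r' - r) F' = F := by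
    have h5 : lieInversion (r' - r) (F + κ • r) = F + κ • r := by
      refine lieInversion_fixed ?_
      rw [map_sub]
      nth_rw 1 [hκ]
      simp [H.Fr, H'.Fr, H.rr, H'.rr]
    have h6 : F' = F + κ • r - κ • r' := by rw [hκ]; module
    rw [h6, map_sub, h5, map_smul, h1]; module
  rw [orthElement, Submodule.map_span, Set.image_pair]
  simp only [orthSphere, orthSphere', map_add, map_sub, map_smul, h1, h2, h3, h4]
  rfl

/-- The Lie transformation that maps the surface `f` to its orthogonal surface with parameters
`(a, b)`, provided that `a (a - ⟨s, p⟩ b)` does not vanish. -/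
noncomputable def orthMap (p s : R42) (a b : ℝ) : R42 →ₗ[ℝ] R42 :=
  LinearMap.id + (b / (a - lieForm s p * b)) • (lieForm.flip p).smulRight s +
    (b ^ 2 / (2 * (a - lieForm s p * b) * a)) • (lieForm.flip s).smulRight s -
    (b / a) • (lieForm.flip s).smulRight p

theorem orthMap_apply (p s : R42) (a b : ℝ) (x : R42) :
    orthMap p s a b x = x + (b / (a - lieForm s p * b) * lieForm x p +
      b ^ 2 / (2 * (a - lieForm s p * b) * a) * lieForm x s) • s - (b / a * lieForm x s) • p := by
  have hflip : ∀ y, lieForm.flip y x = lieForm x y := fun _ => rfl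
  simp only [orthMap, LinearMap.sub_apply, LinearMap.add_apply, LinearMap.id_apply,
    LinearMap.smul_apply, LinearMap.smulRight_apply, hflip]
  module

theorem lieForm_orthMap (hp : lieForm p p = -1) (hs : lieForm s s = 0) {a b : ℝ} (ha : a ≠ 0)
    (ha' : a - lieForm s p * b ≠ 0) (x y : R42) :
    lieForm (orthMap p s a b x) (orthMap p s a b y) = lieForm x y := by
  simp only [orthMap_apply, map_add, map_sub, map_smul, LinearMap.add_apply, LinearMap.sub_apply,
    LinearMap.smul_apply, smul_eq_mul, hp, hs, lieForm_comm p s, lieForm_comm s y,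
    lieForm_comm p y]
  have h1 : lieForm s p * b = a - (a - lieForm s p * b) := by ring
  generalize a - lieForm s p * b = c at *
  field_simp
  linear_combination (-4 * c * b ^ 2 * lieForm x s * lieForm y s -
    4 * c * a * b * (lieForm x s * lieForm y p + lieForm y s * lieForm x p)) * h1

theorem map_orthMap (H : IsVertexFrame p s r F) {a b : ℝ} (ha : a ≠ 0)
    (ha' : a - lieForm s p * b ≠ 0) :
    orthElement p s r F a b = (Submodule.span ℝ {F, r}).map (orthMap p s a b) := by
  have hr : orthMap p s a b ((a - lieForm s p * b) • r) = orthSphere p s r a b := by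
    rw [map_smul, orthMap_apply, H.rp, H.rs, orthSphere]
    match_scalars <;> field_simp <;> ring
  have hF : orthMap p s a b ((2 * a) • F - b • r) = orthSphere' p r F a b := by
    rw [map_sub, map_smul, map_smul, orthMap_apply, orthMap_apply, H.rp, H.rs, H.Fp, H.Fs,
      orthSphere']
    match_scalars <;> field_simp <;> ring
  have hf : IsContactElement (Submodule.span ℝ {F, r}) :=
    isContactElement_span_pair (linearIndependent_pair_of_lieForm
      (fun h => by have := H.Fs; rw [h] at this; simp at this) H.Fp
      (by rw [H.rp]; norm_num)) H.FF H.Fr H.rr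
  have := (hf.map (L := isometryEquiv _ (lieForm_orthMap H.pp H.ss ha ha'))
    (lieForm_orthMap H.pp H.ss ha ha')).eq_span_pair
    (H.linearIndependent_orthSphere (Or.inl ha))
    ⟨_, Submodule.smul_mem _ (a - lieForm s p * b) (Submodule.subset_span (by simp)), hr⟩
    ⟨_, sub_mem (Submodule.smul_mem _ (2 * a) (Submodule.subset_span (by simp)))
      (Submodule.smul_mem _ b (Submodule.subset_span (by simp))), hF⟩
  exact this.symm

end IsVertexFrame

/-! ### Normalized data of a Ribaucour pair with a totally umbilic surface -/

/-- The data of a Ribaucour pair whose second surface is totally umbilic with curvature sphere `s`: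
`F` lifts the point spheres of `f` with `⟨F, s⟩ = 1`, and `r` is the enveloped sphere congruence. -/
structure IsFramedNet (p s : R42) (I J : Set ℤ) (f : ℤ → ℤ → Submodule ℝ R42)
    (r F : ℤ → ℤ → R42) : Prop where
  frame : ∀ m ∈ I, ∀ n ∈ J, IsVertexFrame p s (r m n) (F m n)
  eq_span : ∀ m ∈ I, ∀ n ∈ J, f m n = Submodule.span ℝ {F m n, r m n}
  legendre : IsLegendre I J f
  ne₁ : ∀ m n, m ∈ I → m + 1 ∈ I → n ∈ J → lieForm (r m n) (r (m + 1) n) ≠ 0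
  ne₂ : ∀ m n, m ∈ I → n ∈ J → n + 1 ∈ J → lieForm (r m n) (r m (n + 1)) ≠ 0

/-- Edges of a framed net are parallel: the curvature sphere is `F + κ r` at both ends. -/
theorem exists_curvature {p s r F r' F' : R42} (H : IsVertexFrame p s r F)
    (H' : IsVertexFrame p s r' F') (hr : lieForm r r' ≠ 0)
    (hs : IsSphere (Submodule.span ℝ {F, r} ⊓ Submodule.span ℝ {F', r'})) :
    ∃ κ : ℝ, F + κ • r = F' + κ • r' := by
  obtain ⟨x, hx0, -, hx⟩ := hs.exists_eq_span
  have hx' : x ∈ Submodule.span ℝ {F, r} ⊓ Submodule.span ℝ {F', r'} := by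
    rw [hx]; exact Submodule.mem_span_singleton_self x
  obtain ⟨h1, h2⟩ := hx'
  obtain ⟨a, b, rfl⟩ := Submodule.mem_span_pair.1 h1
  obtain ⟨c, d, h⟩ := Submodule.mem_span_pair.1 h2
  have hca : c = a := by
    have := congrArg (fun v => lieForm v s) h
    simpa [H.Fs, H'.Fs, H.rs, H'.rs] using this
  have hdb : d = b := by
    have := congrArg (fun v => lieForm v p) h
    simpa [H.Fp, H'.Fp, H.rp, H'.rp] using this
  subst hca hdb
  have hc : c ≠ 0 := by
    rintro rfl
    have := congrArg (fun v => lieForm v r') h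
    simp only [zero_smul, zero_add, map_smul, LinearMap.smul_apply, smul_eq_mul, H'.rr,
      mul_zero] at this
    have hd : d = 0 := (mul_eq_zero.1 this.symm).resolve_right hr
    simp [hd] at hx0
  refine ⟨d / c, ?_⟩
  have : c • (F + (d / c) • r) = c • (F' + (d / c) • r') := by
    rw [smul_add, smul_add, smul_smul, smul_smul, mul_div_cancel₀ _ hc, h]
  exact smul_right_injective _ hc this

namespace IsFramedNet

variable {p s : R42} {I J : Set ℤ} {f : ℤ → ℤ → Submodule ℝ R42} {r F : ℤ → ℤ → R42}

theorem swap (h : IsFramedNet p s I J f r F) :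
    IsFramedNet p s J I (fun n m => f m n) (fun n m => r m n) (fun n m => F m n) where
  frame n hn m hm := h.frame m hm n hn
  eq_span n hn m hm := h.eq_span m hm n hn
  legendre := h.legendre.swap
  ne₁ n m hn hn' hm := h.ne₂ m n hm hn hn'
  ne₂ n m hn hm hm' := h.ne₁ m n hm hm' hn

theorem edge₁ (h : IsFramedNet p s I J f r F) {m n : ℤ} (hm : m ∈ I) (hm' : m + 1 ∈ I)
    (hn : n ∈ J) : ∃ κ : ℝ, F m n + κ • r m n = F (m + 1) n + κ • r (m + 1) n := by
  have := h.legendre.edge₁ m n hm hm' hn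
  rw [h.eq_span m hm n hn, h.eq_span _ hm' n hn] at this
  exact exists_curvature (h.frame m hm n hn) (h.frame _ hm' n hn) (h.ne₁ m n hm hm' hn) this

theorem edge₂ (h : IsFramedNet p s I J f r F) {m n : ℤ} (hm : m ∈ I) (hn : n ∈ J)
    (hn' : n + 1 ∈ J) : ∃ κ : ℝ, F m n + κ • r m n = F m (n + 1) + κ • r m (n + 1) :=
  h.swap.edge₁ hn hn' hm

end IsFramedNet

/-- A nondegenerate Ribaucour pair with a totally umbilic surface `u` is a framed net. -/
theorem IsRibaucourPair.exists_isFramedNet {p : R42} (hp : lieForm p p = -1) {I J : Set ℤ}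
    (hI : IsDiscreteInterval I)
    {f u : ℤ → ℤ → Submodule ℝ R42} {r : ℤ → ℤ → R42} (hu : IsTotallyUmbilic I J u)
    (hr : IsRibaucourPair p I J f u r) :
    ∃ (s : R42) (F : ℤ → ℤ → R42), IsFramedNet p s I J f r F ∧
      ∀ m ∈ I, ∀ n ∈ J, u m n = Submodule.span ℝ {s - lieForm s p • r m n, r m n} := by
  obtain ⟨-, S, hS, hu1, hu2⟩ := hu
  obtain ⟨s, hs0, hss, rfl⟩ := hS.exists_eq_span
  have hrf : ∀ m ∈ I, ∀ n ∈ J, r m n ∈ f m n ∧ r m n ∈ u m n := fun m hm n hn => by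
    have : r m n ∈ f m n ⊓ u m n := by
      rw [hr.envelop m hm n hn]; exact Submodule.mem_span_singleton_self _
    exact this
  have hsu : ∀ m ∈ I, ∀ n ∈ J, s ∈ u m n := by
    intro m hm n hn
    rcases hI.succ_or_pred hm with h | h
    · exact ((hu1 m n hm h hn).ge (Submodule.mem_span_singleton_self s)).1
    · have h1 : m - 1 + 1 = m := sub_add_cancel m 1
      have := ((hu1 (m - 1) n h (by rwa [h1]) hn).ge (Submodule.mem_span_singleton_self s)).2
      rwa [h1] at this
  have hsr : ∀ m ∈ I, ∀ n ∈ J, lieForm s (r m n) = 0 := fun m hm n hn =>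
    (hr.legendre_right.contact m hm n hn).2 s (hsu m hm n hn) _ (hrf m hm n hn).2
  have hli : ∀ m ∈ I, ∀ n ∈ J, LinearIndependent ℝ ![s, r m n] := by
    intro m hm n hn
    rcases hI.succ_or_pred hm with h | h
    · exact linearIndependent_pair_of_lieForm hs0 (hsr _ h n hn) (hr.edge₁ m n hm h hn)
    · have h1 : m - 1 + 1 = m := sub_add_cancel m 1
      have h2 := hr.edge₁ (m - 1) n h (by rwa [h1]) hn
      rw [h1, lieForm_comm] at h2
      exact linearIndependent_pair_of_lieForm hs0 (hsr _ h n hn) h2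
  have hF : ∀ m ∈ I, ∀ n ∈ J, ∃ F : R42, IsVertexFrame p s (r m n) F ∧
      f m n = Submodule.span ℝ {F, r m n} := by
    intro m hm n hn
    have hfc := hr.legendre_left.contact m hm n hn
    obtain ⟨hrmf, -⟩ := hrf m hm n hn
    have hrp := hr.normalized m hm n hn
    obtain ⟨v, hv, hvs⟩ : ∃ v ∈ f m n, lieForm v s ≠ 0 := by
      by_contra! h
      have h1 : s ∈ f m n ⊓ u m n := ⟨hfc.mem_of_forall_orthogonal hss h, hsu m hm n hn⟩
      rw [hr.envelop m hm n hn, Submodule.mem_span_singleton] at h1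
      obtain ⟨c, hc⟩ := h1
      have := (LinearIndependent.pair_iff.1 (hli m hm n hn) 1 (-c) (by rw [← hc]; module)).1
      exact one_ne_zero this
    have hFm : (lieForm v s)⁻¹ • (v - lieForm v p • r m n) ∈ f m n :=
      Submodule.smul_mem _ _ (sub_mem hv (Submodule.smul_mem _ _ hrmf))
    have hrs : lieForm (r m n) s = 0 := by rw [lieForm_comm, hsr m hm n hn]
    have H : IsVertexFrame p s (r m n) ((lieForm v s)⁻¹ • (v - lieForm v p • r m n)) :=
      { pp := hp, ss := hss, rr := hfc.2 _ hrmf _ hrmf, FF := hfc.2 _ hFm _ hFm, rp := hrp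
        rs := hrs, Fp := by simp [hrp], Fr := hfc.2 _ hFm _ hrmf
        Fs := by
          simp only [map_sub, map_smul, LinearMap.sub_apply, LinearMap.smul_apply, smul_eq_mul, hrs]
          field_simp
          ring }
    refine ⟨_, H, hfc.eq_span_pair (linearIndependent_pair_of_lieForm ?_ H.Fp ?_) hFm hrmf⟩
    · intro h
      have := H.Fs
      rw [h] at this
      simp at this
    · rw [hrp]; norm_num
  choose! F hF using hF
  refine ⟨s, F, ⟨fun m hm n hn => (hF m hm n hn).1, fun m hm n hn => (hF m hm n hn).2,
    hr.legendre_left, hr.edge₁, hr.edge₂⟩, fun m hm n hn => ?_⟩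
  have hrp := hr.normalized m hm n hn
  refine (hr.legendre_right.contact m hm n hn).eq_span_pair
    (linearIndependent_pair_of_lieForm (z := p) ?_ (by simp [hrp]) (by rw [hrp]; norm_num))
    (sub_mem (hsu m hm n hn) (Submodule.smul_mem _ _ (hrf m hm n hn).2)) (hrf m hm n hn).2
  intro h
  have := (LinearIndependent.pair_iff.1 (hli m hm n hn) 1 (-lieForm s p) (by rw [← h]; module)).1
  exact one_ne_zero this

/-! ### Coordinate lines of a channel surface in a Ribaucour pair -/

namespace IsFramedNet

variable {p s : R42} {I J : Set ℤ} {f : ℤ → ℤ → Submodule ℝ R42} {r F : ℤ → ℤ → R42}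

/-- Along a circular coordinate line that is not umbilic, the curvature spheres coincide: they lie
in the line in which a contact element meets the `(2,1)`-plane `δ` of the ribbon. -/
theorem exists_line_of_splitting (h : IsFramedNet p s I J f r F) (hI : IsDiscreteInterval I)
    {n : ℤ} (hn : n ∈ J) {δ : Submodule ℝ R42} (hδ : HasSignature δ 2 1)
    (h₁ : ∀ m, m ∈ I → m + 1 ∈ I → f m n ⊓ f (m + 1) n ≤ δ)
    (h₂ : ∀ m ∈ I, ∃ e ∈ f m n, e ∈ perp δ ∧ e ≠ 0) :
    ∃ (D : R42) (R : Submodule ℝ R42), lieForm D s = 1 ∧ finrank ℝ R ≤ 3 ∧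
      ∀ m ∈ I, D ∈ f m n ∧ r m n ∈ R := by
  have huniq : ∀ m ∈ I, ∀ D ∈ f m n, ∀ D' ∈ f m n, D ∈ δ → D' ∈ δ → lieForm D s = 1 →
      lieForm D' s = 1 → D = D' := by
    intro m hm D hD D' hD' hDδ hDδ' hs hs'
    by_contra hne
    obtain ⟨e, he, heδ, he0⟩ := h₂ m hm
    have hspan := (h.legendre.contact m hm n hn).eq_span_pair
      (linearIndependent_pair_of_lieForm (x := D - D') (y := D) (z := s) (sub_ne_zero.2 hne)
        (by simp [hs, hs']) (by rw [hs]; norm_num)) (sub_mem hD hD') hD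
    rw [hspan] at he
    refine he0 (hδ.disjoint_perp ?_ heδ)
    obtain ⟨a, b, rfl⟩ := Submodule.mem_span_pair.1 he
    exact add_mem (δ.smul_mem _ (sub_mem hDδ hDδ')) (δ.smul_mem _ hDδ)
  have hedge : ∀ m, m ∈ I → m + 1 ∈ I →
      ∃ c, c ∈ f m n ∧ c ∈ f (m + 1) n ∧ c ∈ δ ∧ lieForm c s = 1 := by
    intro m hm hm'
    obtain ⟨κ, hκ⟩ := h.edge₁ hm hm' hn
    have H := h.frame m hm n hn
    have hc : F m n + κ • r m n ∈ f m n := by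
      rw [h.eq_span m hm n hn]
      exact Submodule.mem_span_pair.2 ⟨1, κ, by module⟩
    have hc' : F m n + κ • r m n ∈ f (m + 1) n := by
      rw [hκ, h.eq_span _ hm' n hn]
      exact Submodule.mem_span_pair.2 ⟨1, κ, by module⟩
    exact ⟨_, hc, hc', h₁ m hm hm' ⟨hc, hc'⟩, by simp [H.Fs, H.rs]⟩
  obtain ⟨m₀, hm₀, hm₀'⟩ := hI.exists_edge
  obtain ⟨D, hD, -, hDδ, hDs⟩ := hedge m₀ hm₀ hm₀'
  have hDf : ∀ m ∈ I, D ∈ f m n := by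
    refine hI.induction hm₀ hD fun m hm hm' => ?_
    obtain ⟨c, hc, hc', hcδ, hcs⟩ := hedge m hm hm'
    constructor
    · intro hDm
      rwa [huniq m hm D hDm c hc hDδ hcδ hDs hcs]
    · intro hDm
      rwa [huniq _ hm' D hDm c hc' hDδ hcδ hDs hcs]
  refine ⟨D, (perp δ ⊔ Submodule.span ℝ {D}) ⊓ perp (Submodule.span ℝ {s}), hDs, ?_,
    fun m hm => ⟨hDf m hm, ?_, ?_⟩⟩
  · exact finrank_inf_perp_le (finrank_sup_span_singleton_le (n := 3) hδ.perp.finrank_eq.le D)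
      (Submodule.mem_sup_right (Submodule.mem_span_singleton_self D)) (by rw [hDs]; norm_num)
  · obtain ⟨e, he, heδ, he0⟩ := h₂ m hm
    have hli : LinearIndependent ℝ ![e, D] := by
      rw [LinearIndependent.pair_iff]
      intro a b hab
      have h1 : a • e = 0 := by
        refine hδ.disjoint_perp ?_ ((perp δ).smul_mem _ heδ)
        rw [eq_neg_of_add_eq_zero_left hab]
        exact δ.neg_mem (δ.smul_mem _ hDδ)
      have ha : a = 0 := (smul_eq_zero.1 h1).resolve_right he0
      rw [ha, zero_smul, zero_add] at hab
      refine ⟨ha, (smul_eq_zero.1 hab).resolve_right ?_⟩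
      rintro rfl
      simp at hDs
    have hr : r m n ∈ f m n := by
      rw [h.eq_span m hm n hn]; exact Submodule.subset_span (by simp)
    rw [(h.legendre.contact m hm n hn).eq_span_pair hli he (hDf m hm)] at hr
    obtain ⟨a, b, hab⟩ := Submodule.mem_span_pair.1 hr
    rw [← hab]
    exact add_mem (Submodule.mem_sup_left (Submodule.smul_mem _ _ heδ))
      (Submodule.mem_sup_right (Submodule.smul_mem _ _ (Submodule.mem_span_singleton_self D)))
  · exact mem_perp_singleton.2 (h.frame m hm n hn).rs

/-- Along a circular coordinate line of `f`, the contact elements share a sphere `D` and the spheres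
`r` lie in a three-dimensional space. -/
theorem exists_line (h : IsFramedNet p s I J f r F) (hI : IsDiscreteInterval I)
    (hJ : IsDiscreteInterval J) (hf : IsChannelSurface I J f) {n : ℤ} (hn : n ∈ J) :
    ∃ (D : R42) (R : Submodule ℝ R42), lieForm D s = 1 ∧ finrank ℝ R ≤ 3 ∧
      ∀ m ∈ I, D ∈ f m n ∧ r m n ∈ R := by
  rcases hf.2 with hc | ⟨⟨-, S, hS, hS₁, -⟩, hl⟩
  · rcases hJ.succ_or_pred hn with hn' | hn'
    · obtain ⟨δ, hδ, -, h1, h2⟩ := hc n hn hn'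
      refine h.exists_line_of_splitting hI hn hδ (fun m hm hm' => (h1 m hm hm').1)
        fun m hm => ?_
      obtain ⟨e, he0, -, he⟩ := (h.legendre.edge₂ m n hm hn hn').exists_eq_span
      have hem := he.ge (Submodule.mem_span_singleton_self e)
      exact ⟨e, hem.1, h2 m hm hem, he0⟩
    · have h1n : n - 1 + 1 = n := sub_add_cancel n 1
      obtain ⟨δ, hδ, -, h1, h2⟩ := hc (n - 1) hn' (by rwa [h1n])
      rw [h1n] at h1 h2
      refine h.exists_line_of_splitting hI hn hδ (fun m hm hm' => (h1 m hm hm').2)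
        fun m hm => ?_
      have hs := h.legendre.edge₂ m (n - 1) hm hn' (by rwa [h1n])
      rw [h1n] at hs
      obtain ⟨e, he0, -, he⟩ := hs.exists_eq_span
      have hem := he.ge (Submodule.mem_span_singleton_self e)
      exact ⟨e, hem.2, h2 m hm hem, he0⟩
  · obtain ⟨m₀, hm₀, hm₀'⟩ := hI.exists_edge
    obtain ⟨κ, hκ⟩ := h.edge₁ hm₀ hm₀' hn
    have H := h.frame m₀ hm₀ n hn
    set D := F m₀ n + κ • r m₀ n with hD
    have hDs : lieForm D s = 1 := by simp [hD, H.Fs, H.rs]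
    have hD0 : D ≠ 0 := by
      intro h0
      rw [h0] at hDs
      simp at hDs
    have hDS : D ∈ S := by
      rw [← hS₁ m₀ n hm₀ hm₀' hn, h.eq_span m₀ hm₀ n hn, h.eq_span _ hm₀' n hn]
      refine ⟨Submodule.mem_span_pair.2 ⟨1, κ, by rw [hD]; module⟩, ?_⟩
      rw [hκ]
      exact Submodule.mem_span_pair.2 ⟨1, κ, by module⟩
    have hDf : ∀ m ∈ I, D ∈ f m n := by
      intro m hm
      rcases hI.succ_or_pred hm with hm' | hm'
      · exact ((hS₁ m n hm hm' hn).ge hDS).1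
      · have h1 : m - 1 + 1 = m := sub_add_cancel m 1
        have := ((hS₁ (m - 1) n hm' (by rwa [h1]) hn).ge hDS).2
        rwa [h1] at this
    -- the circularity condition is used for a point sphere complex that is not in contact with `D`
    obtain ⟨q, hq, hDq⟩ : ∃ q, lieForm q q = -1 ∧ lieForm D q ≠ 0 := by
      by_cases hDp : lieForm D p = 0
      · refine ⟨p + s - lieForm s p • D, ?_, ?_⟩
        · simp only [map_add, map_sub, map_smul, LinearMap.add_apply, LinearMap.sub_apply,
            LinearMap.smul_apply, smul_eq_mul, hDp, hDs, H.pp, H.ss, hS.2 D hDS D hDS,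
            lieForm_comm p D, lieForm_comm s D, lieForm_comm p s]
          ring
        · simp [hDp, hDs, hS.2 D hDS D hDS]
      · exact ⟨p, H.pp, hDp⟩
    refine ⟨D, ((⨆ m ∈ I, pointSphere q (f m n)) ⊔ Submodule.span ℝ {D}) ⊓
      perp (Submodule.span ℝ {s}), hDs, ?_, fun m hm => ⟨hDf m hm, ?_, ?_⟩⟩
    · exact finrank_inf_perp_le (finrank_sup_span_singleton_le (hl n hn q hq) D)
        (Submodule.mem_sup_right (Submodule.mem_span_singleton_self D)) (by rw [hDs]; norm_num)
    · have hr : r m n ∈ f m n := by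
        rw [h.eq_span m hm n hn]; exact Submodule.subset_span (by simp)
      have h1 : r m n - (lieForm (r m n) q / lieForm D q) • D ∈ pointSphere q (f m n) := by
        refine ⟨sub_mem hr (Submodule.smul_mem _ _ (hDf m hm)), mem_perp_singleton.2 ?_⟩
        simp only [map_sub, map_smul, LinearMap.sub_apply, LinearMap.smul_apply, smul_eq_mul]
        field_simp
        ring
      rw [← sub_add_cancel (r m n) ((lieForm (r m n) q / lieForm D q) • D)]
      exact add_mem (Submodule.mem_sup_left
          (Submodule.mem_iSup_of_mem m (Submodule.mem_iSup_of_mem hm h1)))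
        (Submodule.mem_sup_right (Submodule.smul_mem _ _ (Submodule.mem_span_singleton_self D)))
    · exact mem_perp_singleton.2 (h.frame m hm n hn).rs

/-- A common sphere of the contact elements along a line is `F + κ r` with constant `κ`. -/
theorem eq_add_smul (h : IsFramedNet p s I J f r F) {m n : ℤ} (hm : m ∈ I) (hn : n ∈ J) {D : R42}
    (hD : D ∈ f m n) (hDs : lieForm D s = 1) : F m n = D - lieForm D p • r m n := by
  have H := h.frame m hm n hn
  rw [h.eq_span m hm n hn] at hD
  obtain ⟨a, b, rfl⟩ := Submodule.mem_span_pair.1 hD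
  have ha : a = 1 := by simpa [H.Fs, H.rs] using hDs
  subst ha
  simp [H.Fp, H.rp]

/-! ### Orthogonal surfaces are Dupin cyclides -/

/-- If a fixed combination `C` of the two spanning spheres does not depend on the vertex, the
orthogonal surface is totally umbilic with circular coordinate lines. For `a = ⟨s, p⟩ b` this holds
with `ε = 0`, and for `a = 0` with `ε = ⟨s, p⟩`. -/
theorem isChannelSurface_of_const (h : IsFramedNet p s I J f r F) (hI : IsDiscreteInterval I)
    (hJ : IsDiscreteInterval J) (hf : IsChannelSurface I J f)
    {g : ℤ → ℤ → Submodule ℝ R42} (hgL : IsLegendre I J g) {a b : ℝ} (hab : a ≠ 0 ∨ b ≠ 0)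
    (hg : ∀ m ∈ I, ∀ n ∈ J, g m n = orthElement p s (r m n) (F m n) a b) {ε : ℝ} {C : R42}
    (hC : ∀ m ∈ I, ∀ n ∈ J, orthSphere p s (r m n) a b - ε • orthSphere' p (r m n) (F m n) a b = C) :
    IsChannelSurface I J g := by
  have hCg : ∀ m ∈ I, ∀ n ∈ J, C ∈ g m n := fun m hm n hn => by
    rw [hg m hm n hn, ← hC m hm n hn]
    exact sub_mem (Submodule.subset_span (by simp))
      (Submodule.smul_mem _ _ (Submodule.subset_span (by simp)))
  obtain ⟨m₀, hm₀⟩ := hI.nonempty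
  obtain ⟨n₀, hn₀⟩ := hJ.nonempty
  have hC0 : C ≠ 0 := by
    intro h0
    have h1 := hC m₀ hm₀ n₀ hn₀
    rw [h0, sub_eq_add_neg, ← neg_smul, ← one_smul ℝ (orthSphere _ _ _ _ _)] at h1
    exact one_ne_zero (LinearIndependent.pair_iff.1
      ((h.frame m₀ hm₀ n₀ hn₀).linearIndependent_orthSphere hab) _ _ h1).1
  refine ⟨hgL, Or.inr ⟨hgL.isTotallyUmbilic hC0
    ((hgL.contact m₀ hm₀ n₀ hn₀).2 C (hCg m₀ hm₀ n₀ hn₀) C (hCg m₀ hm₀ n₀ hn₀)) hCg,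
    fun n hn => ?_⟩⟩
  obtain ⟨D, R, hDs, hR, hDR⟩ := h.exists_line hI hJ hf hn
  refine isCircularLine_of_le (S := R ⊓ perp (Submodule.span ℝ {p}) ⊔ Submodule.span ℝ {C} ⊔
    Submodule.span ℝ {orthSphere' p (r m₀ n) (F m₀ n) a b}) ?_ hm₀ (hgL.contact m₀ hm₀ n hn) ?_
  · refine finrank_sup_span_singleton_le (finrank_sup_span_singleton_le ?_ _) _
    exact finrank_inf_perp_le hR (hDR m₀ hm₀).2
      (by rw [(h.frame m₀ hm₀ n hn).rp]; norm_num)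
  · intro m hm
    have hw : orthSphere' p (r m n) (F m n) a b ∈ R ⊓ perp (Submodule.span ℝ {p}) ⊔
        Submodule.span ℝ {C} ⊔ Submodule.span ℝ {orthSphere' p (r m₀ n) (F m₀ n) a b} := by
      have h1 : orthSphere' p (r m n) (F m n) a b = (-(2 * a * lieForm D p + b)) •
          (r m n - r m₀ n) + orthSphere' p (r m₀ n) (F m₀ n) a b := by
        rw [orthSphere', orthSphere', h.eq_add_smul hm hn (hDR m hm).1 hDs,
          h.eq_add_smul hm₀ hn (hDR m₀ hm₀).1 hDs]
        module
      rw [h1]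
      refine add_mem (Submodule.mem_sup_left (Submodule.mem_sup_left (Submodule.smul_mem _ _
        ⟨sub_mem (hDR m hm).2 (hDR m₀ hm₀).2, mem_perp_singleton.2 ?_⟩)))
        (Submodule.mem_sup_right (Submodule.mem_span_singleton_self _))
      simp [(h.frame m hm n hn).rp, (h.frame m₀ hm₀ n hn).rp]
    rw [hg m hm n hn, orthElement, Submodule.span_le]
    rintro _ (rfl | rfl)
    · rw [sub_eq_iff_eq_add.1 (hC m hm n hn)]
      exact add_mem (Submodule.mem_sup_left (Submodule.mem_sup_right
        (Submodule.mem_span_singleton_self _))) (Submodule.smul_mem _ _ hw)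
    · exact hw

/-- Orthogonal surfaces are Lie images of `f`, or totally umbilic with circular lines. -/
theorem isDupinCyclide_orthElement (h : IsFramedNet p s I J f r F) (hI : IsDiscreteInterval I)
    (hJ : IsDiscreteInterval J) (hf : IsDupinCyclide I J f)
    {g : ℤ → ℤ → Submodule ℝ R42} (hgL : IsLegendre I J g) {a b : ℝ} (hab : a ≠ 0 ∨ b ≠ 0)
    (hg : ∀ m ∈ I, ∀ n ∈ J, g m n = orthElement p s (r m n) (F m n) a b) :
    IsDupinCyclide I J g := by
  by_cases ha : a = 0
  · have hC : ∀ m ∈ I, ∀ n ∈ J, orthSphere p s (r m n) a b -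
        lieForm s p • orthSphere' p (r m n) (F m n) a b = b • (s + (2 * lieForm s p) • p) := by
      intro m _ n _
      rw [orthSphere, orthSphere', ha]; module
    exact ⟨h.isChannelSurface_of_const hI hJ hf.1 hgL hab hg hC,
      h.swap.isChannelSurface_of_const hJ hI hf.2 hgL.swap hab (fun n hn m hm => hg m hm n hn)
        fun n hn m hm => hC m hm n hn⟩
  by_cases ha' : a - lieForm s p * b = 0
  · have hC : ∀ m ∈ I, ∀ n ∈ J, orthSphere p s (r m n) a b -
        (0 : ℝ) • orthSphere' p (r m n) (F m n) a b = b • s := by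
      intro m _ n _
      rw [orthSphere, sub_eq_zero.1 ha']; module
    exact ⟨h.isChannelSurface_of_const hI hJ hf.1 hgL hab hg hC,
      h.swap.isChannelSurface_of_const hJ hI hf.2 hgL.swap hab (fun n hn m hm => hg m hm n hn)
        fun n hn m hm => hC m hm n hn⟩
  · obtain ⟨m₀, hm₀⟩ := hI.nonempty
    obtain ⟨n₀, hn₀⟩ := hJ.nonempty
    have H := h.frame m₀ hm₀ n₀ hn₀
    have hiso := IsVertexFrame.lieForm_orthMap H.pp H.ss ha ha'
    refine hf.map (L := isometryEquiv _ hiso) hiso fun m hm n hn => ?_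
    rw [hg m hm n hn, (h.frame m hm n hn).map_orthMap ha ha', h.eq_span m hm n hn]
    rfl

theorem map_orthElement₁ (h : IsFramedNet p s I J f r F) (a b : ℝ) {m n : ℤ} (hm : m ∈ I)
    (hm' : m + 1 ∈ I) (hn : n ∈ J) :
    (orthElement p s (r (m + 1) n) (F (m + 1) n) a b).map (lieInversion (r (m + 1) n - r m n)) =
      orthElement p s (r m n) (F m n) a b := by
  obtain ⟨κ, hκ⟩ := h.edge₁ hm hm' hn
  exact (h.frame m hm n hn).map_orthElement (h.frame _ hm' n hn) (h.ne₁ m n hm hm' hn) hκ a b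

theorem sub_self_ne_zero (h : IsFramedNet p s I J f r F) {m n : ℤ} (hm : m ∈ I)
    (hm' : m + 1 ∈ I) (hn : n ∈ J) :
    lieForm (r (m + 1) n - r m n) (r (m + 1) n - r m n) ≠ 0 := by
  have h1 := h.ne₁ m n hm hm' hn
  simp only [map_sub, LinearMap.sub_apply, (h.frame m hm n hn).rr, (h.frame _ hm' n hn).rr,
    lieForm_comm (r (m + 1) n) (r m n)]
  intro h2
  exact h1 (by linear_combination -h2 / 2)

/-- Parallel contact element maps that agree at one vertex agree everywhere. -/
theorem eq_of_parallel (h : IsFramedNet p s I J f r F) (hI : IsDiscreteInterval I)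
    (hJ : IsDiscreteInterval J) {g g' : ℤ → ℤ → Submodule ℝ R42}
    (hg₁ : ∀ m n, m ∈ I → m + 1 ∈ I → n ∈ J →
      (g (m + 1) n).map (lieInversion (r (m + 1) n - r m n)) = g m n)
    (hg₂ : ∀ m n, m ∈ I → n ∈ J → n + 1 ∈ J →
      (g m (n + 1)).map (lieInversion (r m (n + 1) - r m n)) = g m n)
    (hg₁' : ∀ m n, m ∈ I → m + 1 ∈ I → n ∈ J →
      (g' (m + 1) n).map (lieInversion (r (m + 1) n - r m n)) = g' m n)
    (hg₂' : ∀ m n, m ∈ I → n ∈ J → n + 1 ∈ J →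
      (g' m (n + 1)).map (lieInversion (r m (n + 1) - r m n)) = g' m n)
    {m₀ n₀ : ℤ} (hm₀ : m₀ ∈ I) (hn₀ : n₀ ∈ J) (h₀ : g m₀ n₀ = g' m₀ n₀) :
    ∀ m ∈ I, ∀ n ∈ J, g m n = g' m n := by
  have h1 : ∀ m ∈ I, g m n₀ = g' m n₀ := by
    refine hI.induction hm₀ h₀ fun m hm hm' => ⟨fun he => ?_, fun he => ?_⟩
    · rw [← map_lieInversion_map (h.sub_self_ne_zero hm hm' hn₀) (g (m + 1) n₀),
        hg₁ m n₀ hm hm' hn₀, he, ← hg₁' m n₀ hm hm' hn₀,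
        map_lieInversion_map (h.sub_self_ne_zero hm hm' hn₀)]
    · rw [← hg₁ m n₀ hm hm' hn₀, he, hg₁' m n₀ hm hm' hn₀]
  intro m hm
  refine hJ.induction hn₀ (h1 m hm) fun n hn hn' => ⟨fun he => ?_, fun he => ?_⟩
  · rw [← map_lieInversion_map (h.swap.sub_self_ne_zero hn hn' hm) (g m (n + 1)),
      hg₂ m n hm hn hn', he, ← hg₂' m n hm hn hn',
      map_lieInversion_map (h.swap.sub_self_ne_zero hn hn' hm)]
  · rw [← hg₂ m n hm hn hn', he, hg₂' m n hm hn hn']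

end IsFramedNet

theorem map_lieInversion_comm {a b : R42} (hab : lieForm a b = 0) (c : Submodule ℝ R42) :
    (c.map (lieInversion a)).map (lieInversion b) =
      (c.map (lieInversion b)).map (lieInversion a) := by
  rw [← Submodule.map_comp, ← Submodule.map_comp]
  congr 1
  refine LinearMap.ext fun x => ?_
  simp only [LinearMap.comp_apply, lieInversion_apply, map_sub, map_smul, hab, lieForm_comm b a,
    mul_zero]
  module

namespace IsFramedNet

variable {p s : R42} {I J : Set ℤ} {f u : ℤ → ℤ → Submodule ℝ R42} {r F : ℤ → ℤ → R42}

/-- Every orthogonal surface has constant parameters in one of the two rulings. -/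
theorem exists_eq_orthElement (h : IsFramedNet p s I J f r F) (hI : IsDiscreteInterval I)
    (hJ : IsDiscreteInterval J)
    (hu : ∀ m ∈ I, ∀ n ∈ J, u m n = Submodule.span ℝ {s - lieForm s p • r m n, r m n})
    {g : ℤ → ℤ → Submodule ℝ R42} (hg : IsOrthogonalSurface p I J f u r g) :
    ∃ a b : ℝ, (a ≠ 0 ∨ b ≠ 0) ∧
      ((∀ m ∈ I, ∀ n ∈ J, g m n = orthElement p s (r m n) (F m n) a b) ∨
        (∀ m ∈ I, ∀ n ∈ J,
          g m n = (orthElement p s (r m n) (F m n) a b).map (lieInversion p))) := by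
  obtain ⟨m₀, hm₀⟩ := hI.nonempty
  obtain ⟨n₀, hn₀⟩ := hJ.nonempty
  have H := h.frame m₀ hm₀ n₀ hn₀
  have ho := (hg.orthogonal m₀ hm₀ n₀ hn₀).2
  rw [hu m₀ hm₀ n₀ hn₀, h.eq_span m₀ hm₀ n₀ hn₀] at ho
  obtain ⟨a, b, hab, hG⟩ := H.exists_eq_orthElement (hg.legendre.contact m₀ hm₀ n₀ hn₀)
    (H.le_span_of_isOrthogonalToCircle ho)
  have h₁ := fun (m n : ℤ) (hm : m ∈ I) (hm' : m + 1 ∈ I) (hn : n ∈ J) =>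
    h.map_orthElement₁ a b hm hm' hn
  have h₂ := fun (m n : ℤ) (hm : m ∈ I) (hn : n ∈ J) (hn' : n + 1 ∈ J) =>
    h.swap.map_orthElement₁ a b hn hn' hm
  refine ⟨a, b, hab, hG.imp (fun h₀ => ?_) fun h₀ => ?_⟩
  · exact h.eq_of_parallel hI hJ hg.parallel₁ hg.parallel₂ h₁ h₂ hm₀ hn₀ h₀
  · refine h.eq_of_parallel hI hJ
      (g' := fun m n => (orthElement p s (r m n) (F m n) a b).map (lieInversion p))
      hg.parallel₁ hg.parallel₂ (fun m n hm hm' hn => ?_) (fun m n hm hn hn' => ?_) hm₀ hn₀ h₀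
    · rw [map_lieInversion_comm, h₁ m n hm hm' hn]
      simp [(h.frame m hm n hn).pr, (h.frame _ hm' n hn).pr]
    · have := h₂ m n hm hn hn'
      rw [map_lieInversion_comm, this]
      simp [(h.frame m hm n hn).pr, (h.frame m hm _ hn').pr]

theorem isDupinCyclide_of_isOrthogonalSurface (h : IsFramedNet p s I J f r F)
    (hI : IsDiscreteInterval I) (hJ : IsDiscreteInterval J) (hf : IsDupinCyclide I J f)
    (hu : ∀ m ∈ I, ∀ n ∈ J, u m n = Submodule.span ℝ {s - lieForm s p • r m n, r m n})
    {g : ℤ → ℤ → Submodule ℝ R42} (hg : IsOrthogonalSurface p I J f u r g) :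
    IsDupinCyclide I J g := by
  obtain ⟨a, b, hab, hG | hG⟩ := h.exists_eq_orthElement hI hJ hu hg
  · exact h.isDupinCyclide_orthElement hI hJ hf hg.legendre hab hG
  · obtain ⟨m₀, hm₀⟩ := hI.nonempty
    obtain ⟨n₀, hn₀⟩ := hJ.nonempty
    have hp := (h.frame m₀ hm₀ n₀ hn₀).pp
    have hp0 : lieForm p p ≠ 0 := by rw [hp]; norm_num
    -- reverse the orientation of `g`
    have hG' : ∀ m ∈ I, ∀ n ∈ J,
        orthElement p s (r m n) (F m n) a b = (g m n).map (lieInversion p) :=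
      fun m hm n hn => by rw [hG m hm n hn, map_lieInversion_map hp0]
    have hD := h.isDupinCyclide_orthElement hI hJ hf
      (hg.legendre.map (reversal_isometry hp) (g := fun m n => (g m n).map (lieInversion p))
        fun m hm n hn => rfl) hab fun m hm n hn => (hG' m hm n hn).symm
    exact hD.map (reversal_isometry hp) fun m hm n hn => (map_lieInversion_map hp0 _).symm

/-! ### Existence of families of orthogonal surfaces -/

theorem isOrthogonalSurface_orthElement (h : IsFramedNet p s I J f r F)
    (hu : ∀ m ∈ I, ∀ n ∈ J, u m n = Submodule.span ℝ {s - lieForm s p • r m n, r m n})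
    {a b : ℝ} (hp : lieForm p p = -1) (hs : lieForm s s = 0) (ha : a ≠ 0)
    (ha' : a - lieForm s p * b ≠ 0) :
    IsOrthogonalSurface p I J f u r (fun m n => orthElement p s (r m n) (F m n) a b) where
  legendre := by
    have hiso := IsVertexFrame.lieForm_orthMap hp hs ha ha'
    refine h.legendre.map (L := isometryEquiv _ hiso) hiso fun m hm n hn => ?_
    rw [(h.frame m hm n hn).map_orthMap ha ha', h.eq_span m hm n hn]
    rfl
  orthogonal m hm n hn := by
    rw [hu m hm n hn, h.eq_span m hm n hn]
    exact (h.frame m hm n hn).isOrthogonalToCircle_orthElement (Or.inl ha)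
  parallel₁ m n hm hm' hn := h.map_orthElement₁ a b hm hm' hn
  parallel₂ m n hm hn hn' := h.swap.map_orthElement₁ a b hn hn' hm

/-- Adjacent point spheres of an orthogonal surface coincide for at most two parameters. -/
theorem circlePoint_span_ne (h : IsFramedNet p s I J f r F) {b κ : ℝ}
    (hb : 1 - lieForm s p * b ≠ 0) {m n : ℤ} (hm : m ∈ I) (hm' : m + 1 ∈ I) (hn : n ∈ J)
    (hκ : F m n + κ • r m n = F (m + 1) n + κ • r (m + 1) n)
    (hκb : -(lieForm s p * b ^ 2) + 2 * b + 2 * κ ≠ 0) :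
    pointSphere p (orthElement p s (r m n) (F m n) 1 b) ≠
      pointSphere p (orthElement p s (r (m + 1) n) (F (m + 1) n) 1 b) := by
  have H := h.frame m hm n hn
  have H' := h.frame _ hm' n hn
  rw [H.pointSphere_orthElement (Or.inl one_ne_zero),
    H'.pointSphere_orthElement (Or.inl one_ne_zero)]
  intro he
  have h1 := he.ge (Submodule.mem_span_singleton_self _)
  obtain ⟨c, hc⟩ := Submodule.mem_span_singleton.1 h1
  have h2 := congrArg (fun v => lieForm v s) hc
  simp only [map_smul, LinearMap.smul_apply, smul_eq_mul, H.circlePoint_s, H'.circlePoint_s] at h2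
  have hc1 : c = 1 := by
    have h3 : (c - 1) * (1 - lieForm s p * b) = 0 := by linear_combination -h2 / 2
    exact sub_eq_zero.1 ((mul_eq_zero.1 h3).resolve_right hb)
  rw [hc1, one_smul] at hc
  have h3 := IsVertexFrame.circlePoint_sub (p := p) (s := s) hκ 1 b
  rw [hc, sub_self] at h3
  have h4 := h.sub_self_ne_zero hm hm' hn
  rcases smul_eq_zero.1 h3.symm with h5 | h5
  · exact hκb (by linear_combination h5)
  · rw [h5] at h4
    simp at h4

theorem finite_setOf_quadratic (h κ : ℝ) :
    {b : ℝ | -(h * b ^ 2) + 2 * b + 2 * κ = 0}.Finite := by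
  let P : Polynomial ℝ := Polynomial.C (-h) * Polynomial.X ^ 2 + Polynomial.C 2 * Polynomial.X +
    Polynomial.C (2 * κ)
  have hP : P ≠ 0 := by
    intro h0
    have := congrArg (fun Q : Polynomial ℝ => Q.coeff 1) h0
    simp [P, Polynomial.coeff_C] at this
  refine (Polynomial.finite_setOfPred_isRoot hP).subset fun b hb => ?_
  simp only [Set.mem_ofPred_eq, Polynomial.IsRoot, P, Polynomial.eval_add, Polynomial.eval_mul,
    Polynomial.eval_C, Polynomial.eval_pow, Polynomial.eval_X] at hb ⊢
  linear_combination hb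

/-- Regular families exist: only countably many parameters are excluded. -/
theorem exists_isRegularFamily (h : IsFramedNet p s I J f r F) (hp : lieForm p p = -1)
    (hs : lieForm s s = 0)
    (hu : ∀ m ∈ I, ∀ n ∈ J, u m n = Submodule.span ℝ {s - lieForm s p • r m n, r m n})
    (K : Set ℤ) : ∃ g : ℤ → ℤ → ℤ → Submodule ℝ R42, IsRegularFamily p I J K f u r g := by
  have hκ₁ : ∀ m n, ∃ κ : ℝ, m ∈ I → m + 1 ∈ I → n ∈ J →
      F m n + κ • r m n = F (m + 1) n + κ • r (m + 1) n := fun m n => by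
    by_cases hmn : m ∈ I ∧ m + 1 ∈ I ∧ n ∈ J
    · obtain ⟨κ, hκ⟩ := h.edge₁ hmn.1 hmn.2.1 hmn.2.2
      exact ⟨κ, fun _ _ _ => hκ⟩
    · exact ⟨0, fun h1 h2 h3 => absurd ⟨h1, h2, h3⟩ hmn⟩
  have hκ₂ : ∀ m n, ∃ κ : ℝ, m ∈ I → n ∈ J → n + 1 ∈ J →
      F m n + κ • r m n = F m (n + 1) + κ • r m (n + 1) := fun m n => by
    by_cases hmn : m ∈ I ∧ n ∈ J ∧ n + 1 ∈ J
    · obtain ⟨κ, hκ⟩ := h.edge₂ hmn.1 hmn.2.1 hmn.2.2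
      exact ⟨κ, fun _ _ _ => hκ⟩
    · exact ⟨0, fun h1 h2 h3 => absurd ⟨h1, h2, h3⟩ hmn⟩
  choose κ₁ hκ₁ using hκ₁
  choose κ₂ hκ₂ using hκ₂
  let Z : Set ℝ := {b | 1 - lieForm s p * b = 0} ∪
    ((⋃ m : ℤ, ⋃ n : ℤ, {b | -(lieForm s p * b ^ 2) + 2 * b + 2 * κ₁ m n = 0}) ∪
      ⋃ m : ℤ, ⋃ n : ℤ, {b | -(lieForm s p * b ^ 2) + 2 * b + 2 * κ₂ m n = 0})
  have hZ : Z.Countable := by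
    refine Set.Countable.union ?_ (Set.Countable.union ?_ ?_)
    · refine Set.Subsingleton.countable fun b hb c hc => ?_
      simp only [Set.mem_ofPred_eq] at hb hc
      have h0 : lieForm s p ≠ 0 := by
        intro h0
        simp [h0] at hb
      exact mul_left_cancel₀ h0 (by linear_combination hc - hb)
    · exact Set.countable_iUnion fun m => Set.countable_iUnion fun n =>
        (finite_setOf_quadratic _ _).countable
    · exact Set.countable_iUnion fun m => Set.countable_iUnion fun n =>
        (finite_setOf_quadratic _ _).countable
  have hinf : Zᶜ.Infinite := fun hfin =>
    Set.not_countable_univ (α := ℝ) (by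
      rw [← Set.union_compl_self Z]; exact hZ.union hfin.countable)
  obtain ⟨β⟩ : Nonempty (ℤ ↪ ↑(Zᶜ)) :=
    ⟨(Equiv.intEquivNat.toEmbedding).trans (hinf.natEmbedding)⟩
  have hβ : ∀ k, (1 - lieForm s p * (β k : ℝ) ≠ 0) ∧
      (∀ m n, -(lieForm s p * (β k : ℝ) ^ 2) + 2 * (β k : ℝ) + 2 * κ₁ m n ≠ 0) ∧
      ∀ m n, -(lieForm s p * (β k : ℝ) ^ 2) + 2 * (β k : ℝ) + 2 * κ₂ m n ≠ 0 := by
    intro k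
    have := (β k).2
    simp only [Z, Set.mem_compl_iff, Set.mem_union, Set.mem_iUnion, Set.mem_ofPred_eq,
      not_or, not_exists] at this
    exact ⟨this.1, this.2.1, this.2.2⟩
  refine ⟨fun k m n => orthElement p s (r m n) (F m n) 1 (β k), fun k _ =>
    h.isOrthogonalSurface_orthElement hu hp hs one_ne_zero (hβ k).1,
    fun m n k hm hm' hn _ => h.circlePoint_span_ne (hβ k).1 hm hm' hn (hκ₁ m n hm hm' hn)
      ((hβ k).2.1 m n),
    fun m n k hm hn hn' _ => h.swap.circlePoint_span_ne (hβ k).1 hn hn' hm (hκ₂ m n hm hn hn')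
      ((hβ k).2.2 m n), fun m n k hm hn _ _ he => ?_⟩
  have H := h.frame m hm n hn
  rw [H.pointSphere_orthElement (Or.inl one_ne_zero),
    H.pointSphere_orthElement (Or.inl one_ne_zero)] at he
  obtain ⟨c, hc⟩ := Submodule.mem_span_singleton.1 (he.ge (Submodule.mem_span_singleton_self _))
  have h0 : (c * (β k : ℝ) ^ 2 - (β (k + 1) : ℝ) ^ 2) • s +
      (c * (2 * 1 * (β k : ℝ) - lieForm s p * (β k : ℝ) ^ 2) -
        (2 * 1 * (β (k + 1) : ℝ) - lieForm s p * (β (k + 1) : ℝ) ^ 2)) • r m n +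
      (-(2 * c) + 2) • F m n + (c * (2 * (β k : ℝ)) - 2 * (β (k + 1) : ℝ)) • p = 0 := by
    rw [IsVertexFrame.circlePoint_expand, IsVertexFrame.circlePoint_expand] at hc
    rw [← sub_eq_zero] at hc
    rw [← hc]; module
  obtain ⟨-, -, h3, h4⟩ := H.combination_eq_zero h0
  have hc1 : c = 1 := by linear_combination -h3 / 2
  subst hc1
  have : (β k : ℝ) = β (k + 1) := by linear_combination h4 / 2
  have := β.injective (Subtype.ext this)
  omega

end IsFramedNet

/-! ### Coordinate surfaces tangent to the circles -/

/-- Unit vectors orthogonal to the span of `s`, `r`, `F`; they give the spheres through the circle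
of the vertex frame. -/
structure IsUnitNormal (s r F τ : R42) : Prop where
  self : lieForm τ τ = 1
  s : lieForm τ s = 0
  r : lieForm τ r = 0
  F : lieForm τ F = 0

/-- The sphere through the circle of a vertex frame with normal direction `τ`. -/
noncomputable def circleSphere (p r τ : R42) : R42 := τ - lieForm τ p • r + p

/-- The contact element at a point of the circle that contains the sphere with normal direction
`τ` through the circle. -/
noncomputable def tangentElement (p s r F τ : R42) (a b : ℝ) : Submodule ℝ R42 :=
  Submodule.span ℝ {circlePoint p s r F a b, circleSphere p r τ}

/-- A null pair and an orthogonal spacelike vector span a `(2,1)`-plane. -/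
theorem hasSignature_of_null_pair {x y z : R42} (hx : lieForm x x = 0) (hy : lieForm y y = 0)
    (hxy : 0 < lieForm x y) (hz : 0 < lieForm z z) (hxz : lieForm x z = 0)
    (hyz : lieForm y z = 0) : HasSignature (Submodule.span ℝ {x, y, z}) 2 1 := by
  have hspan : Submodule.span ℝ {x, y, z} = Submodule.span ℝ (Set.range ![x + y, x - y, z]) := by
    apply le_antisymm
    · have h1 : x + y ∈ Submodule.span ℝ (Set.range ![x + y, x - y, z]) :=
        Submodule.subset_span ⟨0, rfl⟩
      have h2 : x - y ∈ Submodule.span ℝ (Set.range ![x + y, x - y, z]) :=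
        Submodule.subset_span ⟨1, rfl⟩
      rw [Submodule.span_le]
      rintro _ (rfl | rfl | rfl)
      · have h3 := Submodule.smul_mem _ (1 / 2 : ℝ) (add_mem h1 h2)
        rwa [add_add_sub_cancel, ← two_smul ℝ, smul_smul, one_div_mul_cancel two_ne_zero,
          one_smul] at h3
      · have h3 := Submodule.smul_mem _ (1 / 2 : ℝ) (sub_mem h1 h2)
        rwa [add_sub_sub_cancel, ← two_smul ℝ, smul_smul, one_div_mul_cancel two_ne_zero,
          one_smul] at h3
      · exact Submodule.subset_span ⟨2, rfl⟩
    · rw [Submodule.span_le]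
      rintro _ ⟨i, rfl⟩
      fin_cases i
      · exact add_mem (Submodule.subset_span (by simp)) (Submodule.subset_span (by simp))
      · exact sub_mem (Submodule.subset_span (by simp)) (Submodule.subset_span (by simp))
      · exact Submodule.subset_span (by simp)
  rw [hspan]
  have hyx : lieForm y x = lieForm x y := lieForm_comm y x
  have hzx : lieForm z x = 0 := by rw [lieForm_comm, hxz]
  have hzy : lieForm z y = 0 := by rw [lieForm_comm, hyz]
  refine HasSignature.of_orthogonal _ ?_ 1 ?_ ?_
  · intro i j hij
    fin_cases i <;> fin_cases j <;>
      first
      | exact absurd rfl hij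
      | simp [hx, hy, hxz, hyz, hzx, hzy, hyx]
  · change lieForm (x - y) (x - y) < 0
    have : lieForm (x - y) (x - y) = -2 * lieForm x y := by
      simp only [map_sub, LinearMap.sub_apply, hx, hy, hyx]; ring
    rw [this]; linarith
  · intro i hi
    fin_cases i
    · change 0 < lieForm (x + y) (x + y)
      have : lieForm (x + y) (x + y) = 2 * lieForm x y := by
        simp only [map_add, LinearMap.add_apply, hx, hy, hyx]; ring
      rw [this]; linarith
    · exact absurd rfl hi
    · exact hz

namespace IsVertexFrame

variable {p s r F τ : R42}

theorem circleSphere_p (H : IsVertexFrame p s r F) : lieForm (circleSphere p r τ) p = -1 := by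
  simp [circleSphere, H.rp, H.pp]

theorem circleSphere_r (H : IsVertexFrame p s r F) (N : IsUnitNormal s r F τ) :
    lieForm (circleSphere p r τ) r = 1 := by
  simp [circleSphere, H.rr, H.pr, N.r]

theorem circleSphere_s (H : IsVertexFrame p s r F) (N : IsUnitNormal s r F τ) :
    lieForm (circleSphere p r τ) s = lieForm s p := by
  simp [circleSphere, H.rs, N.s, lieForm_comm p s]

theorem circleSphere_F (H : IsVertexFrame p s r F) (N : IsUnitNormal s r F τ) :
    lieForm (circleSphere p r τ) F = 0 := by
  simp [circleSphere, H.rF, H.pF, N.F]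

theorem circleSphere_self (H : IsVertexFrame p s r F) (N : IsUnitNormal s r F τ) :
    lieForm (circleSphere p r τ) (circleSphere p r τ) = 0 := by
  simp only [circleSphere, map_add, map_sub, map_smul, LinearMap.add_apply, LinearMap.sub_apply,
    LinearMap.smul_apply, smul_eq_mul, N.self, N.r, H.rr, H.rp, H.pr, H.pp, lieForm_comm r τ,
    lieForm_comm p τ]
  ring

theorem circlePoint_circleSphere (H : IsVertexFrame p s r F) (N : IsUnitNormal s r F τ) (a b : ℝ) :
    lieForm (circleSphere p r τ) (circlePoint p s r F a b) = 0 := by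
  rw [circlePoint]
  simp only [map_add, map_sub, map_smul, smul_eq_mul, H.circleSphere_p, H.circleSphere_r N,
    H.circleSphere_s N, H.circleSphere_F N]
  ring

theorem isContactElement_tangentElement (H : IsVertexFrame p s r F) (N : IsUnitNormal s r F τ)
    {a b : ℝ} (hab : a ≠ 0 ∨ b ≠ 0) : IsContactElement (tangentElement p s r F τ a b) := by
  refine isContactElement_span_pair (linearIndependent_pair_of_lieForm
    (H.circlePoint_ne_zero hab) (H.circlePoint_p a b) ?_) (H.circlePoint_self a b) ?_
    (H.circleSphere_self N)
  · rw [H.circleSphere_p]; norm_num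
  · rw [lieForm_comm, H.circlePoint_circleSphere N]

theorem pointSphere_tangentElement (H : IsVertexFrame p s r F) (a b : ℝ) :
    pointSphere p (tangentElement p s r F τ a b) =
      Submodule.span ℝ {circlePoint p s r F a b} :=
  pointSphere_span_pair (H.circlePoint_p a b) (by rw [H.circleSphere_p]; norm_num)

theorem circleSphere_ne_zero (H : IsVertexFrame p s r F) : circleSphere p r τ ≠ 0 := by
  intro h
  have := H.circleSphere_p (τ := τ)
  rw [h] at this
  simp at this

theorem tangentElement_ne_of_circlePoint_ne {r' F' τ' : R42} (H : IsVertexFrame p s r F)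
    (H' : IsVertexFrame p s r' F') {a b a' b' : ℝ}
    (h : Submodule.span ℝ {circlePoint p s r F a b} ≠
      Submodule.span ℝ {circlePoint p s r' F' a' b'}) :
    tangentElement p s r F τ a b ≠ tangentElement p s r' F' τ' a' b' := by
  intro he
  apply h
  rw [← H.pointSphere_tangentElement (τ := τ), ← H'.pointSphere_tangentElement (τ := τ'), he]

/-- Adjacent tangent contact elements share a sphere if the points and the normal directions both
move in the direction of `r' - r`. -/
theorem inf_tangentElement {r' F' τ' : R42} (H : IsVertexFrame p s r F)
    (N : IsUnitNormal s r F τ) (H' : IsVertexFrame p s r' F') (N' : IsUnitNormal s r' F' τ')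
    {a b : ℝ} (hab : a ≠ 0 ∨ b ≠ 0)
    (h : Submodule.span ℝ {circlePoint p s r F a b} ≠
      Submodule.span ℝ {circlePoint p s r' F' a b}) {χ ρ : ℝ}
    (hχ : circlePoint p s r' F' a b - circlePoint p s r F a b = χ • (r' - r))
    (hρ : circleSphere p r' τ' - circleSphere p r τ = ρ • (r' - r)) :
    tangentElement p s r F τ a b ⊓ tangentElement p s r' F' τ' a b =
        Submodule.span ℝ {χ • circleSphere p r τ - ρ • circlePoint p s r F a b} ∧
      IsSphere (tangentElement p s r F τ a b ⊓ tangentElement p s r' F' τ' a b) := by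
  have hχ0 : χ ≠ 0 := by
    rintro rfl
    rw [zero_smul, sub_eq_zero] at hχ
    rw [hχ] at h
    exact h rfl
  have hx0 : χ • circleSphere p r τ - ρ • circlePoint p s r F a b ≠ 0 := by
    intro h0
    have := congrArg (fun v => lieForm v p) h0
    simp [H.circleSphere_p, H.circlePoint_p, hχ0] at this
  have hx : χ • circleSphere p r τ - ρ • circlePoint p s r F a b ∈
      tangentElement p s r F τ a b :=
    sub_mem (Submodule.smul_mem _ _ (Submodule.subset_span (by simp)))
      (Submodule.smul_mem _ _ (Submodule.subset_span (by simp)))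
  have hx' : χ • circleSphere p r τ - ρ • circlePoint p s r F a b ∈
      tangentElement p s r' F' τ' a b := by
    have : χ • circleSphere p r τ - ρ • circlePoint p s r F a b =
        χ • circleSphere p r' τ' - ρ • circlePoint p s r' F' a b := by
      rw [eq_add_of_sub_eq hχ, eq_add_of_sub_eq hρ]; module
    rw [this]
    exact sub_mem (Submodule.smul_mem _ _ (Submodule.subset_span (by simp)))
      (Submodule.smul_mem _ _ (Submodule.subset_span (by simp)))
  have hc := H.isContactElement_tangentElement N hab
  have hc' := H'.isContactElement_tangentElement N' hab
  have hne := H.tangentElement_ne_of_circlePoint_ne (τ := τ) (τ' := τ') H' h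
  exact ⟨inf_eq_span_singleton hc hc' hne hx0 hx hx', hc.isSphere_inf hc' hne hx0 hx hx'⟩

/-- Tangent contact elements at different points of a circle share the sphere that contains the
circle. -/
theorem inf_tangentElement_circle (H : IsVertexFrame p s r F) (N : IsUnitNormal s r F τ)
    {a b a' b' : ℝ} (hab : a ≠ 0 ∨ b ≠ 0) (hab' : a' ≠ 0 ∨ b' ≠ 0)
    (h : Submodule.span ℝ {circlePoint p s r F a b} ≠
      Submodule.span ℝ {circlePoint p s r F a' b'}) :
    tangentElement p s r F τ a b ⊓ tangentElement p s r F τ a' b' =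
        Submodule.span ℝ {circleSphere p r τ} ∧
      IsSphere (tangentElement p s r F τ a b ⊓ tangentElement p s r F τ a' b') := by
  have hc := H.isContactElement_tangentElement N hab
  have hc' := H.isContactElement_tangentElement N hab'
  have hne := H.tangentElement_ne_of_circlePoint_ne (τ := τ) (τ' := τ) H h
  have hx : circleSphere p r τ ∈ tangentElement p s r F τ a b :=
    Submodule.subset_span (by simp)
  have hx' : circleSphere p r τ ∈ tangentElement p s r F τ a' b' :=
    Submodule.subset_span (by simp)
  exact ⟨inf_eq_span_singleton hc hc' hne H.circleSphere_ne_zero hx hx',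
    hc.isSphere_inf hc' hne H.circleSphere_ne_zero hx hx'⟩

end IsVertexFrame

/-- The family of circles along one coordinate line of a Dupin cyclide: the point spheres are
`e - ⟨e, p⟩ r n` for a common curvature sphere `e`, the spheres through the circles have a common
normal direction `τ`, and the points on the circles are given by the parameters `(a k, b k)`. -/
structure IsCircleFamily (p s e τ : R42) (J K : Set ℤ) (r : ℤ → R42) (a b : ℤ → ℝ) : Prop where
  frame : ∀ n ∈ J, IsVertexFrame p s (r n) (e - lieForm e p • r n)
  normal : ∀ n ∈ J, IsUnitNormal s (r n) (e - lieForm e p • r n) τ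
  ne_zero : ∀ k ∈ K, a k ≠ 0 ∨ b k ≠ 0
  ne₁ : ∀ n k, n ∈ J → n + 1 ∈ J → k ∈ K →
    Submodule.span ℝ {circlePoint p s (r n) (e - lieForm e p • r n) (a k) (b k)} ≠
      Submodule.span ℝ {circlePoint p s (r (n + 1)) (e - lieForm e p • r (n + 1)) (a k) (b k)}
  ne₂ : ∀ n k, n ∈ J → k ∈ K → k + 1 ∈ K →
    Submodule.span ℝ {circlePoint p s (r n) (e - lieForm e p • r n) (a k) (b k)} ≠
      Submodule.span ℝ {circlePoint p s (r n) (e - lieForm e p • r n) (a (k + 1)) (b (k + 1))}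

namespace IsCircleFamily

variable {p s e τ : R42} {J K : Set ℤ} {r : ℤ → R42} {a b : ℤ → ℝ}

theorem circlePoint_sub (n n' k : ℤ) :
    circlePoint p s (r n') (e - lieForm e p • r n') (a k) (b k) -
        circlePoint p s (r n) (e - lieForm e p • r n) (a k) (b k) =
      (-(lieForm s p * b k ^ 2) + 2 * a k * b k + 2 * a k ^ 2 * lieForm e p) • (r n' - r n) :=
  IsVertexFrame.circlePoint_sub (by module) _ _

theorem circleSphere_sub (n n' : ℤ) :
    circleSphere p (r n') τ - circleSphere p (r n) τ = (-lieForm τ p) • (r n' - r n) := by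
  rw [circleSphere, circleSphere]; module

theorem inf_edge (h : IsCircleFamily p s e τ J K r a b) {n k : ℤ} (hn : n ∈ J) (hn' : n + 1 ∈ J)
    (hk : k ∈ K) :
    tangentElement p s (r n) (e - lieForm e p • r n) τ (a k) (b k) ⊓
        tangentElement p s (r (n + 1)) (e - lieForm e p • r (n + 1)) τ (a k) (b k) =
      Submodule.span ℝ {(-(lieForm s p * b k ^ 2) + 2 * a k * b k + 2 * a k ^ 2 * lieForm e p) •
        circleSphere p (r n) τ - (-lieForm τ p) •
          circlePoint p s (r n) (e - lieForm e p • r n) (a k) (b k)} ∧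
    IsSphere (tangentElement p s (r n) (e - lieForm e p • r n) τ (a k) (b k) ⊓
        tangentElement p s (r (n + 1)) (e - lieForm e p • r (n + 1)) τ (a k) (b k)) :=
  (h.frame n hn).inf_tangentElement (h.normal n hn) (h.frame _ hn') (h.normal _ hn')
    (h.ne_zero k hk) (h.ne₁ n k hn hn' hk) (circlePoint_sub n (n + 1) k)
    (circleSphere_sub n (n + 1))

theorem inf_edge_circle (h : IsCircleFamily p s e τ J K r a b) {n k : ℤ} (hn : n ∈ J)
    (hk : k ∈ K) (hk' : k + 1 ∈ K) :
    tangentElement p s (r n) (e - lieForm e p • r n) τ (a k) (b k) ⊓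
        tangentElement p s (r n) (e - lieForm e p • r n) τ (a (k + 1)) (b (k + 1)) =
      Submodule.span ℝ {circleSphere p (r n) τ} ∧
    IsSphere (tangentElement p s (r n) (e - lieForm e p • r n) τ (a k) (b k) ⊓
        tangentElement p s (r n) (e - lieForm e p • r n) τ (a (k + 1)) (b (k + 1))) :=
  (h.frame n hn).inf_tangentElement_circle (h.normal n hn) (h.ne_zero k hk) (h.ne_zero _ hk')
    (h.ne₂ n k hn hk hk')

theorem isLegendre (h : IsCircleFamily p s e τ J K r a b) :
    IsLegendre J K fun n k =>
      tangentElement p s (r n) (e - lieForm e p • r n) τ (a k) (b k) where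
  contact n hn k hk := (h.frame n hn).isContactElement_tangentElement (h.normal n hn)
    (h.ne_zero k hk)
  edge₁ n k hn hn' hk := (h.inf_edge hn hn' hk).2
  edge₂ n k hn hk hk' := (h.inf_edge_circle hn hk hk').2
  circular n k hn hn' hk hk' q hq := by
    -- the four contact elements lie in a four-dimensional space
    let S := Submodule.span ℝ {circleSphere p (r n) τ,
      circlePoint p s (r n) (e - lieForm e p • r n) (a k) (b k),
      circlePoint p s (r n) (e - lieForm e p • r n) (a (k + 1)) (b (k + 1)), r (n + 1) - r n}
    have hS : finrank ℝ S ≤ 4 := finrank_span_quadruple_le _ _ _ _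
    have hd : r (n + 1) - r n ∈ S := Submodule.subset_span (by simp)
    have hN : circleSphere p (r n) τ ∈ S := Submodule.subset_span (by simp)
    have hN' : circleSphere p (r (n + 1)) τ ∈ S := by
      rw [eq_add_of_sub_eq (circleSphere_sub n (n + 1))]
      exact add_mem (Submodule.smul_mem _ _ hd) hN
    have hX : ∀ l, circlePoint p s (r n) (e - lieForm e p • r n) (a l) (b l) ∈ S →
        circlePoint p s (r (n + 1)) (e - lieForm e p • r (n + 1)) (a l) (b l) ∈ S := by
      intro l hl
      rw [eq_add_of_sub_eq (circlePoint_sub n (n + 1) l)]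
      exact add_mem (Submodule.smul_mem _ _ hd) hl
    have h1 : circlePoint p s (r n) (e - lieForm e p • r n) (a k) (b k) ∈ S :=
      Submodule.subset_span (by simp)
    have h2 : circlePoint p s (r n) (e - lieForm e p • r n) (a (k + 1)) (b (k + 1)) ∈ S :=
      Submodule.subset_span (by simp)
    have hle : ∀ {x y : R42}, x ∈ S → y ∈ S → Submodule.span ℝ {x, y} ≤ S := by
      intro x y hx hy
      rw [Submodule.span_le]
      rintro _ (rfl | rfl)
      · exact hx
      · exact hy
    refine (Submodule.finrank_mono ?_).trans (finrank_inf_perp_le_three hS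
      ((h.frame n hn).isContactElement_tangentElement (h.normal n hn) (h.ne_zero k hk))
      (hle h1 hN) hq)
    exact sup_le (sup_le (sup_le (inf_le_inf_right _ (hle h1 hN))
      (inf_le_inf_right _ (hle (hX k h1) hN'))) (inf_le_inf_right _ (hle h2 hN)))
      (inf_le_inf_right _ (hle (hX (k + 1) h2) hN'))

theorem lieForm_e (h : IsCircleFamily p s e τ J K r a b) {n : ℤ} (hn : n ∈ J) :
    lieForm e e = 0 ∧ lieForm e s = 1 ∧ lieForm e (r n) = 0 ∧ lieForm τ e = 0 := by
  have H := h.frame n hn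
  have N := h.normal n hn
  have h1 : lieForm e s = 1 := by simpa [H.rs] using H.Fs
  have h2 : lieForm e (r n) = 0 := by simpa [H.rr] using H.Fr
  have h3 : lieForm τ e = 0 := by simpa [N.r] using N.F
  refine ⟨?_, h1, h2, h3⟩
  simpa [H.rr, h2, lieForm_comm (r n) e] using H.FF

/-- The `(2,1)`-plane that contains the curvature spheres across the circles. -/
noncomputable def cyclidePlane (p s e τ : R42) : Submodule ℝ R42 :=
  Submodule.span ℝ {lieForm τ p • s - lieForm s p • (τ + p),
    lieForm τ p • e - lieForm e p • (τ + p), τ + (1 + lieForm τ p) • p}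

theorem hasSignature_cyclidePlane (h : IsCircleFamily p s e τ J K r a b) {n : ℤ} (hn : n ∈ J)
    (hT : lieForm τ p ≠ 0) : HasSignature (cyclidePlane p s e τ) 2 1 := by
  have H := h.frame n hn
  have N := h.normal n hn
  obtain ⟨hee, hes, her, hτe⟩ := h.lieForm_e hn
  have hsτ : lieForm s τ = 0 := by rw [lieForm_comm, N.s]
  have hse : lieForm s e = 1 := by rw [lieForm_comm, hes]
  have heτ : lieForm e τ = 0 := by rw [lieForm_comm, hτe]
  have hT2 : 0 < lieForm τ p ^ 2 := by positivity
  refine hasSignature_of_null_pair ?_ ?_ ?_ ?_ ?_ ?_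
  · simp only [map_add, map_sub, map_smul, LinearMap.add_apply, LinearMap.sub_apply,
      LinearMap.smul_apply, smul_eq_mul, H.ss, H.pp, N.self, N.s, hsτ, lieForm_comm p s,
      lieForm_comm p τ]
    ring
  · simp only [map_add, map_sub, map_smul, LinearMap.add_apply, LinearMap.sub_apply,
      LinearMap.smul_apply, smul_eq_mul, H.pp, N.self, hee, hτe, heτ, lieForm_comm p e,
      lieForm_comm p τ]
    ring
  · convert hT2 using 1
    simp only [map_add, map_sub, map_smul, LinearMap.add_apply, LinearMap.sub_apply,
      LinearMap.smul_apply, smul_eq_mul, H.pp, N.self, hsτ, hse, hτe, lieForm_comm p e, lieForm_comm p τ]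
    ring
  · convert hT2 using 1
    simp only [map_add, map_smul, LinearMap.add_apply,
      LinearMap.smul_apply, smul_eq_mul, H.pp, N.self, lieForm_comm p τ]
    ring
  · simp only [map_add, map_sub, map_smul, LinearMap.add_apply, LinearMap.sub_apply,
      LinearMap.smul_apply, smul_eq_mul, H.pp, N.self, hsτ, lieForm_comm p τ]
    ring
  · simp only [map_add, map_sub, map_smul, LinearMap.add_apply, LinearMap.sub_apply,
      LinearMap.smul_apply, smul_eq_mul, H.pp, N.self, heτ, lieForm_comm p τ]
    ring

theorem circleSphere_mem_perp (h : IsCircleFamily p s e τ J K r a b) {n : ℤ} (hn : n ∈ J) :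
    circleSphere p (r n) τ ∈ perp (cyclidePlane p s e τ) := by
  have H := h.frame n hn
  have N := h.normal n hn
  obtain ⟨hee, hes, her, hτe⟩ := h.lieForm_e hn
  have hsτ : lieForm s τ = 0 := by rw [lieForm_comm, N.s]
  have heτ : lieForm e τ = 0 := by rw [lieForm_comm, hτe]
  rw [cyclidePlane, mem_perp_span]
  rintro _ (rfl | rfl | rfl) <;>
  · simp only [circleSphere, map_add, map_sub, map_smul, LinearMap.add_apply, LinearMap.sub_apply,
      LinearMap.smul_apply, smul_eq_mul, H.pp, N.self, N.r, H.sr, H.pr, hsτ, her, heτ,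
      lieForm_comm p τ]
    ring

theorem curvatureSphere_mem (p s e τ ρ : R42) (α β : ℝ) :
    (-(lieForm s p * β ^ 2) + 2 * α * β + 2 * α ^ 2 * lieForm e p) • circleSphere p ρ τ -
        (-lieForm τ p) • circlePoint p s ρ (e - lieForm e p • ρ) α β ∈ cyclidePlane p s e τ := by
  have : (-(lieForm s p * β ^ 2) + 2 * α * β + 2 * α ^ 2 * lieForm e p) • circleSphere p ρ τ -
        (-lieForm τ p) • circlePoint p s ρ (e - lieForm e p • ρ) α β =
      β ^ 2 • (lieForm τ p • s - lieForm s p • (τ + p)) +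
        (-(2 * α ^ 2)) • (lieForm τ p • e - lieForm e p • (τ + p)) +
        (2 * α * β) • (τ + (1 + lieForm τ p) • p) := by
    rw [circleSphere, circlePoint]; module
  rw [this, cyclidePlane]
  exact add_mem (add_mem (Submodule.smul_mem _ _ (Submodule.subset_span (by simp)))
    (Submodule.smul_mem _ _ (Submodule.subset_span (by simp))))
    (Submodule.smul_mem _ _ (Submodule.subset_span (by simp)))

/-- If `⟨τ, p⟩ = 0`, all contact elements contain the sphere `τ + p`. -/
theorem isTotallyUmbilic (h : IsCircleFamily p s e τ J K r a b) {n₀ : ℤ} (hn₀ : n₀ ∈ J)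
    (hT : lieForm τ p = 0) : IsTotallyUmbilic J K fun n k =>
      tangentElement p s (r n) (e - lieForm e p • r n) τ (a k) (b k) := by
  have hC : ∀ n, circleSphere p (r n) τ = circleSphere p (r n₀) τ := fun n => by
    simp [circleSphere, hT]
  refine h.isLegendre.isTotallyUmbilic (h.frame n₀ hn₀).circleSphere_ne_zero
    ((h.frame n₀ hn₀).circleSphere_self (h.normal n₀ hn₀)) fun n _ k _ => ?_
  rw [← hC n]
  exact Submodule.subset_span (by simp)

/-- The circles are circular curvature lines. -/
theorem isCircularLine_circle (h : IsCircleFamily p s e τ J K r a b) {n k₀ : ℤ} (hn : n ∈ J)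
    (hk₀ : k₀ ∈ K) : IsCircularLine K fun k =>
      tangentElement p s (r n) (e - lieForm e p • r n) τ (a k) (b k) := by
  refine isCircularLine_of_le (S := Submodule.span ℝ {circleSphere p (r n) τ,
    s - lieForm s p • r n, r n + p, e - lieForm e p • r n}) (finrank_span_quadruple_le _ _ _ _) hk₀
    ((h.frame n hn).isContactElement_tangentElement (h.normal n hn) (h.ne_zero k₀ hk₀)) ?_
  intro k _
  rw [tangentElement, Submodule.span_le]
  rintro _ (rfl | rfl)
  · rw [circlePoint]
    exact sub_mem (add_mem (Submodule.smul_mem _ _ (Submodule.subset_span (by simp)))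
      (Submodule.smul_mem _ _ (Submodule.subset_span (by simp))))
      (Submodule.smul_mem _ _ (Submodule.subset_span (by simp)))
  · exact Submodule.subset_span (by simp)

/-- The orthogonal trajectories are circular in the umbilic case: the spheres `r n` lie in the
orthogonal complement of `s`, `e`, `τ`. -/
theorem isCircularLine_trajectory (h : IsCircleFamily p s e τ J K r a b) {n₀ k : ℤ} (hn₀ : n₀ ∈ J)
    (hk : k ∈ K) (hT : lieForm τ p = 0) : IsCircularLine J fun n =>
      tangentElement p s (r n) (e - lieForm e p • r n) τ (a k) (b k) := by
  have H := h.frame n₀ hn₀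
  have N := h.normal n₀ hn₀
  obtain ⟨hee, hes, her, hτe⟩ := h.lieForm_e hn₀
  have hse : lieForm s e = 1 := by rw [lieForm_comm, hes]
  have hsτ : lieForm s τ = 0 := by rw [lieForm_comm, N.s]
  have heτ : lieForm e τ = 0 := by rw [lieForm_comm, hτe]
  have hsig : HasSignature (Submodule.span ℝ {s, e, τ}) 2 1 :=
    hasSignature_of_null_pair H.ss hee (by rw [hse]; norm_num) (by rw [N.self]; norm_num) hsτ heτ
  have hr : ∀ n ∈ J, r n ∈ perp (Submodule.span ℝ {s, e, τ}) := by
    intro n hn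
    rw [mem_perp_span]
    rintro _ (rfl | rfl | rfl)
    · exact (h.frame n hn).sr
    · exact (h.lieForm_e hn).2.2.1
    · exact (h.normal n hn).r
  refine isCircularLine_of_le (S := perp (Submodule.span ℝ {s, e, τ}) ⊓
    perp (Submodule.span ℝ {p}) ⊔ Submodule.span ℝ {circleSphere p (r n₀) τ} ⊔
    Submodule.span ℝ {circlePoint p s (r n₀) (e - lieForm e p • r n₀) (a k) (b k)}) ?_ hn₀
    (H.isContactElement_tangentElement N (h.ne_zero k hk)) ?_
  · refine finrank_sup_span_singleton_le (finrank_sup_span_singleton_le ?_ _) _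
    exact finrank_inf_perp_le hsig.perp.finrank_eq.le (hr n₀ hn₀) (by rw [H.rp]; norm_num)
  · intro n hn
    rw [tangentElement, Submodule.span_le]
    rintro _ (rfl | rfl)
    · rw [eq_add_of_sub_eq (circlePoint_sub n₀ n k)]
      refine add_mem (Submodule.mem_sup_left (Submodule.mem_sup_left (Submodule.smul_mem _ _
        ⟨sub_mem (hr n hn) (hr n₀ hn₀), mem_perp_singleton.2 ?_⟩)))
        (Submodule.mem_sup_right (Submodule.mem_span_singleton_self _))
      simp [(h.frame n hn).rp, H.rp]
    · have : circleSphere p (r n) τ = circleSphere p (r n₀) τ := by simp [circleSphere, hT]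
      rw [this]
      exact Submodule.mem_sup_left (Submodule.mem_sup_right (Submodule.mem_span_singleton_self _))

/-- The surface swept out by the circles along a coordinate line is a Dupin cyclide: either its
curvature spheres lie in the fixed splitting given by `cyclidePlane`, or it is umbilic. -/
theorem isDupinCyclide (h : IsCircleFamily p s e τ J K r a b) (hJ : IsDiscreteInterval J)
    (hK : IsDiscreteInterval K) : IsDupinCyclide J K fun n k =>
      tangentElement p s (r n) (e - lieForm e p • r n) τ (a k) (b k) := by
  obtain ⟨n₀, hn₀⟩ := hJ.nonempty
  obtain ⟨k₀, hk₀⟩ := hK.nonempty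
  by_cases hT : lieForm τ p = 0
  · have hU := h.isTotallyUmbilic hn₀ hT
    exact ⟨⟨h.isLegendre, Or.inr ⟨hU, fun k hk => h.isCircularLine_trajectory hn₀ hk hT⟩⟩,
      ⟨h.isLegendre.swap, Or.inr ⟨hU.swap, fun n hn => h.isCircularLine_circle hn hk₀⟩⟩⟩
  · have hW := h.hasSignature_cyclidePlane hn₀ hT
    have h1 : ∀ n k, n ∈ J → n + 1 ∈ J → k ∈ K →
        tangentElement p s (r n) (e - lieForm e p • r n) τ (a k) (b k) ⊓
          tangentElement p s (r (n + 1)) (e - lieForm e p • r (n + 1)) τ (a k) (b k) ≤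
        cyclidePlane p s e τ := by
      intro n k hn hn' hk
      rw [(h.inf_edge hn hn' hk).1, Submodule.span_singleton_le_iff_mem]
      exact curvatureSphere_mem p s e τ (r n) (a k) (b k)
    have h2 : ∀ n k, n ∈ J → k ∈ K → k + 1 ∈ K →
        tangentElement p s (r n) (e - lieForm e p • r n) τ (a k) (b k) ⊓
          tangentElement p s (r n) (e - lieForm e p • r n) τ (a (k + 1)) (b (k + 1)) ≤
        perp (cyclidePlane p s e τ) := by
      intro n k hn hk hk'
      rw [(h.inf_edge_circle hn hk hk').1, Submodule.span_singleton_le_iff_mem]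
      exact h.circleSphere_mem_perp hn
    refine ⟨⟨h.isLegendre, Or.inl fun k hk hk' => ⟨_, hW, hW.perp,
      fun n hn hn' => ⟨h1 n k hn hn' hk, h1 n (k + 1) hn hn' hk'⟩,
      fun n hn => h2 n k hn hk hk'⟩⟩, ⟨h.isLegendre.swap, Or.inl fun n hn hn' =>
      ⟨_, hW.perp, ?_, fun k hk hk' => ⟨h2 n k hn hk hk', h2 (n + 1) k hn' hk hk'⟩,
      fun k hk => ?_⟩⟩⟩
    · rw [perp_perp]; exact hW
    · rw [perp_perp]; exact h1 n k hn hn' hk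

end IsCircleFamily

/-! ### The splitting of a Dupin cyclide that is not totally umbilic -/

theorem IsDupinCyclide.hasConstantLieCyclides {I J : Set ℤ} {f : ℤ → ℤ → Submodule ℝ R42}
    (hf : IsDupinCyclide I J f) (hnu : ¬ IsTotallyUmbilic I J f) :
    HasConstantLieCyclides I J f ∧ HasConstantLieCyclides J I (fun n m => f m n) :=
  ⟨hf.1.2.resolve_right fun h => hnu h.1, hf.2.2.resolve_right fun h => hnu h.1.swap⟩

/-- The splittings of the ribbons of a Dupin cyclide can be replaced by a single one. If the spheres
`D n` do not all lie in the plane `δ` of one ribbon in the first direction, they span a `(2,1)`-plane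
and its complement is the plane of every ribbon in the second direction. -/
theorem exists_splitting {I J : Set ℤ} (hI : IsDiscreteInterval I) (hJ : IsDiscreteInterval J)
    {f : ℤ → ℤ → Submodule ℝ R42} (hf : IsLegendre I J f) (h₁ : HasConstantLieCyclides I J f)
    (h₂ : HasConstantLieCyclides J I (fun n m => f m n)) {s : R42} {D E : ℤ → R42}
    (hD : ∀ n ∈ J, ∀ m ∈ I, D n ∈ f m n) (hDs : ∀ n ∈ J, lieForm (D n) s = 1)
    (hE : ∀ m ∈ I, ∀ n ∈ J, E m ∈ f m n) (hEs : ∀ m ∈ I, lieForm (E m) s = 1) :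
    ∃ δ : Submodule ℝ R42, HasSignature δ 2 1 ∧ (∀ n ∈ J, D n ∈ δ) ∧
      ∀ m ∈ I, E m ∈ perp δ := by
  obtain ⟨m₀, hm₀, hm₀'⟩ := hI.exists_edge
  obtain ⟨n₀, hn₀, hn₀'⟩ := hJ.exists_edge
  obtain ⟨δ, hδ, -, hδ₁, hδ₂⟩ := h₁ n₀ hn₀ hn₀'
  obtain ⟨δ', hδ', -, -, hδ₂'⟩ := h₂ m₀ hm₀ hm₀'
  have hDδ : D n₀ ∈ δ := (hδ₁ m₀ hm₀ hm₀').1 ⟨hD n₀ hn₀ m₀ hm₀, hD n₀ hn₀ _ hm₀'⟩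
  have hDδ' : D (n₀ + 1) ∈ δ := (hδ₁ m₀ hm₀ hm₀').2 ⟨hD _ hn₀' m₀ hm₀, hD _ hn₀' _ hm₀'⟩
  have hEδ : ∀ m ∈ I, E m ∈ perp δ := fun m hm => hδ₂ m hm ⟨hE m hm n₀ hn₀, hE m hm _ hn₀'⟩
  have hD' : ∀ n ∈ J, D n ∈ perp δ' := fun n hn => hδ₂' n hn ⟨hD n hn m₀ hm₀, hD n hn _ hm₀'⟩
  by_cases hall : ∀ n ∈ J, D n ∈ δ
  · exact ⟨δ, hδ, hall, hEδ⟩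
  push Not at hall
  obtain ⟨n₁, hn₁, hDn₁⟩ := hall
  have hne : D n₀ ≠ D (n₀ + 1) := by
    intro heq
    -- otherwise adjacent contact elements share a second sphere
    have hli : LinearIndependent ℝ ![D n₀, E m₀] := by
      rw [LinearIndependent.pair_iff]
      intro x y hxy
      have hx : x • D n₀ = 0 := by
        refine hδ.disjoint_perp (δ.smul_mem _ hDδ) ?_
        rw [eq_neg_of_add_eq_zero_left hxy]
        exact (perp δ).neg_mem ((perp δ).smul_mem _ (hEδ m₀ hm₀))
      have hD0 : D n₀ ≠ 0 := by
        intro h0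
        have := hDs n₀ hn₀
        rw [h0] at this
        simp at this
      have hE0 : E m₀ ≠ 0 := by
        intro h0
        have := hEs m₀ hm₀
        rw [h0] at this
        simp at this
      have hx0 := (smul_eq_zero.1 hx).resolve_right hD0
      rw [hx0, zero_smul, zero_add] at hxy
      exact ⟨hx0, (smul_eq_zero.1 hxy).resolve_right hE0⟩
    have hf₀ := (hf.contact m₀ hm₀ n₀ hn₀).eq_span_pair hli (hD n₀ hn₀ m₀ hm₀) (hE m₀ hm₀ n₀ hn₀)
    have hf₁ := (hf.contact m₀ hm₀ _ hn₀').eq_span_pair hli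
      (by rw [heq]; exact hD _ hn₀' m₀ hm₀) (hE m₀ hm₀ _ hn₀')
    have := (hf.edge₂ m₀ n₀ hm₀ hn₀ hn₀').1
    rw [hf₀, hf₁, inf_idem, finrank_span_pair hli] at this
    norm_num at this
  have hspan : Submodule.span ℝ {D n₀ - D (n₀ + 1), D n₀} ⊔ Submodule.span ℝ {D n₁} =
      perp δ' := by
    have hle : Submodule.span ℝ {D n₀ - D (n₀ + 1), D n₀} ≤ δ := by
      rw [Submodule.span_le]
      rintro _ (rfl | rfl)
      · exact sub_mem hDδ hDδ'
      · exact hDδ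
    have hlt : Submodule.span ℝ {D n₀ - D (n₀ + 1), D n₀} <
        Submodule.span ℝ {D n₀ - D (n₀ + 1), D n₀} ⊔ Submodule.span ℝ {D n₁} :=
      lt_of_le_of_ne le_sup_left fun h => hDn₁ (hle (h.ge
        (Submodule.mem_sup_right (Submodule.mem_span_singleton_self _))))
    have hfr := Submodule.finrank_lt_finrank_of_lt hlt
    rw [finrank_span_pair (linearIndependent_pair_of_lieForm (z := s) (sub_ne_zero.2 hne)
      (by simp [hDs n₀ hn₀, hDs _ hn₀']) (by rw [hDs n₀ hn₀]; norm_num))] at hfr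
    refine Submodule.eq_of_le_of_finrank_le (sup_le ?_ ?_) ?_
    · rw [Submodule.span_le]
      rintro _ (rfl | rfl)
      · exact sub_mem (hD' n₀ hn₀) (hD' _ hn₀')
      · exact hD' n₀ hn₀
    · rw [Submodule.span_singleton_le_iff_mem]; exact hD' n₁ hn₁
    · rw [hδ'.perp.finrank_eq]; omega
  refine ⟨perp δ', hδ'.perp, hD', fun m hm => ?_⟩
  have hDE : ∀ n ∈ J, lieForm (D n) (E m) = 0 := fun n hn =>
    (hf.contact m hm n hn).2 _ (hD n hn m hm) _ (hE m hm n hn)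
  rw [← hspan, ← Submodule.span_union, mem_perp_span]
  rintro _ ((rfl | rfl) | rfl)
  · rw [map_sub, LinearMap.sub_apply, hDE n₀ hn₀, hDE _ hn₀', sub_zero]
  · exact hDE n₀ hn₀
  · exact hDE n₁ hn₁

/-- Unit tangents of the conic `⟨x, s⟩ = 1` in the light cone of a `(2,1)`-plane `W`, given by the
cross product with `s`. The sum of the tangents at two points is proportional to their difference:
the reflection that exchanges the points reverses the orientation of the conic. -/
theorem exists_conic_tangent {W : Submodule ℝ R42} (hW : HasSignature W 2 1) (s : R42) :
    ∃ N : R42 → R42, (∀ x ∈ W, lieForm x x = 0 → lieForm x s = 1 →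
        N x ∈ W ∧ lieForm (N x) x = 0 ∧ lieForm (N x) s = 0 ∧ lieForm (N x) (N x) = 1) ∧
      ∀ x ∈ W, ∀ y ∈ W, lieForm x x = 0 → lieForm y y = 0 → lieForm x s = 1 → lieForm y s = 1 →
        lieForm x y ≠ 0 → ∃ ν : ℝ, N x + N y = ν • (y - x) := by
  obtain ⟨e, rfl, ho, hp, hn⟩ := hW
  set b₀ := e (Sum.inl 0) with hb₀
  set b₁ := e (Sum.inl 1) with hb₁
  set b₂ := e (Sum.inr 0) with hb₂
  have h00 : lieForm b₀ b₀ = 1 := hp 0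
  have h11 : lieForm b₁ b₁ = 1 := hp 1
  have h22 : lieForm b₂ b₂ = -1 := hn 0
  have h01 : lieForm b₀ b₁ = 0 := ho _ _ (by simp)
  have h02 : lieForm b₀ b₂ = 0 := ho _ _ (by simp)
  have h12 : lieForm b₁ b₂ = 0 := ho _ _ (by simp)
  have h10 : lieForm b₁ b₀ = 0 := ho _ _ (by simp)
  have h20 : lieForm b₂ b₀ = 0 := ho _ _ (by simp)
  have h21 : lieForm b₂ b₁ = 0 := ho _ _ (by simp)
  have hmem : ∀ c₀ c₁ c₂ : ℝ, c₀ • b₀ + c₁ • b₁ + c₂ • b₂ ∈ Submodule.span ℝ (Set.range e) :=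
    fun c₀ c₁ c₂ => add_mem (add_mem
      (Submodule.smul_mem _ _ (Submodule.subset_span ⟨_, rfl⟩))
      (Submodule.smul_mem _ _ (Submodule.subset_span ⟨_, rfl⟩)))
      (Submodule.smul_mem _ _ (Submodule.subset_span ⟨_, rfl⟩))
  have hexp : ∀ x ∈ Submodule.span ℝ (Set.range e),
      x = lieForm b₀ x • b₀ + lieForm b₁ x • b₁ + (-lieForm b₂ x) • b₂ := by
    intro x hx
    obtain ⟨c, rfl⟩ := (Submodule.mem_span_range_iff_exists_fun ℝ).1 hx
    simp only [Fintype.sum_sum_type, Fin.sum_univ_two, Finset.univ_unique,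
      Fin.default_eq_zero, Finset.sum_singleton, ← hb₀, ← hb₁, ← hb₂, map_add, map_smul,
      smul_eq_mul, h00, h11, h22, h01, h02, h12, h10, h20, h21]
    module
  have hform : ∀ c₀ c₁ c₂ : ℝ, ∀ x, lieForm (c₀ • b₀ + c₁ • b₁ + c₂ • b₂) x =
      c₀ * lieForm b₀ x + c₁ * lieForm b₁ x + c₂ * lieForm b₂ x := fun c₀ c₁ c₂ x => by simp
  have hxy : ∀ x ∈ Submodule.span ℝ (Set.range e), ∀ y, lieForm x y =
      lieForm b₀ x * lieForm b₀ y + lieForm b₁ x * lieForm b₁ y - lieForm b₂ x * lieForm b₂ y := by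
    intro x hx y
    nth_rw 1 [hexp x hx]
    rw [hform]; ring
  refine ⟨fun x => (lieForm b₁ x * lieForm b₂ s - lieForm b₂ x * lieForm b₁ s) • b₀ +
    (lieForm b₂ x * lieForm b₀ s - lieForm b₀ x * lieForm b₂ s) • b₁ +
    (lieForm b₀ x * lieForm b₁ s - lieForm b₁ x * lieForm b₀ s) • b₂, ?_, ?_⟩
  · intro x hx hxx hxs
    rw [hxy x hx] at hxx hxs
    refine ⟨hmem _ _ _, ?_, ?_, ?_⟩
    · rw [hform]; ring
    · rw [hform]; ring
    · simp only [map_add, map_smul, LinearMap.add_apply, LinearMap.smul_apply, smul_eq_mul, h00,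
        h11, h22, h01, h02, h12, h10, h20, h21]
      linear_combination -(lieForm b₀ s ^ 2 + lieForm b₁ s ^ 2 - lieForm b₂ s ^ 2) * hxx +
        (lieForm b₀ x * lieForm b₀ s + lieForm b₁ x * lieForm b₁ s -
          lieForm b₂ x * lieForm b₂ s + 1) * hxs
  · intro x hx y hy hxx hyy hxs hys hg
    rw [hxy x hx] at hxx hxs hg
    rw [hxy y hy] at hyy hys
    beta_reduce
    have ex := hexp x hx
    have ey := hexp y hy
    generalize lieForm b₀ x = x₀ at *
    generalize lieForm b₁ x = x₁ at *
    generalize lieForm b₂ x = x₂ at *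
    generalize lieForm b₀ y = y₀ at *
    generalize lieForm b₁ y = y₁ at *
    generalize lieForm b₂ y = y₂ at *
    generalize lieForm b₀ s = s₀ at *
    generalize lieForm b₁ s = s₁ at *
    generalize lieForm b₂ s = s₂ at *
    set g := x₀ * y₀ + x₁ * y₁ - x₂ * y₂ with hgdef
    set d := x₀ * (y₁ * s₂ - y₂ * s₁) - x₁ * (y₀ * s₂ - y₂ * s₀) + x₂ * (y₀ * s₁ - y₁ * s₀)
      with hd
    -- Cramer's rule for the three coordinate vectors
    have e0 : g * ((x₁ * s₂ - x₂ * s₁) + (y₁ * s₂ - y₂ * s₁)) = d * (y₀ - x₀) := by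
      rw [hgdef, hd]
      linear_combination (x₁ * s₂ - x₂ * s₁) * hyy + (y₁ * s₂ - y₂ * s₁) * hxx -
        (x₁ * y₂ - x₂ * y₁) * (hys - hxs)
    have e1 : g * ((x₂ * s₀ - x₀ * s₂) + (y₂ * s₀ - y₀ * s₂)) = d * (y₁ - x₁) := by
      rw [hgdef, hd]
      linear_combination -(x₀ * s₂ - x₂ * s₀) * hyy - (y₀ * s₂ - y₂ * s₀) * hxx +
        (x₀ * y₂ - x₂ * y₀) * (hys - hxs)
    have e2 : g * ((x₀ * s₁ - x₁ * s₀) + (y₀ * s₁ - y₁ * s₀)) = d * (-y₂ - -x₂) := by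
      rw [hgdef, hd]
      linear_combination (x₀ * s₁ - x₁ * s₀) * hyy + (y₀ * s₁ - y₁ * s₀) * hxx -
        (x₀ * y₁ - x₁ * y₀) * (hys - hxs)
    have hdiv : ∀ {α β : ℝ}, g * α = d * β → α = d / g * β := by
      intro α β h
      field_simp
      rw [mul_comm α]
      exact h
    refine ⟨d / g, ?_⟩
    rw [ex, ey]
    have hsplit : ∀ α₀ α₁ α₂ β₀ β₁ β₂ : ℝ, (α₀ • b₀ + α₁ • b₁ + α₂ • b₂) +
        (β₀ • b₀ + β₁ • b₁ + β₂ • b₂) = (α₀ + β₀) • b₀ + (α₁ + β₁) • b₁ + (α₂ + β₂) • b₂ := by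
      intros; module
    rw [hsplit, hdiv e0, hdiv e1, hdiv e2]
    module

/-- Unit tangents along a sequence of points on the conic of a `(2,1)`-plane, with alternating
orientation. -/
theorem exists_alternating_tangents {W : Submodule ℝ R42} (hW : HasSignature W 2 1) (s : R42)
    {I : Set ℤ} {E : ℤ → R42} (hE : ∀ m ∈ I, E m ∈ W ∧ lieForm (E m) (E m) = 0 ∧
      lieForm (E m) s = 1)
    (hne : ∀ m, m ∈ I → m + 1 ∈ I → lieForm (E m) (E (m + 1)) ≠ 0) :
    ∃ τ : ℤ → R42, (∀ m ∈ I, τ m ∈ W ∧ lieForm (τ m) (E m) = 0 ∧ lieForm (τ m) s = 0 ∧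
        lieForm (τ m) (τ m) = 1) ∧
      ∀ m, m ∈ I → m + 1 ∈ I → ∃ ν : ℝ, τ (m + 1) - τ m = ν • (E (m + 1) - E m) := by
  obtain ⟨N, hN, hN'⟩ := exists_conic_tangent hW s
  refine ⟨fun m => if Even m then N (E m) else -N (E m), fun m hm => ?_, fun m hm hm' => ?_⟩
  · obtain ⟨h1, h2, h3⟩ := hE m hm
    obtain ⟨n1, n2, n3, n4⟩ := hN _ h1 h2 h3
    beta_reduce
    split_ifs
    · exact ⟨n1, n2, n3, n4⟩
    · exact ⟨W.neg_mem n1, by simp [n2], by simp [n3], by simp [n4]⟩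
  · obtain ⟨h1, h2, h3⟩ := hE m hm
    obtain ⟨h1', h2', h3'⟩ := hE _ hm'
    obtain ⟨ν, hν⟩ := hN' _ h1 _ h1' h2 h2' h3 h3' (hne m hm hm')
    beta_reduce
    by_cases hev : Even m
    · rw [if_pos hev, if_neg (by rw [Int.even_add_one]; exact not_not.2 hev)]
      exact ⟨-ν, by rw [neg_smul, ← hν]; module⟩
    · rw [if_neg hev, if_pos (Int.even_add_one.2 hev)]
      exact ⟨ν, by rw [← hν]; module⟩

/-- A Ribaucour pair of a Dupin cyclide and a totally umbilic surface, with the curvature spheres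
`D n`, `E m` of the cyclide and parallel orthonormal normal directions `τ m`, `ω n` of the
associated circles. -/
structure IsSplitNet (p s : R42) (I J : Set ℤ) (f : ℤ → ℤ → Submodule ℝ R42)
    (r F : ℤ → ℤ → R42) (D E τ ω : ℤ → R42) : Prop where
  net : IsFramedNet p s I J f r F
  eq_D : ∀ m ∈ I, ∀ n ∈ J, F m n = D n - lieForm (D n) p • r m n
  eq_E : ∀ m ∈ I, ∀ n ∈ J, F m n = E m - lieForm (E m) p • r m n
  normal_τ : ∀ m ∈ I, ∀ n ∈ J, IsUnitNormal s (r m n) (F m n) (τ m)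
  normal_ω : ∀ m ∈ I, ∀ n ∈ J, IsUnitNormal s (r m n) (F m n) (ω n)
  orthogonal : ∀ m ∈ I, ∀ n ∈ J, lieForm (τ m) (ω n) = 0
  edge_τ : ∀ m, m ∈ I → m + 1 ∈ I → ∃ ν : ℝ, τ (m + 1) - τ m = ν • (E (m + 1) - E m)
  edge_ω : ∀ n, n ∈ J → n + 1 ∈ J → ∃ ν : ℝ, ω (n + 1) - ω n = ν • (D (n + 1) - D n)

theorem IsSplitNet.swap {p s : R42} {I J : Set ℤ} {f : ℤ → ℤ → Submodule ℝ R42}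
    {r F : ℤ → ℤ → R42} {D E τ ω : ℤ → R42} (h : IsSplitNet p s I J f r F D E τ ω) :
    IsSplitNet p s J I (fun n m => f m n) (fun n m => r m n) (fun n m => F m n) E D ω τ where
  net := h.net.swap
  eq_D n hn m hm := h.eq_E m hm n hn
  eq_E n hn m hm := h.eq_D m hm n hn
  normal_τ n hn m hm := h.normal_ω m hm n hn
  normal_ω n hn m hm := h.normal_τ m hm n hn
  orthogonal n hn m hm := by rw [lieForm_comm]; exact h.orthogonal m hm n hn
  edge_τ := h.edge_ω
  edge_ω := h.edge_τ

theorem IsFramedNet.exists_isSplitNet {p s : R42} {I J : Set ℤ} {f : ℤ → ℤ → Submodule ℝ R42}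
    {r F : ℤ → ℤ → R42} (h : IsFramedNet p s I J f r F) (hI : IsDiscreteInterval I)
    (hJ : IsDiscreteInterval J) (hf : IsDupinCyclide I J f) (hnu : ¬ IsTotallyUmbilic I J f) :
    ∃ D E τ ω : ℤ → R42, IsSplitNet p s I J f r F D E τ ω := by
  have hD : ∀ n ∈ J, ∃ D : R42, lieForm D s = 1 ∧ ∀ m ∈ I, D ∈ f m n := fun n hn => by
    obtain ⟨D, _, h1, -, h2⟩ := h.exists_line hI hJ hf.1 hn
    exact ⟨D, h1, fun m hm => (h2 m hm).1⟩
  have hE : ∀ m ∈ I, ∃ E : R42, lieForm E s = 1 ∧ ∀ n ∈ J, E ∈ f m n := fun m hm => by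
    obtain ⟨E, _, h1, -, h2⟩ := h.swap.exists_line hJ hI hf.2 hm
    exact ⟨E, h1, fun n hn => (h2 n hn).1⟩
  choose! D hDs hD using hD
  choose! E hEs hE using hE
  obtain ⟨hc₁, hc₂⟩ := hf.hasConstantLieCyclides hnu
  obtain ⟨δ, hδ, hDδ, hEδ⟩ := exists_splitting hI hJ h.legendre hc₁ hc₂ hD hDs hE hEs
  obtain ⟨m₀, hm₀⟩ := hI.nonempty
  obtain ⟨n₀, hn₀⟩ := hJ.nonempty
  have hFD : ∀ m ∈ I, ∀ n ∈ J, F m n = D n - lieForm (D n) p • r m n := fun m hm n hn =>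
    h.eq_add_smul hm hn (hD n hn m hm) (hDs n hn)
  have hFE : ∀ m ∈ I, ∀ n ∈ J, F m n = E m - lieForm (E m) p • r m n := fun m hm n hn =>
    h.eq_add_smul hm hn (hE m hm n hn) (hEs m hm)
  have hDE : ∀ m ∈ I, ∀ n ∈ J, D n - E m = (lieForm (D n) p - lieForm (E m) p) • r m n :=
    fun m hm n hn => by
      have := (hFD m hm n hn).symm.trans (hFE m hm n hn)
      rw [sub_smul, sub_eq_sub_iff_sub_eq_sub.1 this]
  have hne : ∀ m ∈ I, ∀ n ∈ J, lieForm (D n) p - lieForm (E m) p ≠ 0 := by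
    intro m hm n hn h0
    have h1 := hDE m hm n hn
    rw [h0, zero_smul, sub_eq_zero] at h1
    have h2 : D n = 0 := hδ.disjoint_perp (hDδ n hn) (by rw [h1]; exact hEδ m hm)
    have h3 := hDs n hn
    rw [h2] at h3
    simp at h3
  have hDDnull : ∀ n ∈ J, lieForm (D n) (D n) = 0 := fun n hn =>
    (h.legendre.contact m₀ hm₀ n hn).2 _ (hD n hn m₀ hm₀) _ (hD n hn m₀ hm₀)
  have hEEnull : ∀ m ∈ I, lieForm (E m) (E m) = 0 := fun m hm =>
    (h.legendre.contact m hm n₀ hn₀).2 _ (hE m hm n₀ hn₀) _ (hE m hm n₀ hn₀)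
  have hDEorth : ∀ m ∈ I, ∀ n ∈ J, lieForm (D n) (E m) = 0 := fun m hm n hn =>
    (h.legendre.contact m hm n hn).2 _ (hD n hn m hm) _ (hE m hm n hn)
  have hEE : ∀ m, m ∈ I → m + 1 ∈ I → lieForm (E m) (E (m + 1)) ≠ 0 := by
    intro m hm hm' h0
    have h1 : lieForm (D n₀ - E m) (D n₀ - E (m + 1)) = 0 := by
      simp [hDDnull n₀ hn₀, hDEorth m hm n₀ hn₀, hDEorth _ hm' n₀ hn₀, h0, lieForm_comm (E m) (D n₀)]
    rw [hDE m hm n₀ hn₀, hDE _ hm' n₀ hn₀] at h1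
    simp [hne m hm n₀ hn₀, hne _ hm' n₀ hn₀, h.ne₁ m n₀ hm hm' hn₀] at h1
  have hDD : ∀ n, n ∈ J → n + 1 ∈ J → lieForm (D n) (D (n + 1)) ≠ 0 := by
    intro n hn hn' h0
    have h1 : lieForm (D n - E m₀) (D (n + 1) - E m₀) = 0 := by
      simp [hEEnull m₀ hm₀, hDEorth m₀ hm₀ n hn, hDEorth m₀ hm₀ _ hn', h0,
        lieForm_comm (E m₀) (D (n + 1))]
    rw [hDE m₀ hm₀ n hn, hDE m₀ hm₀ _ hn'] at h1
    simp [hne m₀ hm₀ n hn, hne m₀ hm₀ _ hn', h.ne₂ m₀ n hm₀ hn hn'] at h1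
  obtain ⟨τ, hτ, hτ'⟩ := exists_alternating_tangents hδ.perp s (I := I) (E := E)
    (fun m hm => ⟨hEδ m hm, hEEnull m hm, hEs m hm⟩) hEE
  obtain ⟨ω, hω, hω'⟩ := exists_alternating_tangents hδ s (I := J) (E := D)
    (fun n hn => ⟨hDδ n hn, hDDnull n hn, hDs n hn⟩) hDD
  refine ⟨D, E, τ, ω, h, hFD, hFE, fun m hm n hn => ?_, fun m hm n hn => ?_,
    fun m hm n hn => ?_, hτ', hω'⟩
  · obtain ⟨h1, h2, h3, h4⟩ := hτ m hm
    have h5 : lieForm (τ m) (r m n) = 0 := by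
      have h6 := congrArg (lieForm (τ m)) (hDE m hm n hn)
      rw [map_sub, h2, lieForm_comm, h1 _ (hDδ n hn), map_smul, sub_zero, smul_eq_mul] at h6
      exact (mul_eq_zero.1 h6.symm).resolve_left (hne m hm n hn)
    exact ⟨h4, h3, h5, by rw [hFE m hm n hn]; simp [h2, h5]⟩
  · obtain ⟨h1, h2, h3, h4⟩ := hω n hn
    have h5 : lieForm (ω n) (r m n) = 0 := by
      have h6 := congrArg (lieForm (ω n)) (hDE m hm n hn)
      rw [map_sub, h2, hEδ m hm _ h1, map_smul, sub_zero, smul_eq_mul] at h6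
      exact (mul_eq_zero.1 h6.symm).resolve_left (hne m hm n hn)
    exact ⟨h4, h3, h5, by rw [hFD m hm n hn]; simp [h2, h5]⟩
  · rw [lieForm_comm]
    exact (hτ m hm).1 _ (hω n hn).1

/-! ### The triply orthogonal system -/

theorem OrthogonalSpheres.symm {p x y : R42} (h : OrthogonalSpheres p x y) :
    OrthogonalSpheres p y x := by
  rw [OrthogonalSpheres] at h ⊢
  simp only [map_add, map_smul, smul_eq_mul] at h ⊢
  rw [lieForm_comm y x]
  linear_combination h

theorem OrthogonalSpheres.lieInversion {p x y : R42} (hp : lieForm p p = -1)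
    (h : OrthogonalSpheres p x y) : OrthogonalSpheres p x (lieInversion p y) := by
  rw [OrthogonalSpheres] at h ⊢
  rw [lieInversion_of_timelike hp]
  simp only [map_add, map_smul, LinearMap.add_apply, LinearMap.smul_apply, smul_eq_mul, hp] at h ⊢
  linear_combination h

namespace IsVertexFrame

variable {p s r F τ ω : R42}

theorem circleSphere_circleSphere (H : IsVertexFrame p s r F) (N : IsUnitNormal s r F τ)
    (M : IsUnitNormal s r F ω) (h : lieForm τ ω = 0) :
    lieForm (circleSphere p r τ) (circleSphere p r ω) = -1 := by
  simp only [circleSphere, map_add, map_sub, map_smul, LinearMap.add_apply, LinearMap.sub_apply,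
    LinearMap.smul_apply, smul_eq_mul, N.r, M.r, H.rr, H.rp, H.pr, H.pp, h, lieForm_comm r ω,
    lieForm_comm p ω]
  ring

theorem orthogonal_tangentElement (H : IsVertexFrame p s r F) (N : IsUnitNormal s r F τ)
    (M : IsUnitNormal s r F ω) (h : lieForm τ ω = 0) {a b : ℝ} {x y : R42}
    (hx : x ∈ tangentElement p s r F τ a b) (hy : y ∈ tangentElement p s r F ω a b) :
    OrthogonalSpheres p x y := by
  obtain ⟨α, β, rfl⟩ := Submodule.mem_span_pair.1 hx
  obtain ⟨γ, δ, rfl⟩ := Submodule.mem_span_pair.1 hy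
  simp only [OrthogonalSpheres, map_add, map_smul, LinearMap.add_apply, LinearMap.smul_apply,
    smul_eq_mul, H.circleSphere_circleSphere N M h, H.circlePoint_circleSphere N,
    lieForm_comm (circlePoint p s r F a b) (circleSphere p r ω), H.circlePoint_circleSphere M,
    H.circlePoint_self, H.circlePoint_p, H.circleSphere_p]
  ring

theorem orthogonal_orthElement (H : IsVertexFrame p s r F) (N : IsUnitNormal s r F τ) {a b : ℝ}
    (hab : a ≠ 0 ∨ b ≠ 0) {x y : R42} (hx : x ∈ tangentElement p s r F τ a b)
    (hy : y ∈ orthElement p s r F a b) : OrthogonalSpheres p x y := by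
  have hXy : lieForm (circlePoint p s r F a b) y = 0 :=
    (H.isContactElement_orthElement hab).2 _ (circlePoint_mem p s r F a b) y hy
  have hNy : lieForm (circleSphere p r τ) y - lieForm y p = 0 := by
    obtain ⟨α, β, rfl⟩ := Submodule.mem_span_pair.1 hy
    simp only [orthSphere, orthSphere', map_add, map_sub, map_smul, LinearMap.add_apply,
      LinearMap.sub_apply, LinearMap.smul_apply, smul_eq_mul, H.circleSphere_p,
      H.circleSphere_r N, H.circleSphere_s N, H.circleSphere_F N, H.rp, H.Fp, H.pp]
    ring
  obtain ⟨α, β, rfl⟩ := Submodule.mem_span_pair.1 hx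
  simp only [OrthogonalSpheres, map_add, map_smul, LinearMap.add_apply, LinearMap.smul_apply,
    smul_eq_mul, hXy, H.circlePoint_p, H.circleSphere_p]
  linear_combination β * hNy

end IsVertexFrame

/-- A split net together with parameters `(a k, b k)` of orthogonal surfaces whose point spheres
form a net in which adjacent points are distinct. -/
structure IsSplitFamily (p s : R42) (I J K : Set ℤ) (f : ℤ → ℤ → Submodule ℝ R42)
    (r F : ℤ → ℤ → R42) (D E τ ω : ℤ → R42) (a b : ℤ → ℝ) : Prop where
  split : IsSplitNet p s I J f r F D E τ ω
  ne_zero : ∀ k ∈ K, a k ≠ 0 ∨ b k ≠ 0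
  ne₁ : ∀ m n k, m ∈ I → m + 1 ∈ I → n ∈ J → k ∈ K →
    Submodule.span ℝ {circlePoint p s (r m n) (F m n) (a k) (b k)} ≠
      Submodule.span ℝ {circlePoint p s (r (m + 1) n) (F (m + 1) n) (a k) (b k)}
  ne₂ : ∀ m n k, m ∈ I → n ∈ J → n + 1 ∈ J → k ∈ K →
    Submodule.span ℝ {circlePoint p s (r m n) (F m n) (a k) (b k)} ≠
      Submodule.span ℝ {circlePoint p s (r m (n + 1)) (F m (n + 1)) (a k) (b k)}
  ne₃ : ∀ m n k, m ∈ I → n ∈ J → k ∈ K → k + 1 ∈ K →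
    Submodule.span ℝ {circlePoint p s (r m n) (F m n) (a k) (b k)} ≠
      Submodule.span ℝ {circlePoint p s (r m n) (F m n) (a (k + 1)) (b (k + 1))}

namespace IsSplitFamily

variable {p s : R42} {I J K : Set ℤ} {f : ℤ → ℤ → Submodule ℝ R42} {r F : ℤ → ℤ → R42}
  {D E τ ω : ℤ → R42} {a b : ℤ → ℝ}

theorem swap (h : IsSplitFamily p s I J K f r F D E τ ω a b) :
    IsSplitFamily p s J I K (fun n m => f m n) (fun n m => r m n) (fun n m => F m n) E D ω τ a b where
  split := h.split.swap
  ne_zero := h.ne_zero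
  ne₁ n m k hn hn' hm hk := h.ne₂ m n k hm hn hn' hk
  ne₂ n m k hn hm hm' hk := h.ne₁ m n k hm hm' hn hk
  ne₃ n m k hn hm hk hk' := h.ne₃ m n k hm hn hk hk'

theorem frame (h : IsSplitFamily p s I J K f r F D E τ ω a b) {m n : ℤ} (hm : m ∈ I)
    (hn : n ∈ J) : IsVertexFrame p s (r m n) (F m n) := h.split.net.frame m hm n hn

theorem isCircleFamily (h : IsSplitFamily p s I J K f r F D E τ ω a b) {m : ℤ} (hm : m ∈ I) :
    IsCircleFamily p s (E m) (τ m) J K (r m) a b where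
  frame n hn := by rw [← h.split.eq_E m hm n hn]; exact h.frame hm hn
  normal n hn := by rw [← h.split.eq_E m hm n hn]; exact h.split.normal_τ m hm n hn
  ne_zero := h.ne_zero
  ne₁ n k hn hn' hk := by
    rw [← h.split.eq_E m hm n hn, ← h.split.eq_E m hm _ hn']
    exact h.ne₂ m n k hm hn hn' hk
  ne₂ n k hn hk hk' := by
    rw [← h.split.eq_E m hm n hn]
    exact h.ne₃ m n k hm hn hk hk'

/-- The circles along a coordinate line of the second direction sweep out a Dupin cyclide. -/
theorem isDupinCyclide_tangentElement (h : IsSplitFamily p s I J K f r F D E τ ω a b)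
    (hJ : IsDiscreteInterval J) (hK : IsDiscreteInterval K) {m : ℤ} (hm : m ∈ I) :
    IsDupinCyclide J K fun n k => tangentElement p s (r m n) (F m n) (τ m) (a k) (b k) :=
  ((h.isCircleFamily hm).isDupinCyclide hJ hK).congr fun n hn k _ => by
    rw [← h.split.eq_E m hm n hn]

/-- Contact elements of different coordinate surfaces of one family share a sphere: the tangent
directions `τ` move in the direction of `r`. -/
theorem isSphere_edge (h : IsSplitFamily p s I J K f r F D E τ ω a b) {m n k : ℤ} (hm : m ∈ I)
    (hm' : m + 1 ∈ I) (hn : n ∈ J) (hk : k ∈ K) :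
    IsSphere (tangentElement p s (r m n) (F m n) (τ m) (a k) (b k) ⊓
      tangentElement p s (r (m + 1) n) (F (m + 1) n) (τ (m + 1)) (a k) (b k)) := by
  obtain ⟨κ, hκ⟩ := h.split.net.edge₁ hm hm' hn
  obtain ⟨ν, hν⟩ := h.split.edge_τ m hm hm'
  have hDE : ∀ {l : ℤ}, l ∈ I →
      E l = D n - (lieForm (D n) p - lieForm (E l) p) • r l n := fun {l} hl => by
    have := (h.split.eq_D l hl n hn).symm.trans (h.split.eq_E l hl n hn)
    rw [sub_smul, ← sub_add, this, sub_add_cancel]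
  have hT : lieForm (τ (m + 1)) p - lieForm (τ m) p =
      ν * (lieForm (E (m + 1)) p - lieForm (E m) p) := by
    have := congrArg (fun v => lieForm v p) hν
    simpa using this
  refine ((h.frame hm hn).inf_tangentElement (h.split.normal_τ m hm n hn) (h.frame hm' hn)
    (h.split.normal_τ _ hm' n hn) (h.ne_zero k hk) (h.ne₁ m n k hm hm' hn hk)
    (IsVertexFrame.circlePoint_sub hκ _ _)
    (ρ := -(ν * (lieForm (D n) p - lieForm (E (m + 1)) p) + lieForm (τ (m + 1)) p)) ?_).2
  have h1 : E (m + 1) - E m = (lieForm (D n) p - lieForm (E m) p) • r m n -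
      (lieForm (D n) p - lieForm (E (m + 1)) p) • r (m + 1) n := by
    linear_combination (exp := 1) hDE hm' - hDE hm
  have h2 : τ (m + 1) = τ m + ν • (E (m + 1) - E m) := by rw [← hν]; module
  have h3 : lieForm (τ m) p =
      lieForm (τ (m + 1)) p - ν * (lieForm (E (m + 1)) p - lieForm (E m) p) := by
    rw [← hT]; ring
  rw [circleSphere, circleSphere, h3]
  nth_rw 1 [h2]
  rw [h1]
  module

/-- The contact elements orthogonal to the circles, with orientations alternating in the third
direction so that adjacent ones belong to opposite rulings and share a sphere. -/
noncomputable def alternatingElement (p s : R42) (r F : ℤ → ℤ → R42) (a b : ℤ → ℝ) (m n k : ℤ) :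
    Submodule ℝ R42 :=
  if Even k then orthElement p s (r m n) (F m n) (a k) (b k)
  else (orthElement p s (r m n) (F m n) (a k) (b k)).map (lieInversion p)

theorem isContactElement_alternatingElement (h : IsSplitFamily p s I J K f r F D E τ ω a b)
    {m n k : ℤ} (hm : m ∈ I) (hn : n ∈ J) (hk : k ∈ K) :
    IsContactElement (alternatingElement p s r F a b m n k) := by
  have hc := (h.frame hm hn).isContactElement_orthElement (h.ne_zero k hk)
  rw [alternatingElement]
  split_ifs
  · exact hc
  · exact hc.map (reversal_isometry (h.frame hm hn).pp)

theorem pointSphere_alternatingElement (h : IsSplitFamily p s I J K f r F D E τ ω a b)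
    {m n k : ℤ} (hm : m ∈ I) (hn : n ∈ J) (hk : k ∈ K) :
    pointSphere p (alternatingElement p s r F a b m n k) =
      Submodule.span ℝ {circlePoint p s (r m n) (F m n) (a k) (b k)} := by
  have hc := (h.frame hm hn).pointSphere_orthElement (h.ne_zero k hk)
  rw [alternatingElement]
  split_ifs
  · exact hc
  · rw [pointSphere_map_lieInversion (h.frame hm hn).pp, hc]

theorem isSphere_alternatingElement (h : IsSplitFamily p s I J K f r F D E τ ω a b)
    {m n k : ℤ} (hm : m ∈ I) (hn : n ∈ J) (hk : k ∈ K) (hk' : k + 1 ∈ K) :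
    IsSphere (alternatingElement p s r F a b m n k ⊓
      alternatingElement p s r F a b m n (k + 1)) := by
  have H := h.frame hm hn
  have hne : alternatingElement p s r F a b m n k ≠ alternatingElement p s r F a b m n (k + 1) := by
    intro he
    apply h.ne₃ m n k hm hn hk hk'
    rw [← h.pointSphere_alternatingElement hm hn hk, ← h.pointSphere_alternatingElement hm hn hk',
      he]
  obtain ⟨x, hx0, hx, hx'⟩ : ∃ x, x ≠ 0 ∧ x ∈ alternatingElement p s r F a b m n k ∧
      x ∈ alternatingElement p s r F a b m n (k + 1) := by
    by_cases hev : Even k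
    · rw [alternatingElement, alternatingElement, if_pos hev,
        if_neg (by rw [Int.even_add_one]; exact not_not.2 hev)]
      exact H.exists_mem_orthElement_reversed (h.ne_zero k hk) (h.ne_zero _ hk')
    · rw [alternatingElement, alternatingElement, if_neg hev, if_pos (Int.even_add_one.2 hev)]
      obtain ⟨x, h0, h1, h2⟩ :=
        H.exists_mem_orthElement_reversed (h.ne_zero _ hk') (h.ne_zero k hk)
      exact ⟨x, h0, h2, h1⟩
  exact (h.isContactElement_alternatingElement hm hn hk).isSphere_inf
    (h.isContactElement_alternatingElement hm hn hk') hne hx0 hx hx'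

theorem orthogonal_alternatingElement (h : IsSplitFamily p s I J K f r F D E τ ω a b)
    {m n k : ℤ} (hm : m ∈ I) (hn : n ∈ J) (hk : k ∈ K) {υ : R42}
    (N : IsUnitNormal s (r m n) (F m n) υ) {x y : R42}
    (hx : x ∈ tangentElement p s (r m n) (F m n) υ (a k) (b k))
    (hy : y ∈ alternatingElement p s r F a b m n k) : OrthogonalSpheres p x y := by
  have H := h.frame hm hn
  rw [alternatingElement] at hy
  split_ifs at hy
  · exact H.orthogonal_orthElement N (h.ne_zero k hk) hx hy
  · obtain ⟨y, hy, rfl⟩ := hy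
    exact (H.orthogonal_orthElement N (h.ne_zero k hk) hx hy).lieInversion H.pp

/-- The contact element maps of the cyclic system. -/
noncomputable def system (p s : R42) (r F : ℤ → ℤ → R42) (τ ω : ℤ → R42) (a b : ℤ → ℝ) :
    Fin 3 → ℤ → ℤ → ℤ → Submodule ℝ R42 :=
  ![fun m n k => tangentElement p s (r m n) (F m n) (τ m) (a k) (b k),
    fun m n k => tangentElement p s (r m n) (F m n) (ω n) (a k) (b k),
    alternatingElement p s r F a b]

theorem allCoordinateSurfacesDupin (h : IsSplitFamily p s I J K f r F D E τ ω a b)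
    (hI : IsDiscreteInterval I) (hJ : IsDiscreteInterval J) (hK : IsDiscreteInterval K)
    (hG : ∀ k ∈ K, IsDupinCyclide I J fun m n => alternatingElement p s r F a b m n k) :
    AllCoordinateSurfacesDupin I J K (system p s r F τ ω a b) :=
  ⟨fun _ hm => h.isDupinCyclide_tangentElement hJ hK hm,
    fun _ hn => h.swap.isDupinCyclide_tangentElement hI hK hn, hG⟩

theorem isTriplyOrthogonalSystem (h : IsSplitFamily p s I J K f r F D E τ ω a b)
    (hI : IsDiscreteInterval I) (hJ : IsDiscreteInterval J) (hK : IsDiscreteInterval K)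
    (hG : ∀ k ∈ K, IsDupinCyclide I J fun m n => alternatingElement p s r F a b m n k) :
    IsTriplyOrthogonalSystem p I J K (system p s r F τ ω a b) where
  contact μ m hm n hn k hk := by
    fin_cases μ
    · exact (h.frame hm hn).isContactElement_tangentElement (h.split.normal_τ m hm n hn)
        (h.ne_zero k hk)
    · exact (h.frame hm hn).isContactElement_tangentElement (h.split.normal_ω m hm n hn)
        (h.ne_zero k hk)
    · exact h.isContactElement_alternatingElement hm hn hk
  point m hm n hn k hk := by
    have H := h.frame hm hn
    have N := h.split.normal_τ m hm n hn
    have M := h.split.normal_ω m hm n hn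
    have hne : tangentElement p s (r m n) (F m n) (τ m) (a k) (b k) ≠
        tangentElement p s (r m n) (F m n) (ω n) (a k) (b k) := by
      intro he
      have h1 : circleSphere p (r m n) (ω n) ∈
          tangentElement p s (r m n) (F m n) (τ m) (a k) (b k) := by
        rw [he]; exact Submodule.subset_span (by simp)
      have h2 := (H.isContactElement_tangentElement N (h.ne_zero k hk)).2
        (circleSphere p (r m n) (τ m)) (Submodule.subset_span (by simp)) _ h1
      rw [H.circleSphere_circleSphere N M (h.split.orthogonal m hm n hn)] at h2
      norm_num at h2
    have h01 : tangentElement p s (r m n) (F m n) (τ m) (a k) (b k) ⊓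
        tangentElement p s (r m n) (F m n) (ω n) (a k) (b k) =
        Submodule.span ℝ {circlePoint p s (r m n) (F m n) (a k) (b k)} :=
      inf_eq_span_singleton (H.isContactElement_tangentElement N (h.ne_zero k hk))
        (H.isContactElement_tangentElement M (h.ne_zero k hk)) hne
        (H.circlePoint_ne_zero (h.ne_zero k hk)) (Submodule.subset_span (by simp))
        (Submodule.subset_span (by simp))
    have h2 : Submodule.span ℝ {circlePoint p s (r m n) (F m n) (a k) (b k)} ≤
        alternatingElement p s r F a b m n k := by
      rw [← h.pointSphere_alternatingElement hm hn hk]; exact inf_le_left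
    have hall : system p s r F τ ω a b 0 m n k ⊓ system p s r F τ ω a b 1 m n k ⊓
        system p s r F τ ω a b 2 m n k =
        Submodule.span ℝ {circlePoint p s (r m n) (F m n) (a k) (b k)} := by
      change tangentElement p s (r m n) (F m n) (τ m) (a k) (b k) ⊓
        tangentElement p s (r m n) (F m n) (ω n) (a k) (b k) ⊓
        alternatingElement p s r F a b m n k = _
      rw [h01]
      exact inf_eq_left.2 h2
    rw [hall]
    refine ⟨isSphere_span_singleton (H.circlePoint_ne_zero (h.ne_zero k hk))
      (H.circlePoint_self _ _), ?_⟩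
    rw [Submodule.span_singleton_le_iff_mem]
    exact mem_perp_singleton.2 (H.circlePoint_p _ _)
  orthogonal μ ν hμν m hm n hn k hk x hx y hy := by
    have H := h.frame hm hn
    have N := h.split.normal_τ m hm n hn
    have M := h.split.normal_ω m hm n hn
    have ho := h.split.orthogonal m hm n hn
    fin_cases μ <;> fin_cases ν
    · exact absurd rfl hμν
    · exact H.orthogonal_tangentElement N M ho hx hy
    · exact h.orthogonal_alternatingElement hm hn hk N hx hy
    · exact (H.orthogonal_tangentElement N M ho hy hx).symm
    · exact absurd rfl hμν
    · exact h.orthogonal_alternatingElement hm hn hk M hx hy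
    · exact (h.orthogonal_alternatingElement hm hn hk N hy hx).symm
    · exact (h.orthogonal_alternatingElement hm hn hk M hy hx).symm
    · exact absurd rfl hμν
  edge₁ μ m n k hm hm' hn hk := by
    fin_cases μ
    · exact h.isSphere_edge hm hm' hn hk
    · exact (h.swap.isDupinCyclide_tangentElement hI hK hn).1.1.edge₁ m k hm hm' hk
    · exact (hG k hk).1.1.edge₁ m n hm hm' hn
  edge₂ μ m n k hm hn hn' hk := by
    fin_cases μ
    · exact (h.isDupinCyclide_tangentElement hJ hK hm).1.1.edge₁ n k hn hn' hk
    · exact h.swap.isSphere_edge hn hn' hm hk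
    · exact (hG k hk).1.1.edge₂ m n hm hn hn'
  edge₃ μ m n k hm hn hk hk' := by
    fin_cases μ
    · exact (h.isDupinCyclide_tangentElement hJ hK hm).1.1.edge₂ n k hn hk hk'
    · exact (h.swap.isDupinCyclide_tangentElement hI hK hn).1.1.edge₂ m k hm hk hk'
    · exact h.isSphere_alternatingElement hm hn hk hk'

end IsSplitFamily

/-- Regular families of orthogonal surfaces of a Dupin cyclide that is not totally umbilic extend to
cyclic systems. -/
theorem IsFramedNet.exists_cyclicSystem {p s : R42} {I J K : Set ℤ}
    {f u : ℤ → ℤ → Submodule ℝ R42} {r F : ℤ → ℤ → R42} (h : IsFramedNet p s I J f r F)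
    (hI : IsDiscreteInterval I) (hJ : IsDiscreteInterval J) (hK : IsDiscreteInterval K)
    (hf : IsDupinCyclide I J f) (hnu : ¬ IsTotallyUmbilic I J f)
    (hu : ∀ m ∈ I, ∀ n ∈ J, u m n = Submodule.span ℝ {s - lieForm s p • r m n, r m n})
    {g : ℤ → ℤ → ℤ → Submodule ℝ R42} (hg : IsRegularFamily p I J K f u r g) :
    ∃ Φ : Fin 3 → ℤ → ℤ → ℤ → Submodule ℝ R42, IsCyclicSystem p I J K Φ ∧
      (∀ k ∈ K, EqUpToOrientation p I J (fun m n => Φ 2 m n k) (g k)) ∧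
      AllCoordinateSurfacesDupin I J K Φ := by
  obtain ⟨D, E, τ, ω, hS⟩ := h.exists_isSplitNet hI hJ hf hnu
  obtain ⟨m₀, hm₀⟩ := hI.nonempty
  obtain ⟨n₀, hn₀⟩ := hJ.nonempty
  have hp := (h.frame m₀ hm₀ n₀ hn₀).pp
  have hp0 : lieForm p p ≠ 0 := by rw [hp]; norm_num
  choose! a b hab hG using fun k (hk : k ∈ K) => h.exists_eq_orthElement hI hJ hu (hg.surface k hk)
  have hpt : ∀ m ∈ I, ∀ n ∈ J, ∀ k ∈ K, pointSphere p (g k m n) =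
      Submodule.span ℝ {circlePoint p s (r m n) (F m n) (a k) (b k)} := by
    intro m hm n hn k hk
    rw [← (h.frame m hm n hn).pointSphere_orthElement (hab k hk)]
    rcases hG k hk with hk' | hk'
    · rw [hk' m hm n hn]
    · rw [hk' m hm n hn, pointSphere_map_lieInversion hp]
  have hF : IsSplitFamily p s I J K f r F D E τ ω a b :=
    { split := hS
      ne_zero := hab
      ne₁ := fun m n k hm hm' hn hk => by
        rw [← hpt m hm n hn k hk, ← hpt _ hm' n hn k hk]
        exact hg.distinct₁ m n k hm hm' hn hk
      ne₂ := fun m n k hm hn hn' hk => by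
        rw [← hpt m hm n hn k hk, ← hpt m hm _ hn' k hk]
        exact hg.distinct₂ m n k hm hn hn' hk
      ne₃ := fun m n k hm hn hk hk' => by
        rw [← hpt m hm n hn k hk, ← hpt m hm n hn _ hk']
        exact hg.distinct₃ m n k hm hn hk hk' }
  have hEq : ∀ k ∈ K, EqUpToOrientation p I J
      (fun m n => IsSplitFamily.alternatingElement p s r F a b m n k) (g k) := by
    intro k hk
    by_cases hev : Even k
    · simp only [IsSplitFamily.alternatingElement, if_pos hev]
      rcases hG k hk with hk' | hk'
      · exact Or.inl fun m hm n hn => (hk' m hm n hn).symm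
      · exact Or.inr fun m hm n hn => by rw [hk' m hm n hn, map_lieInversion_map hp0]
    · simp only [IsSplitFamily.alternatingElement, if_neg hev]
      rcases hG k hk with hk' | hk'
      · exact Or.inr fun m hm n hn => by rw [hk' m hm n hn]
      · exact Or.inl fun m hm n hn => (hk' m hm n hn).symm
  have hDup : ∀ k ∈ K, IsDupinCyclide I J
      fun m n => IsSplitFamily.alternatingElement p s r F a b m n k := by
    intro k hk
    have hgk := h.isDupinCyclide_of_isOrthogonalSurface hI hJ hf hu (hg.surface k hk)
    rcases hEq k hk with hk' | hk'
    · exact hgk.congr hk'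
    · exact hgk.map (reversal_isometry hp) hk'
  have hall := hF.allCoordinateSurfacesDupin hI hJ hK hDup
  exact ⟨_, ⟨hF.isTriplyOrthogonalSystem hI hJ hK hDup, fun m hm => (hall.1 m hm).2,
    fun n hn => (hall.2.1 n hn).2⟩, hEq, hall⟩

theorem mainTheorem5 (p : R42) (hp : lieForm p p = -1)
    (I J : Set ℤ) (hI : IsDiscreteInterval I) (hJ : IsDiscreteInterval J)
    (f u : ℤ → ℤ → Submodule ℝ R42) (r : ℤ → ℤ → R42)
    (hf : IsDupinCyclide I J f) (hu : IsTotallyUmbilic I J u)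
    (hr : IsRibaucourPair p I J f u r) :
    (∀ g : ℤ → ℤ → Submodule ℝ R42,
      IsOrthogonalSurface p I J f u r g → IsDupinCyclide I J g) ∧
    (∀ K : Set ℤ, IsDiscreteInterval K →
      (∃ g : ℤ → ℤ → ℤ → Submodule ℝ R42, IsRegularFamily p I J K f u r g) ∧
      (¬ IsTotallyUmbilic I J f →
        ∀ g : ℤ → ℤ → ℤ → Submodule ℝ R42, IsRegularFamily p I J K f u r g →
          ∃ F : Fin 3 → ℤ → ℤ → ℤ → Submodule ℝ R42,
            IsCyclicSystem p I J K F ∧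
            (∀ k ∈ K, EqUpToOrientation p I J (fun m n => F 2 m n k) (g k)) ∧
            AllCoordinateSurfacesDupin I J K F)) := by
  obtain ⟨s, F, h, hu'⟩ := hr.exists_isFramedNet hp hI hu
  obtain ⟨m₀, hm₀⟩ := hI.nonempty
  obtain ⟨n₀, hn₀⟩ := hJ.nonempty
  have hs := (h.frame m₀ hm₀ n₀ hn₀).ss
  exact ⟨fun g hg => h.isDupinCyclide_of_isOrthogonalSurface hI hJ hf hu' hg,
    fun K hK => ⟨h.exists_isRegularFamily hp hs hu' K,
      fun hnu g hg => h.exists_cyclicSystem hI hJ hK hf hnu hu' hg⟩⟩
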